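/- **Theorem 6.3.** Let $H^s=H^s(\mathbb R)$, $s\in\mathbb R$, be the $L^2$-based Sobolev space of real-valued (tempered) distributions on $\mathbb R$, and let $\mathcal F$ be the Fourier transform in $x$ (normalized so that $\partial_x^2$ has the symbol $-\xi^2$). Let $\rho\ge 0$, $r\ge 0$ satisfy $$r+\tfrac{\rho}{2}\ge 1,\qquad s:=\tfrac r2+\tfrac\rho2>\tfrac12 .$$ Let $L$, $B$ be the operators $\mathcal F(Lv)=l\,\mathcal F v$, $\mathcal F(Bv)=b\,\mathcal F v$, where $l,b:\mathbb R\to\mathbb R$ are measurable and even and, for some constants $c_1,c_2,c_3>0$ and all $\xi\in\mathbb R$, $$c_1^2(1+\xi^2)^{\rho/2}\le l(\xi)\le c_2^2(1+\xi^2)^{\rho/2},\qquad 0<b(\xi)\le c_3^2(1+\xi^2)^{-r/2}.$$ Let $g\in C^{[s]+1}(\mathbb R)$ be real-valued, $G(u)=\int_0^u g(p)\,dp$, and let $\varphi\in H^{s}$, $\psi\in H^{\frac r2-1}$ be such that $\Lambda^{-1}\psi:=\mathcal F^{-1}\big(|\xi|^{-1}\mathcal F\psi\big)\in L^2$, $G(\varphi)\in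 L^1$, and $G(v)\ge 0$ for all $v\in\mathbb R$. Suppose moreover that $B$ is elliptic of order $-r$, i.e. $b(\xi)\ge c_4^2(1+\xi^2)^{-r/2}$ for some $c_4>0$ and all $\xi$, or, if it is not, that the initial energy is finite, i.e. $\mathcal F^{-1}\big(b^{-1/2}l^{1/2}\mathcal F\varphi\big)\in L^2$ and $\mathcal F^{-1}\big(b^{-1/2}|\xi|^{-1}\mathcal F\psi\big)\in L^2$. Then the Cauchy problem $$u_{tt}-Lu_{xx}=B(g(u))_{xx}\quad(x\in\mathbb R,\ t>0),\qquad u(x,0)=\varphi(x),\quad u_t(x,0)=\psi(x),$$ has a unique global solution $u\in C([0,\infty),H^{s})\cap C^1([0,\infty),H^{\frac r2-1})$, where for each $t>0$ the equation holds in the sense of tempered distributions in $x$. -/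

import Mathlib

open MeasureTheory Set FourierTransform
open scoped SchwartzMap ENNReal

noncomputable section

namespace DoublyDispersive

/-- The tempered distribution `u` is the (locally integrable) function `f`:
`⟨u, η⟩ = ∫ η f` for every Schwartz function `η`, with absolutely convergent integrals. Such an `f`
is unique up to a null set. -/
def RepresentedBy (u : 𝓢'(ℝ, ℂ)) (f : ℝ → ℂ) : Prop :=
  ∀ η : 𝓢(ℝ, ℂ), Integrable (fun x => η x * f x) ∧ u η = ∫ x, η x * f x

/-- `v = F⁻¹ (m(ξ) F u)`, for a measurable real symbol `m` and a tempered distribution `u` whose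
Fourier transform is a function. The symbol is a function of the angular frequency, so that
`∂ₓ²` has the symbol `-ξ²`; as `𝓕` has the kernel `exp (-2πixξ)`, this is the multiplication by
`m (2πξ)` on the side of `𝓕`. -/
def IsMultiplier (m : ℝ → ℝ) (u v : 𝓢'(ℝ, ℂ)) : Prop :=
  ∃ f : ℝ → ℂ, RepresentedBy (𝓕 u) f ∧
    RepresentedBy (𝓕 v) (fun ξ => (m (2 * Real.pi * ξ) : ℂ) * f ξ)

/-- `F⁻¹ (m(ξ) F u) ∈ L²`. -/
def MultiplierMemL2 (m : ℝ → ℝ) (u : 𝓢'(ℝ, ℂ)) : Prop :=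
  ∃ w : Lp ℂ 2 (volume : Measure ℝ), IsMultiplier m u (w : 𝓢'(ℝ, ℂ))

/-- A tempered distribution is real if it is real on real test functions. -/
def IsRealDistribution (u : 𝓢'(ℝ, ℂ)) : Prop :=
  ∀ η : 𝓢(ℝ, ℂ), (∀ x, (η x).im = 0) → (u η).im = 0

/-- The second derivative `u_xx` of a tempered distribution. -/
def dxx (u : 𝓢'(ℝ, ℂ)) : 𝓢'(ℝ, ℂ) :=
  TemperedDistribution.derivCLM ℂ (TemperedDistribution.derivCLM ℂ u)

/-- The real distributions of the `L²` Sobolev class of order `s`. -/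
def sobolevSubmodule (s : ℝ) : Submodule ℝ 𝓢'(ℝ, ℂ) where
  carrier := {u | IsRealDistribution u ∧ TemperedDistribution.MemSobolev s 2 u}
  zero_mem' := ⟨fun _ _ => by simp, TemperedDistribution.memSobolev_fun_zero ℝ ℂ s 2⟩
  add_mem' := fun {u v} hu hv =>
    ⟨fun η hη => by simp [hu.1 η hη, hv.1 η hη], hu.2.add hv.2⟩
  smul_mem' := fun c u hu =>
    ⟨fun η hη => by simp [hu.1 η hη], hu.2.smul (c : ℂ)⟩

/-- The real Sobolev space `H^s(ℝ)`, `s ∈ ℝ`, as a space of tempered distributions. (It is a type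
of its own, so that it carries the topology of its norm and not that of `𝓢'`.) -/
def Sobolev (s : ℝ) : Type := sobolevSubmodule s

namespace Sobolev

variable {s : ℝ}

instance : AddCommGroup (Sobolev s) := inferInstanceAs (AddCommGroup (sobolevSubmodule s))

instance : Module ℝ (Sobolev s) := inferInstanceAs (Module ℝ (sobolevSubmodule s))

/-- The underlying distribution. -/
def toDist (u : Sobolev s) : 𝓢'(ℝ, ℂ) := Subtype.val u

theorem toDist_injective : Function.Injective (toDist (s := s)) := Subtype.val_injective

@[simp] theorem toDist_zero : (0 : Sobolev s).toDist = 0 := rfl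

@[simp] theorem toDist_add (u v : Sobolev s) : (u + v).toDist = u.toDist + v.toDist := rfl

@[simp] theorem toDist_smul (c : ℝ) (u : Sobolev s) : (c • u).toDist = c • u.toDist := rfl

theorem isReal (u : Sobolev s) : IsRealDistribution u.toDist := u.2.1

theorem memSobolev (u : Sobolev s) : TemperedDistribution.MemSobolev s 2 u.toDist := u.2.2

theorem lp_toDist_injective {f g : Lp ℂ 2 (volume : Measure ℝ)}
    (h : (f : 𝓢'(ℝ, ℂ)) = (g : 𝓢'(ℝ, ℂ))) : f = g := by
  have hk := Lp.ker_toTemperedDistributionCLM_eq_bot (E := ℝ) (F := ℂ)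
    (μ := (volume : Measure ℝ)) (p := 2)
  exact LinearMap.ker_eq_bot.mp hk h

/-- The Bessel potential of an element of `H^s`, as an element of `L²`. -/
def besselFun (u : Sobolev s) : Lp ℂ 2 (volume : Measure ℝ) := u.memSobolev.choose

theorem besselFun_spec (u : Sobolev s) :
    TemperedDistribution.besselPotential ℝ ℂ s u.toDist = (besselFun u : 𝓢'(ℝ, ℂ)) :=
  u.memSobolev.choose_spec

/-- The Bessel potential of order `s` as a linear map from `H^s` to `L²`. -/
def bessel (s : ℝ) : Sobolev s →ₗ[ℝ] Lp ℂ 2 (volume : Measure ℝ) where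
  toFun u := besselFun u
  map_add' u v := by
    apply lp_toDist_injective
    rw [← besselFun_spec, toDist_add, map_add, besselFun_spec, besselFun_spec]
    exact (map_add (Lp.toTemperedDistributionCLM ℂ (volume : Measure ℝ) 2) _ _).symm
  map_smul' c u := by
    apply lp_toDist_injective
    have h1 : c • u.toDist = (c : ℂ) • u.toDist := rfl
    rw [← besselFun_spec, toDist_smul, h1, map_smul, besselFun_spec]
    exact (map_smul (Lp.toTemperedDistributionCLM ℂ (volume : Measure ℝ) 2) (c : ℂ) _).symm

theorem bessel_spec (u : Sobolev s) :
    TemperedDistribution.besselPotential ℝ ℂ s u.toDist = (bessel s u : 𝓢'(ℝ, ℂ)) :=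
  besselFun_spec u

theorem bessel_injective (s : ℝ) : Function.Injective (bessel s) := by
  intro u v h
  apply toDist_injective
  have h1 : TemperedDistribution.besselPotential ℝ ℂ s u.toDist =
      TemperedDistribution.besselPotential ℝ ℂ s v.toDist := by
    rw [bessel_spec, bessel_spec, h]
  rw [← TemperedDistribution.besselPotential_neg_apply_eq_iff] at h1
  rw [← h1]
  simp

/-- The norm of `H^s`: the square of the norm of `u` is `∫ (1 + ξ²)^s |(𝓕 u)(ξ)|² dξ`. -/
instance : NormedAddCommGroup (Sobolev s) :=
  NormedAddCommGroup.induced (Sobolev s) (Lp ℂ 2 (volume : Measure ℝ)) (bessel s)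
    (bessel_injective s)

instance : NormedSpace ℝ (Sobolev s) :=
  NormedSpace.induced ℝ (Sobolev s) (Lp ℂ 2 (volume : Measure ℝ)) (bessel s)

end Sobolev

/-- `u` solves `u_tt - L u_xx = B (g(u))_xx` at time `t`, where `ut` is the time derivative of `u`
and `l`, `b` are the symbols of `L`, `B`: `u(t)` is a real function `f`, `g(f)` is a tempered
distribution, and the time derivative of `ut` at `t`, in the sense of tempered distributions in
`x`, is `L u_xx + B (g(u))_xx`. -/
def SolvesAt (l b g : ℝ → ℝ) (u ut : ℝ → 𝓢'(ℝ, ℂ)) (t : ℝ) : Prop :=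
  ∃ (f : ℝ → ℝ) (gu Luxx Bgxx : 𝓢'(ℝ, ℂ)),
    RepresentedBy (u t) (fun x => (f x : ℂ)) ∧
    RepresentedBy gu (fun x => (g (f x) : ℂ)) ∧
    IsMultiplier l (dxx (u t)) Luxx ∧
    IsMultiplier b (dxx gu) Bgxx ∧
    ∀ η : 𝓢(ℝ, ℂ), HasDerivAt (fun τ => ut τ η) (Luxx η + Bgxx η) t

/-- `u` is in `C([0,∞), H^s) ∩ C¹([0,∞), H^σ)` and solves the Cauchy problem
`u_tt - L u_xx = B (g(u))_xx` for `t > 0`, `u(0) = φ`, `u_t(0) = ψ`. Here `v` is `u` as an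
`H^σ`-valued function and `vt` is its derivative; the values at `t < 0` play no role. -/
def IsGlobalSolution (l b g : ℝ → ℝ) {s σ : ℝ} (φ : Sobolev s) (ψ : Sobolev σ)
    (u : ℝ → Sobolev s) : Prop :=
  ContinuousOn u (Ici 0) ∧ u 0 = φ ∧
  ∃ v vt : ℝ → Sobolev σ,
    (∀ t ∈ Ici (0 : ℝ), (v t).toDist = (u t).toDist) ∧
    (∀ t ∈ Ici (0 : ℝ), HasDerivWithinAt v (vt t) (Ici 0) t) ∧
    ContinuousOn vt (Ici 0) ∧ vt 0 = ψ ∧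
    ∀ t ∈ Ioi (0 : ℝ), SolvesAt l b g (fun τ => (u τ).toDist) (fun τ => (vt τ).toDist) t

end DoublyDispersive

end

/-!
The equation is treated on the side of the Fourier transform. Let `ω = |ξ| l^(1/2)` be the
dispersion relation and put `Z = 𝓕u + i ω⁻¹ 𝓕u_t`. The Cauchy problem becomes the first order
equation `Z' = -i ω Z - i k N(Z)`, with the bounded symbol `k = |ξ| b l^(-1/2)` (this is where
`r + ρ/2 ≥ 1` enters) and `N(Z) = 𝓕(g(Re 𝓕⁻¹ Z))`.

The nonlinearity is first replaced by a globally Lipschitz one that agrees with `g` on `[-M, M]` and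
still has a nonnegative primitive (`exists_lipschitz_truncation`). Then `N` is Lipschitz on `L²`, and
in the interaction picture `exp (i t ω) Z` the equation is an ordinary differential equation in `L²`,
which has a global solution (`exists_isMildSolution`). With `a = (b/l)^(1/2)` and `Z = a Y`, the
energy is `‖Y‖²/2 + ∫ G(u)`. If `Y` is in `L²` initially, it stays so, and the energy is conserved
(`exists_isMildSolution_energy`): this is proved with cut-offs to the frequencies where `ω` and `1/a`
are bounded, for which the energy identity is elementary. As the potential is nonnegative, it
follows that `‖Y‖` is bounded in time by the initial energy. Since `(1 + ξ²)^(s/2) a` is bounded,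
this bounds the norm of `u` in `H^s` and, by the Sobolev embedding, its supremum. The initial energy
does not depend on the truncation as long as `M` is at least the supremum of `φ`, so that `M` can be
chosen beforehand so large that the solution never leaves `[-M, M]`
(`IsSymbolPair.exists_isGlobalSolution`).

For the uniqueness (`IsSymbolPair.unique`), two solutions are bounded on a compact time interval, so
that `g` may again be replaced by a Lipschitz function. The weak equation determines the derivative of
`u_t` in a weighted `L²` space (`hasDerivAt_of_pair`), and on bounded frequencies away from `ξ = 0`
the difference of the solutions satisfies an energy estimate with constants that do not depend on
the cut-off (`norm_proj_sq_le_integral`); Grönwall's lemma concludes.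

If `B` is elliptic, the finiteness of the initial energy follows from the regularity of `φ` and `ψ`
and from `Λ⁻¹ψ ∈ L²` (`IsSymbolPair.memLp_of_elliptic`).
-/

noncomputable section

namespace DoublyDispersive

/-! ### Global solutions of Lipschitz differential equations -/

section GlobalODE

variable {E : Type*} [NormedAddCommGroup E] [NormedSpace ℝ E]

theorem norm_integral_le_of_le_exp_of_nonneg {f : ℝ → E} {lam C : ℝ} (hlam : 0 < lam)
    (hC : 0 ≤ C) (h : ∀ τ, ‖f τ‖ ≤ C * Real.exp (lam * |τ|)) {t : ℝ} (ht : 0 ≤ t) :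
    ‖∫ τ in (0 : ℝ)..t, f τ‖ ≤ C / lam * Real.exp (lam * t) := by
  have h1 : ‖∫ τ in (0 : ℝ)..t, f τ‖ ≤ ∫ τ in (0 : ℝ)..t, C * Real.exp (lam * τ) := by
    refine intervalIntegral.norm_integral_le_of_norm_le ht ?_
      (Continuous.intervalIntegrable (by fun_prop) _ _)
    refine Filter.Eventually.of_forall fun τ hτ => ?_
    have := h τ
    rwa [abs_of_pos hτ.1] at this
  have h2 : ∫ τ in (0 : ℝ)..t, C * Real.exp (lam * τ) =
      C / lam * Real.exp (lam * t) - C / lam * Real.exp (lam * 0) := by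
    refine intervalIntegral.integral_eq_sub_of_hasDerivAt
      (f := fun τ => C / lam * Real.exp (lam * τ)) (fun x _ => ?_)
      (Continuous.intervalIntegrable (by fun_prop) _ _)
    have h3 : HasDerivAt (fun τ : ℝ => lam * τ) lam x := by
      simpa using (hasDerivAt_id x).const_mul lam
    refine (h3.exp.const_mul (C / lam)).congr_deriv ?_
    field_simp
  rw [h2] at h1
  have h4 : 0 ≤ C / lam * Real.exp (lam * 0) := by positivity
  linarith

theorem norm_integral_le_of_le_exp {f : ℝ → E} {lam C : ℝ} (hlam : 0 < lam)
    (hC : 0 ≤ C) (h : ∀ τ, ‖f τ‖ ≤ C * Real.exp (lam * |τ|)) (t : ℝ) :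
    ‖∫ τ in (0 : ℝ)..t, f τ‖ ≤ C / lam * Real.exp (lam * |t|) := by
  rcases le_total 0 t with ht | ht
  · rw [abs_of_nonneg ht]
    exact norm_integral_le_of_le_exp_of_nonneg hlam hC h ht
  · have h1 := norm_integral_le_of_le_exp_of_nonneg (f := fun τ => f (-τ)) hlam hC
      (fun τ => by simpa using h (-τ)) (neg_nonneg.mpr ht)
    rw [intervalIntegral.integral_comp_neg, intervalIntegral.integral_symm, norm_neg] at h1
    rw [abs_of_nonpos ht]
    simpa using h1

/-- A time-dependent vector field that is continuous, uniformly Lipschitz and vanishes at `0` has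
integral curves defined for all times. The fixed point argument takes place in the bounded
continuous functions `v`, which stand for the curves `exp (λ|t|) v(t)`; the weight makes
the Picard map a contraction on the whole line. -/
theorem exists_forall_hasDerivAt [CompleteSpace E] {F : ℝ → E → E} {K : NNReal}
    (hF : Continuous (Function.uncurry F)) (hK : ∀ t, LipschitzWith K (F t))
    (h0 : ∀ t, F t 0 = 0) (x₀ : E) :
    ∃ x : ℝ → E, x 0 = x₀ ∧ ∀ t, HasDerivAt x (F t (x t)) t := by
  set lam : ℝ := K + 1 with hlam
  have hlam0 : 0 < lam := by positivity
  have hbd : ∀ (v w : BoundedContinuousFunction ℝ E) (τ : ℝ),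
      ‖F τ (Real.exp (lam * |τ|) • v τ) - F τ (Real.exp (lam * |τ|) • w τ)‖ ≤
        (K * ‖v - w‖) * Real.exp (lam * |τ|) := by
    intro v w τ
    have h1 := (hK τ).dist_le_mul (Real.exp (lam * |τ|) • v τ) (Real.exp (lam * |τ|) • w τ)
    rw [dist_eq_norm, dist_eq_norm, ← smul_sub, norm_smul, Real.norm_eq_abs, Real.abs_exp] at h1
    have h2 : ‖v τ - w τ‖ ≤ ‖v - w‖ := (v - w).norm_coe_le_norm τ
    calc _ ≤ _ := h1
      _ ≤ K * (Real.exp (lam * |τ|) * ‖v - w‖) := by gcongr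
      _ = _ := by ring
  have hcont : ∀ v : BoundedContinuousFunction ℝ E,
      Continuous fun τ => F τ (Real.exp (lam * |τ|) • v τ) := fun v =>
    hF.comp (continuous_id.prodMk (Continuous.smul (by fun_prop) v.continuous))
  have hcontI : ∀ v : BoundedContinuousFunction ℝ E,
      Continuous fun t => ∫ τ in (0 : ℝ)..t, F τ (Real.exp (lam * |τ|) • v τ) := fun v =>
    intervalIntegral.continuous_primitive (fun a b => (hcont v).intervalIntegrable a b) 0
  have hexp : ∀ t : ℝ, Real.exp (-(lam * |t|)) * Real.exp (lam * |t|) = 1 := fun t => by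
    rw [← Real.exp_add]; simp
  let Φ : BoundedContinuousFunction ℝ E → BoundedContinuousFunction ℝ E := fun v =>
    BoundedContinuousFunction.ofNormedAddCommGroup
      (fun t => Real.exp (-(lam * |t|)) •
        (x₀ + ∫ τ in (0 : ℝ)..t, F τ (Real.exp (lam * |τ|) • v τ)))
      (Continuous.smul (by fun_prop) (continuous_const.add (hcontI v)))
      (‖x₀‖ + K * ‖v‖ / lam) (by
        intro t
        have h1 := norm_integral_le_of_le_exp (f := fun τ => F τ (Real.exp (lam * |τ|) • v τ))
          hlam0 (C := K * ‖v‖) (by positivity)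
          (fun τ => by simpa [h0] using hbd v 0 τ) t
        have h3 : Real.exp (-(lam * |t|)) ≤ 1 := Real.exp_le_one_iff.mpr (by
          have : 0 ≤ lam * |t| := by positivity
          linarith)
        rw [norm_smul, Real.norm_eq_abs, Real.abs_exp]
        calc _ ≤ Real.exp (-(lam * |t|)) *
              (‖x₀‖ + K * ‖v‖ / lam * Real.exp (lam * |t|)) := by
              gcongr
              exact (norm_add_le _ _).trans (by gcongr)
          _ = Real.exp (-(lam * |t|)) * ‖x₀‖ +
              K * ‖v‖ / lam * (Real.exp (-(lam * |t|)) * Real.exp (lam * |t|)) := by ring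
          _ ≤ 1 * ‖x₀‖ + K * ‖v‖ / lam * 1 := by
              rw [hexp]; gcongr
          _ = _ := by ring)
  have hΦ : ContractingWith (K / (K + 1)) Φ := by
    refine ⟨?_, LipschitzWith.of_dist_le_mul fun v w => ?_⟩
    · rw [div_lt_one (by positivity)]; exact lt_add_one K
    · rw [dist_eq_norm, dist_eq_norm,
        BoundedContinuousFunction.norm_le (by positivity)]
      intro t
      have h1 := norm_integral_le_of_le_exp
        (f := fun τ => F τ (Real.exp (lam * |τ|) • v τ) - F τ (Real.exp (lam * |τ|) • w τ))
        hlam0 (C := K * ‖v - w‖) (by positivity) (fun τ => hbd v w τ) t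
      have h2 : (Φ v - Φ w) t = Real.exp (-(lam * |t|)) • ∫ τ in (0 : ℝ)..t,
          (F τ (Real.exp (lam * |τ|) • v τ) - F τ (Real.exp (lam * |τ|) • w τ)) := by
        rw [intervalIntegral.integral_sub ((hcont v).intervalIntegrable _ _)
          ((hcont w).intervalIntegrable _ _)]
        simp only [Φ, BoundedContinuousFunction.coe_sub, Pi.sub_apply,
          BoundedContinuousFunction.coe_ofNormedAddCommGroup]
        rw [← smul_sub]; congr 1; abel
      rw [h2, norm_smul, Real.norm_eq_abs, Real.abs_exp]
      calc _ ≤ Real.exp (-(lam * |t|)) * (K * ‖v - w‖ / lam * Real.exp (lam * |t|)) := by gcongr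
        _ = K * ‖v - w‖ / lam * (Real.exp (-(lam * |t|)) * Real.exp (lam * |t|)) := by ring
        _ = _ := by rw [hexp]; push_cast; rw [hlam]; ring
  set v := hΦ.fixedPoint Φ with hv
  have hfix : ∀ t, v t = Real.exp (-(lam * |t|)) •
      (x₀ + ∫ τ in (0 : ℝ)..t, F τ (Real.exp (lam * |τ|) • v τ)) := fun t => by
    have h1 : Φ v = v := hΦ.fixedPoint_isFixedPt
    conv_lhs => rw [← h1]
    rfl
  have hx : ∀ t, Real.exp (lam * |t|) • v t =
      x₀ + ∫ τ in (0 : ℝ)..t, F τ (Real.exp (lam * |τ|) • v τ) := fun t => by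
    conv_lhs => rw [hfix t]
    rw [smul_smul, mul_comm, hexp, one_smul]
  refine ⟨fun t => Real.exp (lam * |t|) • v t, by simp [hfix 0], fun t => ?_⟩
  have h1 : (fun t => Real.exp (lam * |t|) • v t) =
      fun t => x₀ + ∫ τ in (0 : ℝ)..t, F τ (Real.exp (lam * |τ|) • v τ) := funext hx
  have h2 := ((hcont v).integral_hasStrictDerivAt 0 t).hasDerivAt.const_add x₀
  rwa [← h1] at h2

end GlobalODE

/-! ### Bounded multiplication operators on `L²` -/

section Multiplication

open Filter Topology

variable {α : Type*} [MeasurableSpace α] {μ : Measure α}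

/-- A bounded measurable symbol, bounded everywhere and not only almost everywhere. -/
def IsBddSymbol (a : α → ℂ) : Prop := Measurable a ∧ ∃ C : ℝ, ∀ x, ‖a x‖ ≤ C

theorem IsBddSymbol.memLp {a : α → ℂ} (ha : IsBddSymbol a) (f : Lp ℂ 2 μ) :
    MemLp (fun x => a x * f x) 2 μ := by
  obtain ⟨hm, C, hC⟩ := ha
  refine MemLp.of_le_mul (Lp.memLp f) (c := C)
    (hm.aestronglyMeasurable.mul (Lp.aestronglyMeasurable f)) (Eventually.of_forall fun x => ?_)
  rw [norm_mul]
  exact mul_le_mul_of_nonneg_right (hC x) (norm_nonneg _)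

theorem IsBddSymbol.mul {a b : α → ℂ} (ha : IsBddSymbol a) (hb : IsBddSymbol b) :
    IsBddSymbol (fun x => a x * b x) := by
  obtain ⟨hm, C, hC⟩ := ha
  obtain ⟨hm', C', hC'⟩ := hb
  refine ⟨hm.mul hm', C * C', fun x => ?_⟩
  rw [norm_mul]
  exact mul_le_mul (hC x) (hC' x) (norm_nonneg _) ((norm_nonneg _).trans (hC x))

theorem IsBddSymbol.conj {a : α → ℂ} (ha : IsBddSymbol a) :
    IsBddSymbol (fun x => starRingEnd ℂ (a x)) :=
  ⟨Complex.continuous_conj.measurable.comp ha.1, ha.2.imp fun C hC x => by simpa using hC x⟩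

theorem IsBddSymbol.const (c : ℂ) : IsBddSymbol (fun _ : α => c) :=
  ⟨measurable_const, ‖c‖, fun _ => le_rfl⟩

theorem IsBddSymbol.sub {a b : α → ℂ} (ha : IsBddSymbol a) (hb : IsBddSymbol b) :
    IsBddSymbol (fun x => a x - b x) := by
  obtain ⟨hm, C, hC⟩ := ha
  obtain ⟨hm', C', hC'⟩ := hb
  exact ⟨hm.sub hm', C + C', fun x => (norm_sub_le _ _).trans (add_le_add (hC x) (hC' x))⟩

theorem IsBddSymbol.indicator {a : α → ℂ} (ha : IsBddSymbol a) {A : Set α}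
    (hA : MeasurableSet A) : IsBddSymbol (A.indicator a) := by
  obtain ⟨hm, C, hC⟩ := ha
  exact ⟨hm.indicator hA, C, fun x => (norm_indicator_le_norm_self _ _).trans (hC x)⟩

open Classical in
/-- Multiplication by a bounded symbol, as an operator on `L²`; for other symbols it is `0`. -/
def mulOp (a : α → ℂ) : Lp ℂ 2 μ →L[ℂ] Lp ℂ 2 μ :=
  if ha : IsBddSymbol a then
    LinearMap.mkContinuousOfExistsBound
      { toFun := fun f => (ha.memLp f).toLp _
        map_add' := fun f g => by
          rw [← MemLp.toLp_add, MemLp.toLp_eq_toLp_iff]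
          filter_upwards [Lp.coeFn_add f g] with x hx
          simp only [hx, Pi.add_apply, mul_add]
        map_smul' := fun c f => by
          rw [RingHom.id_apply, ← MemLp.toLp_const_smul, MemLp.toLp_eq_toLp_iff]
          filter_upwards [Lp.coeFn_smul c f] with x hx
          simp only [hx, Pi.smul_apply, smul_eq_mul]
          ring }
      (by
        obtain ⟨C, hC⟩ := ha.2
        refine ⟨C, fun f => Lp.norm_le_mul_norm_of_ae_le_mul ?_⟩
        filter_upwards [(ha.memLp f).coeFn_toLp] with x hx
        simp only [LinearMap.coe_mk, AddHom.coe_mk, hx, norm_mul]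
        exact mul_le_mul_of_nonneg_right (hC x) (norm_nonneg _))
  else 0

theorem coeFn_mulOp {a : α → ℂ} (ha : IsBddSymbol a) (f : Lp ℂ 2 μ) :
    mulOp a f =ᵐ[μ] fun x => a x * f x := by
  have h : mulOp a f = (ha.memLp f).toLp _ := by
    rw [mulOp, dif_pos ha]; rfl
  rw [h]
  exact (ha.memLp f).coeFn_toLp

theorem norm_mulOp_le {a : α → ℂ} (ha : IsBddSymbol a) {C : ℝ} (hC : ∀ x, ‖a x‖ ≤ C)
    (f : Lp ℂ 2 μ) : ‖mulOp a f‖ ≤ C * ‖f‖ := by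
  refine Lp.norm_le_mul_norm_of_ae_le_mul ?_
  filter_upwards [coeFn_mulOp ha f] with x hx
  rw [hx, norm_mul]
  exact mul_le_mul_of_nonneg_right (hC x) (norm_nonneg _)

theorem norm_mulOp_le_one {a : α → ℂ} (ha : Measurable a) (hC : ∀ x, ‖a x‖ ≤ 1)
    (f : Lp ℂ 2 μ) : ‖mulOp a f‖ ≤ ‖f‖ := by
  simpa using norm_mulOp_le ⟨ha, 1, hC⟩ hC f

/-- Two products of bounded symbols that agree pointwise give the same operator. -/
theorem mulOp_mulOp_eq {a b c : α → ℂ} (ha : IsBddSymbol a) (hb : IsBddSymbol b)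
    (h : ∀ x, c x = a x * b x) (f : Lp ℂ 2 μ) : mulOp a (mulOp b f) = mulOp c f := by
  have hc : IsBddSymbol c := by
    have : c = fun x => a x * b x := funext h
    exact this ▸ ha.mul hb
  refine Lp.ext ?_
  filter_upwards [coeFn_mulOp ha (mulOp b f), coeFn_mulOp hb f, coeFn_mulOp hc f] with x h1 h2 h3
  rw [h1, h2, h3, h x, mul_assoc]

theorem mulOp_comm {a b : α → ℂ} (ha : IsBddSymbol a) (hb : IsBddSymbol b) (f : Lp ℂ 2 μ) :
    mulOp a (mulOp b f) = mulOp b (mulOp a f) := by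
  rw [mulOp_mulOp_eq ha hb (fun _ => rfl), mulOp_mulOp_eq hb ha (fun x => mul_comm (a x) (b x))]

theorem mulOp_one (f : Lp ℂ 2 μ) : mulOp (fun _ => 1) f = f := by
  refine Lp.ext ?_
  filter_upwards [coeFn_mulOp (IsBddSymbol.const 1) f] with x hx
  rw [hx, one_mul]

theorem mulOp_const_mul {a : α → ℂ} (ha : IsBddSymbol a) (c : ℂ) (f : Lp ℂ 2 μ) :
    mulOp (fun x => c * a x) f = c • mulOp a f := by
  refine Lp.ext ?_
  filter_upwards [coeFn_mulOp ((IsBddSymbol.const c).mul ha) f, coeFn_mulOp ha f,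
    Lp.coeFn_smul c (mulOp a f)] with x h1 h2 h3
  rw [h1, h3, Pi.smul_apply, h2, smul_eq_mul, mul_assoc]

theorem mulOp_sub_symbol {a b : α → ℂ} (ha : IsBddSymbol a) (hb : IsBddSymbol b) (f : Lp ℂ 2 μ) :
    mulOp (fun x => a x - b x) f = mulOp a f - mulOp b f := by
  refine Lp.ext ?_
  filter_upwards [coeFn_mulOp (ha.sub hb) f, coeFn_mulOp ha f, coeFn_mulOp hb f,
    Lp.coeFn_sub (mulOp a f) (mulOp b f)] with x h1 h2 h3 h4
  rw [h1, h4, Pi.sub_apply, h2, h3, sub_mul]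

theorem inner_mulOp_left {a : α → ℂ} (ha : IsBddSymbol a) (f g : Lp ℂ 2 μ) :
    inner ℂ (mulOp a f) g = inner ℂ f (mulOp (fun x => starRingEnd ℂ (a x)) g) := by
  rw [L2.inner_def, L2.inner_def]
  refine integral_congr_ae ?_
  filter_upwards [coeFn_mulOp ha f, coeFn_mulOp ha.conj g] with x h1 h2
  rw [h1, h2]
  simp only [RCLike.inner_apply, map_mul]
  ring

theorem inner_mulOp_ofReal {a : α → ℝ} (ha : IsBddSymbol fun x => (a x : ℂ)) (f g : Lp ℂ 2 μ) :
    inner ℂ (mulOp (fun x => (a x : ℂ)) f) g = inner ℂ f (mulOp (fun x => (a x : ℂ)) g) := by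
  rw [inner_mulOp_left ha]
  simp only [Complex.conj_ofReal]

theorem eq_zero_of_mulOp_eq_zero {a : α → ℂ} (ha : IsBddSymbol a) (h0 : ∀ᵐ x ∂μ, a x ≠ 0)
    {f : Lp ℂ 2 μ} (h : mulOp a f = 0) : f = 0 := by
  refine (Lp.eq_zero_iff_ae_eq_zero).mpr ?_
  have h1 := coeFn_mulOp ha f
  rw [h] at h1
  filter_upwards [h1, Lp.coeFn_zero ℂ 2 μ, h0] with x h2 h3 h4
  rw [h3] at h2
  simpa [h4] using h2.symm

theorem mulOp_injective {a : α → ℂ} (ha : IsBddSymbol a) (h0 : ∀ᵐ x ∂μ, a x ≠ 0) :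
    Function.Injective (mulOp a : Lp ℂ 2 μ →L[ℂ] Lp ℂ 2 μ) := fun f g h =>
  sub_eq_zero.mp (eq_zero_of_mulOp_eq_zero ha h0 (by rw [map_sub, h, sub_self]))

/-- Multiplication operators depend strongly continuously on the symbol, for the bounded pointwise
convergence of symbols. -/
theorem tendsto_mulOp {ι : Type*} {l : Filter ι} [l.IsCountablyGenerated] {A : ι → α → ℂ}
    {a : α → ℂ} {C : ℝ} (hA : ∀ i, Measurable (A i)) (hAC : ∀ i x, ‖A i x‖ ≤ C)
    (ha : Measurable a) (haC : ∀ x, ‖a x‖ ≤ C)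
    (h : ∀ x, Tendsto (fun i => A i x) l (𝓝 (a x))) (f : Lp ℂ 2 μ) :
    Tendsto (fun i => mulOp (A i) f) l (𝓝 (mulOp a f)) := by
  have hAb : ∀ i, IsBddSymbol (A i) := fun i => ⟨hA i, C, hAC i⟩
  have hab : IsBddSymbol a := ⟨ha, C, haC⟩
  have key : Tendsto (fun i => ∫ x, ‖A i x - a x‖ ^ 2 * ‖f x‖ ^ 2 ∂μ) l
      (𝓝 (∫ x, (0 : ℝ) ∂μ)) := by
    refine tendsto_integral_filter_of_dominated_convergence
      (fun x => (2 * C) ^ 2 * ‖f x‖ ^ 2) (Eventually.of_forall fun i => ?_)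
      (Eventually.of_forall fun i => Eventually.of_forall fun x => ?_) ?_
      (Eventually.of_forall fun x => ?_)
    · exact ((((hA i).sub ha).norm.pow_const 2).aestronglyMeasurable).mul
        ((Lp.aestronglyMeasurable f).norm.pow 2)
    · rw [Real.norm_of_nonneg (by positivity)]
      have h1 : ‖A i x - a x‖ ≤ 2 * C :=
        (norm_sub_le _ _).trans (by linarith [hAC i x, haC x])
      gcongr
    · exact ((Lp.memLp f).integrable_norm_pow (by norm_num)).const_mul _
    · have h1 : Tendsto (fun i => A i x - a x) l (𝓝 0) := by
        simpa using (h x).sub_const (a x)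
      simpa using (h1.norm.pow 2).mul_const (‖f x‖ ^ 2)
  rw [tendsto_iff_norm_sub_tendsto_zero]
  have h2 : ∀ i, ‖mulOp (A i) f - mulOp a f‖ =
      Real.sqrt (∫ x, ‖A i x - a x‖ ^ 2 * ‖f x‖ ^ 2 ∂μ) := fun i => by
    rw [← mulOp_sub_symbol (hAb i) hab]
    refine (Real.sqrt_eq_iff_mul_self_eq (by positivity) (by positivity)).mpr ?_ |>.symm
    rw [← pow_two]
    have h3 : (‖mulOp (fun x => A i x - a x) f‖ ^ 2 : ℝ) = RCLike.re (inner ℂ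
        (mulOp (fun x => A i x - a x) f) (mulOp (fun x => A i x - a x) f)) :=
      (inner_self_eq_norm_sq (𝕜 := ℂ) _).symm
    rw [h3, L2.inner_def]
    have h4 : ∫ x, inner ℂ (mulOp (fun x => A i x - a x) f x) (mulOp (fun x => A i x - a x) f x) ∂μ
        = ∫ x, ((‖A i x - a x‖ ^ 2 * ‖f x‖ ^ 2 : ℝ) : ℂ) ∂μ := by
      refine integral_congr_ae ?_
      filter_upwards [coeFn_mulOp ((hAb i).sub hab) f] with x hx
      rw [hx, inner_self_eq_norm_sq_to_K, norm_mul]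
      push_cast
      ring_nf
      simp
    rw [h4, integral_complex_ofReal]
    simp
  simp_rw [h2]
  simpa [Function.comp_def] using (Real.continuous_sqrt.tendsto _).comp key

/-- If `Z` stays bounded in `L²` under bounded symbols that converge pointwise to `1 / a`, then
`Z = a Y` with `Y` in `L²`, by Fatou's lemma. -/
theorem exists_mulOp_eq_of_norm_le {a : α → ℂ} (ha : IsBddSymbol a) (h0 : ∀ x, a x ≠ 0)
    {c : ℕ → α → ℂ} (hc : ∀ n, IsBddSymbol (c n))
    (hlim : ∀ x, Tendsto (fun n => c n x) atTop (𝓝 (a x)⁻¹)) {Z : Lp ℂ 2 μ} {R : ℝ}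
    (hR : ∀ n, ‖mulOp (c n) Z‖ ≤ R) : ∃ Y : Lp ℂ 2 μ, mulOp a Y = Z ∧ ‖Y‖ ≤ R := by
  have hR0 : 0 ≤ R := (norm_nonneg _).trans (hR 0)
  have h1 : ∀ᵐ x ∂μ, Tendsto (fun n => mulOp (c n) Z x) atTop (𝓝 ((a x)⁻¹ * Z x)) := by
    have := ae_all_iff.mpr fun n => coeFn_mulOp (hc n) Z
    filter_upwards [this] with x hx
    simp_rw [hx]
    exact (hlim x).mul_const _
  have h2 : eLpNorm (fun x => (a x)⁻¹ * Z x) 2 μ ≤ ENNReal.ofReal R := by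
    refine (Lp.eLpNorm_lim_le_liminf_eLpNorm (fun n => Lp.aestronglyMeasurable _) _ h1).trans ?_
    refine liminf_le_of_frequently_le' (Frequently.of_forall fun n => ?_)
    rw [← ENNReal.ofReal_toReal (Lp.eLpNorm_ne_top (mulOp (c n) Z))]
    exact ENNReal.ofReal_le_ofReal (hR n)
  have h3 : MemLp (fun x => (a x)⁻¹ * Z x) 2 μ :=
    ⟨ha.1.inv.aestronglyMeasurable.mul (Lp.aestronglyMeasurable Z),
      h2.trans_lt ENNReal.ofReal_lt_top⟩
  refine ⟨h3.toLp _, Lp.ext ?_, ?_⟩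
  · filter_upwards [coeFn_mulOp ha (h3.toLp _), h3.coeFn_toLp] with x hx hx'
    rw [hx, hx', mul_inv_cancel_left₀ (h0 x)]
  · rw [Lp.norm_toLp]
    exact ENNReal.toReal_le_of_le_ofReal hR0 h2

end Multiplication

/-! ### The unitary group with a real symbol -/

section Flow

open Filter Topology

variable {α : Type*}

/-- The symbol `exp (i t ω)`. -/
def phase (ω : α → ℝ) (t : ℝ) (x : α) : ℂ := Complex.exp ((t * ω x : ℝ) * Complex.I)

theorem norm_phase (ω : α → ℝ) (t : ℝ) (x : α) : ‖phase ω t x‖ = 1 :=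
  Complex.norm_exp_ofReal_mul_I _

theorem phase_mul (ω : α → ℝ) (s t : ℝ) (x : α) :
    phase ω (s + t) x = phase ω s x * phase ω t x := by
  simp only [phase, ← Complex.exp_add]
  congr 1
  push_cast
  ring

theorem phase_neg_symbol (ω : α → ℝ) (t : ℝ) :
    phase (fun x => -ω x) t = phase ω (-t) := by
  funext x; simp [phase]

variable [MeasurableSpace α] {μ : Measure α}

theorem measurable_phase {ω : α → ℝ} (hω : Measurable ω) (t : ℝ) : Measurable (phase ω t) :=
  Complex.measurable_exp.comp
    ((Complex.measurable_ofReal.comp (hω.const_mul t)).mul_const Complex.I)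

theorem isBddSymbol_phase {ω : α → ℝ} (hω : Measurable ω) (t : ℝ) : IsBddSymbol (phase ω t) :=
  ⟨measurable_phase hω t, 1, fun x => (norm_phase ω t x).le⟩

/-- The unitary group `exp (i t ω)` on `L²`. -/
def flow (ω : α → ℝ) (t : ℝ) : Lp ℂ 2 μ →L[ℂ] Lp ℂ 2 μ := mulOp (phase ω t)

theorem flow_neg_symbol (ω : α → ℝ) (t : ℝ) :
    (flow (fun x => -ω x) t : Lp ℂ 2 μ →L[ℂ] Lp ℂ 2 μ) = flow ω (-t) := by
  rw [flow, flow, phase_neg_symbol]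

theorem flow_flow {ω : α → ℝ} (hω : Measurable ω) (s t : ℝ) (f : Lp ℂ 2 μ) :
    flow ω s (flow ω t f) = flow ω (s + t) f :=
  mulOp_mulOp_eq (isBddSymbol_phase hω s) (isBddSymbol_phase hω t) (fun x => phase_mul ω s t x) f

theorem flow_zero (ω : α → ℝ) (f : Lp ℂ 2 μ) : flow ω 0 f = f := by
  have : phase ω 0 = fun _ => 1 := by funext x; simp [phase]
  rw [flow, this, mulOp_one]

theorem flow_neg_flow {ω : α → ℝ} (hω : Measurable ω) (t : ℝ) (f : Lp ℂ 2 μ) :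
    flow ω (-t) (flow ω t f) = f := by
  rw [flow_flow hω, neg_add_cancel, flow_zero]

theorem flow_flow_neg {ω : α → ℝ} (hω : Measurable ω) (t : ℝ) (f : Lp ℂ 2 μ) :
    flow ω t (flow ω (-t) f) = f := by
  rw [flow_flow hω, add_neg_cancel, flow_zero]

theorem norm_flow {ω : α → ℝ} (hω : Measurable ω) (t : ℝ) (f : Lp ℂ 2 μ) :
    ‖flow ω t f‖ = ‖f‖ := by
  have h : ∀ (s : ℝ) (g : Lp ℂ 2 μ), ‖flow ω s g‖ ≤ ‖g‖ := fun s g =>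
    norm_mulOp_le_one (measurable_phase hω s) (fun x => (norm_phase ω s x).le) g
  refine le_antisymm (h t f) ?_
  conv_lhs => rw [← flow_neg_flow hω t f]
  exact h _ _

theorem mulOp_flow_comm {ω : α → ℝ} (hω : Measurable ω) {a : α → ℂ} (ha : IsBddSymbol a) (t : ℝ)
    (f : Lp ℂ 2 μ) : mulOp a (flow ω t f) = flow ω t (mulOp a f) :=
  mulOp_comm ha (isBddSymbol_phase hω t) f

theorem continuous_flow {ω : α → ℝ} (hω : Measurable ω) :
    Continuous fun p : ℝ × Lp ℂ 2 μ => flow ω p.1 p.2 := by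
  refine continuous_iff_continuousAt.mpr fun ⟨t, f⟩ => ?_
  have h1 : Tendsto (fun s => flow ω s f) (𝓝 t) (𝓝 (flow ω t f)) :=
    tendsto_mulOp (C := 1) (fun s => measurable_phase hω s) (fun s x => (norm_phase ω s x).le)
      (measurable_phase hω t) (fun x => (norm_phase ω t x).le)
      (fun x => Continuous.tendsto (by unfold phase; fun_prop) t) f
  rw [ContinuousAt, tendsto_iff_norm_sub_tendsto_zero]
  have h2 : Tendsto (fun p : ℝ × Lp ℂ 2 μ => ‖p.2 - f‖ + ‖flow ω p.1 f - flow ω t f‖)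
      (𝓝 (t, f)) (𝓝 (0 + 0)) := by
    refine Tendsto.add ?_ ?_
    · exact tendsto_iff_norm_sub_tendsto_zero.mp (continuous_snd.tendsto (t, f))
    · exact (tendsto_iff_norm_sub_tendsto_zero.mp h1).comp (continuous_fst.tendsto (t, f))
  rw [add_zero] at h2
  refine squeeze_zero (fun _ => norm_nonneg _) (fun p => ?_) h2
  calc ‖flow ω p.1 p.2 - flow ω t f‖
      = ‖flow ω p.1 (p.2 - f) + (flow ω p.1 f - flow ω t f)‖ := by rw [map_sub]; congr 1; abel
    _ ≤ _ := (norm_add_le _ _).trans (by rw [norm_flow hω])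

theorem continuous_flow_comp {ω : α → ℝ} (hω : Measurable ω) {X : Type*} [TopologicalSpace X]
    {s : X → ℝ} {f : X → Lp ℂ 2 μ} (hs : Continuous s) (hf : Continuous f) :
    Continuous fun x => flow ω (s x) (f x) :=
  (continuous_flow hω).comp (hs.prodMk hf)

/-- On a set where the frequencies `ω` are bounded, the group is differentiable in norm. -/
theorem hasDerivAt_mulOp_phase {ω : α → ℝ} (hω : Measurable ω) {A : Set α} (hA : MeasurableSet A)
    {R : ℝ} (hR : ∀ x ∈ A, |ω x| ≤ R) (t : ℝ) :
    HasDerivAt (fun τ => (mulOp (A.indicator (phase ω τ)) :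
      Lp ℂ 2 μ →L[ℂ] Lp ℂ 2 μ).restrictScalars ℝ)
      ((mulOp (A.indicator fun x => Complex.I * ω x * phase ω t x) :
        Lp ℂ 2 μ →L[ℂ] Lp ℂ 2 μ).restrictScalars ℝ) t := by
  have hb1 : ∀ τ, IsBddSymbol (A.indicator (phase ω τ)) := fun τ =>
    (isBddSymbol_phase hω τ).indicator hA
  have hb2 : IsBddSymbol (A.indicator fun x => Complex.I * ω x * phase ω t x) := by
    refine ⟨Measurable.indicator (((Complex.measurable_ofReal.comp hω).const_mul _).mul
      (measurable_phase hω t)) hA, |R|, fun x => ?_⟩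
    by_cases hx : x ∈ A
    · simpa [hx, norm_phase] using (hR x hx).trans (le_abs_self R)
    · simp [hx]
  rw [hasDerivAt_iff_isLittleO]
  have hO : (fun τ => (mulOp (A.indicator (phase ω τ)) :
      Lp ℂ 2 μ →L[ℂ] Lp ℂ 2 μ).restrictScalars ℝ - (mulOp (A.indicator (phase ω t)) :
      Lp ℂ 2 μ →L[ℂ] Lp ℂ 2 μ).restrictScalars ℝ - (τ - t) •
      (mulOp (A.indicator fun x => Complex.I * ω x * phase ω t x) :
        Lp ℂ 2 μ →L[ℂ] Lp ℂ 2 μ).restrictScalars ℝ) =O[𝓝 t] fun τ => (τ - t) ^ 2 := by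
    refine Asymptotics.IsBigO.of_bound (|R| ^ 2) ?_
    have hev : ∀ᶠ τ in 𝓝 t, |τ - t| * |R| ≤ 1 := by
      have : Tendsto (fun τ : ℝ => |τ - t| * |R|) (𝓝 t) (𝓝 (|t - t| * |R|)) :=
        Continuous.tendsto (by fun_prop) t
      rw [sub_self, abs_zero, zero_mul] at this
      exact this.eventually (Iic_mem_nhds one_pos)
    filter_upwards [hev] with τ hτ
    refine ContinuousLinearMap.opNorm_le_bound _ (by positivity) fun f => ?_
    have hsc : (τ - t) • mulOp (A.indicator fun x => Complex.I * ω x * phase ω t x) f =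
        ((τ - t : ℝ) : ℂ) • mulOp (A.indicator fun x => Complex.I * ω x * phase ω t x) f := rfl
    have hsub : IsBddSymbol (fun x => A.indicator (phase ω τ) x - A.indicator (phase ω t) x) :=
      (hb1 τ).sub (hb1 t)
    have hmul : IsBddSymbol (fun x => ((τ - t : ℝ) : ℂ) *
        A.indicator (fun x => Complex.I * ω x * phase ω t x) x) := (IsBddSymbol.const _).mul hb2
    simp only [sub_apply, smul_apply,
      ContinuousLinearMap.coe_restrictScalars']
    rw [hsc, ← mulOp_const_mul hb2, ← mulOp_sub_symbol (hb1 τ) (hb1 t),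
      ← mulOp_sub_symbol hsub hmul]
    refine norm_mulOp_le (hsub.sub hmul) (fun x => ?_) f
    by_cases hx : x ∈ A
    · simp only [hx, indicator_of_mem]
      have h1 : phase ω τ x = phase ω (τ - t) x * phase ω t x := by
        rw [← phase_mul, sub_add_cancel]
      set z : ℂ := (((τ - t) * ω x : ℝ) : ℂ) * Complex.I with hz
      have hzn : ‖z‖ = |τ - t| * |ω x| := by
        rw [hz, norm_mul, Complex.norm_I, mul_one, Complex.norm_real, Real.norm_eq_abs, abs_mul]
      have hxR : |ω x| ≤ |R| := (hR x hx).trans (le_abs_self R)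
      have h2 : phase ω τ x - phase ω t x - ((τ - t : ℝ) : ℂ) * (Complex.I * ω x * phase ω t x) =
          (Complex.exp z - 1 - z) * phase ω t x := by
        rw [h1, phase, ← hz, hz]; push_cast; ring
      rw [h2, norm_mul, norm_phase, mul_one]
      have hz1 : ‖z‖ ≤ |τ - t| * |R| := by rw [hzn]; gcongr
      calc _ ≤ ‖z‖ ^ 2 := Complex.norm_exp_sub_one_sub_id_le (hz1.trans hτ)
        _ ≤ (|τ - t| * |R|) ^ 2 := by gcongr
        _ = _ := by rw [Real.norm_of_nonneg (sq_nonneg _), mul_pow, sq_abs (τ - t)]; ring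
    · simp only [hx, not_false_eq_true, indicator_of_notMem, sub_self, mul_zero, norm_zero]
      positivity
  exact hO.trans_isLittleO (by
    simpa using (Asymptotics.isLittleO_pow_sub_sub t one_lt_two))

/-- The multiplication by the indicator function of `A`. -/
def proj (A : Set α) : Lp ℂ 2 μ →L[ℂ] Lp ℂ 2 μ := mulOp (A.indicator fun _ => 1)

theorem isBddSymbol_indicator_one {A : Set α} (hA : MeasurableSet A) :
    IsBddSymbol (A.indicator fun _ => (1 : ℂ)) := (IsBddSymbol.const 1).indicator hA

theorem norm_proj_le {A : Set α} (hA : MeasurableSet A) (f : Lp ℂ 2 μ) : ‖proj A f‖ ≤ ‖f‖ :=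
  norm_mulOp_le_one (isBddSymbol_indicator_one hA).1
    (fun x => (norm_indicator_le_norm_self _ _).trans (by simp)) f

/-- Going back from the interaction picture `w` to `exp (-i t ω) w`, on bounded frequencies. -/
theorem hasDerivAt_proj_flow_neg {ω : α → ℝ} (hω : Measurable ω) {A : Set α}
    (hA : MeasurableSet A) {R : ℝ} (hR : ∀ x ∈ A, |ω x| ≤ R) {w : ℝ → Lp ℂ 2 μ}
    {w' : Lp ℂ 2 μ} {t : ℝ} (hw : HasDerivAt w w' t) :
    HasDerivAt (fun τ => proj A (flow ω (-τ) (w τ)))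
      (proj A (flow ω (-t) w') - Complex.I •
        mulOp (A.indicator fun x => (ω x : ℂ)) (flow ω (-t) (w t))) t := by
  have hR' : ∀ x ∈ A, |-ω x| ≤ R := fun x hx => by simpa using hR x hx
  have hb3 : IsBddSymbol (A.indicator fun x => (ω x : ℂ)) := by
    refine ⟨(Complex.measurable_ofReal.comp hω).indicator hA, |R|, fun x => ?_⟩
    by_cases hx : x ∈ A
    · simpa [hx] using (hR x hx).trans (le_abs_self R)
    · simp [hx]
  have h1 := (hasDerivAt_mulOp_phase (μ := μ) hω.neg hA hR' t).clm_apply hw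
  simp only [Pi.neg_def, phase_neg_symbol, ContinuousLinearMap.coe_restrictScalars'] at h1
  have hpr : ∀ (τ : ℝ) (f : Lp ℂ 2 μ),
      mulOp (A.indicator (phase ω (-τ))) f = proj A (flow ω (-τ) f) := fun τ f => by
    refine (mulOp_mulOp_eq (isBddSymbol_indicator_one hA) (isBddSymbol_phase hω _)
      (fun x => ?_) f).symm
    by_cases hx : x ∈ A <;> simp [hx]
  simp only [hpr] at h1
  refine h1.congr_deriv ?_
  rw [add_comm, sub_eq_add_neg]
  congr 1
  rw [← neg_smul, ← mulOp_const_mul hb3]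
  refine (mulOp_mulOp_eq ((IsBddSymbol.const _).mul hb3) (isBddSymbol_phase hω _)
    (fun x => ?_) _).symm
  by_cases hx : x ∈ A <;> simp [hx]

end Flow

/-! ### Semilinear equations in the interaction picture -/

section Semilinear

open Filter Topology

variable {α : Type*} [MeasurableSpace α] {μ : Measure α}

/-- `N` is a globally Lipschitz nonlinearity with `N 0 = 0` and a nonnegative potential `Γ`, whose
gradient is `N`, with a quadratic bound for the remainder. -/
structure HasPotential (N : Lp ℂ 2 μ → Lp ℂ 2 μ) (Γ : Lp ℂ 2 μ → ℝ) (L : NNReal) : Prop where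
  lipschitz : LipschitzWith L N
  map_zero : N 0 = 0
  nonneg : ∀ Z, 0 ≤ Γ Z
  expand : ∀ Z h, |Γ (Z + h) - Γ Z - (inner ℂ (N Z) h).re| ≤ L * ‖h‖ ^ 2

/-- `Z` solves `Z' = -i ω Z - i k N(Z)`, in the form that makes sense for an unbounded `ω`: the
derivative is taken of `exp (i t ω) Z(t)`. -/
def IsMildSolution (ω : α → ℝ) (k : α → ℝ) (N : Lp ℂ 2 μ → Lp ℂ 2 μ) (Z : ℝ → Lp ℂ 2 μ) : Prop :=
  ∀ t, HasDerivAt (fun τ => flow ω τ (Z τ))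
    (-Complex.I • flow ω t (mulOp (fun x => (k x : ℂ)) (N (Z t)))) t

variable {ω k : α → ℝ} {N : Lp ℂ 2 μ → Lp ℂ 2 μ} {Γ : Lp ℂ 2 μ → ℝ} {L : NNReal}
  {Z : ℝ → Lp ℂ 2 μ}

theorem IsMildSolution.continuous (hω : Measurable ω) (hZ : IsMildSolution ω k N Z) :
    Continuous Z := by
  have h1 : Continuous fun τ => flow ω τ (Z τ) :=
    continuous_iff_continuousAt.mpr fun t => (hZ t).continuousAt
  have h2 : Z = fun τ => flow ω (-τ) (flow ω τ (Z τ)) := by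
    funext τ; rw [flow_neg_flow hω]
  rw [h2]
  exact continuous_flow_comp hω continuous_neg h1

theorem IsMildSolution.comp_add (hω : Measurable ω) (hZ : IsMildSolution ω k N Z) (s : ℝ) :
    IsMildSolution ω k N (fun t => Z (s + t)) := by
  intro t
  have h1 : HasDerivAt (fun τ => flow ω (s + τ) (Z (s + τ)))
      (-Complex.I • flow ω (s + t) (mulOp (fun x => (k x : ℂ)) (N (Z (s + t))))) t :=
    (hZ (s + t)).comp_const_add s t
  have h2 := ((flow ω (-s) : Lp ℂ 2 μ →L[ℂ] Lp ℂ 2 μ).restrictScalars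
    ℝ).hasFDerivAt.comp_hasDerivAt t h1
  simp only [Function.comp_def, ContinuousLinearMap.coe_restrictScalars', map_smul,
    flow_flow hω, neg_add_cancel_left] at h2
  exact h2

theorem IsMildSolution.comp_neg (hk : IsBddSymbol fun x => (k x : ℂ))
    (hZ : IsMildSolution ω k N Z) :
    IsMildSolution (fun x => -ω x) (fun x => -k x) N (fun t => Z (-t)) := by
  intro t
  simp only [flow_neg_symbol]
  have h1 := (hZ (-t)).scomp t (hasDerivAt_neg t)
  simp only [Function.comp_def] at h1
  refine h1.congr_deriv ?_
  have h2 := mulOp_const_mul hk (-1) (N (Z (-t)))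
  have h3 : (fun x => ((-k x : ℝ) : ℂ)) = fun x => -1 * (k x : ℂ) := by funext x; simp
  rw [h3, h2]
  simp

theorem lipschitzWith_interaction (hω : Measurable ω) {C : NNReal} (hk : Measurable k)
    (hkC : ∀ x, |k x| ≤ C) (hN : LipschitzWith L N) (t : ℝ) :
    LipschitzWith (C * L) fun w : Lp ℂ 2 μ =>
      -Complex.I • flow ω t (mulOp (fun x => (k x : ℂ)) (N (flow ω (-t) w))) := by
  have hb : IsBddSymbol fun x => (k x : ℂ) :=
    ⟨Complex.measurable_ofReal.comp hk, C, fun x => by simpa using hkC x⟩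
  refine LipschitzWith.of_dist_le_mul fun w w' => ?_
  rw [dist_eq_norm, dist_eq_norm, ← smul_sub, ← map_sub, ← map_sub, norm_smul, norm_neg,
    Complex.norm_I, one_mul, norm_flow hω]
  have h1 := hN.dist_le_mul (flow ω (-t) w) (flow ω (-t) w')
  rw [dist_eq_norm, dist_eq_norm, ← map_sub, norm_flow hω] at h1
  calc _ ≤ C * ‖N (flow ω (-t) w) - N (flow ω (-t) w')‖ :=
        norm_mulOp_le hb (fun x => by simpa using hkC x) _
    _ ≤ C * (L * ‖w - w'‖) := by gcongr
    _ = _ := by push_cast; ring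

theorem exists_isMildSolution (hω : Measurable ω) {C : NNReal} (hk : Measurable k)
    (hkC : ∀ x, |k x| ≤ C) (hN : LipschitzWith L N) (hN0 : N 0 = 0) (Z₀ : Lp ℂ 2 μ) :
    ∃ Z : ℝ → Lp ℂ 2 μ, Z 0 = Z₀ ∧ IsMildSolution ω k N Z := by
  obtain ⟨w, hw0, hw⟩ := exists_forall_hasDerivAt (E := Lp ℂ 2 μ) (K := C * L)
    (F := fun t w => -Complex.I • flow ω t (mulOp (fun x => (k x : ℂ)) (N (flow ω (-t) w))))
    (by
      have h1 : Continuous fun p : ℝ × Lp ℂ 2 μ => N (flow ω (-p.1) p.2) :=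
        hN.continuous.comp (continuous_flow_comp hω continuous_fst.neg continuous_snd)
      exact (continuous_flow_comp hω continuous_fst
        ((mulOp fun x => (k x : ℂ)).continuous.comp h1)).const_smul (-Complex.I))
    (lipschitzWith_interaction hω hk hkC hN) (fun t => by simp [hN0]) Z₀
  refine ⟨fun t => flow ω (-t) (w t), by simp [hw0, flow_zero], fun t => ?_⟩
  simp only [flow_flow_neg hω]
  exact hw t

/-! ### Exhaustion by sets on which a symbol is bounded -/

/-- An increasing exhaustion by measurable sets. -/
structure IsExhaustion (A : ℕ → Set α) : Prop where
  measurableSet : ∀ n, MeasurableSet (A n)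
  mono : Monotone A
  exists_mem : ∀ x, ∃ n, x ∈ A n

variable {A : ℕ → Set α}

theorem IsExhaustion.eventually_mem (hA : IsExhaustion A) (x : α) : ∀ᶠ n in atTop, x ∈ A n := by
  obtain ⟨m, hm⟩ := hA.exists_mem x
  exact eventually_atTop.mpr ⟨m, fun n hn => hA.mono hn hm⟩

theorem IsExhaustion.tendsto_proj (hA : IsExhaustion A) (f : Lp ℂ 2 μ) :
    Tendsto (fun n => proj (A n) f) atTop (𝓝 f) := by
  have h := tendsto_mulOp (μ := μ) (l := atTop) (C := 1)
    (A := fun n => (A n).indicator fun _ => (1 : ℂ)) (a := fun _ => 1)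
    (fun n => (isBddSymbol_indicator_one (hA.measurableSet n)).1)
    (fun n x => (norm_indicator_le_norm_self _ _).trans (by simp)) measurable_const (by simp)
    (fun x => by
      refine tendsto_const_nhds.congr' ?_
      filter_upwards [hA.eventually_mem x] with n hn
      simp [hn]) f
  rwa [mulOp_one] at h

theorem IsExhaustion.eq_zero (hA : IsExhaustion A) {f : Lp ℂ 2 μ}
    (h : ∀ n, proj (A n) f = 0) : f = 0 :=
  tendsto_nhds_unique (hA.tendsto_proj f) (by simp only [h]; exact tendsto_const_nhds)

/-- The cut-offs of a continuous curve converge uniformly on compact intervals (Dini). -/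
theorem IsExhaustion.tendstoUniformlyOn (hA : IsExhaustion A) {w : ℝ → Lp ℂ 2 μ}
    (hw : Continuous w) (T : ℝ) :
    TendstoUniformlyOn (fun n t => ‖w t - proj (A n) (w t)‖) (fun _ => 0) atTop (Icc 0 T) := by
  refine Antitone.tendstoUniformlyOn_of_forall_tendsto isCompact_Icc
    (fun n => (hw.sub ((proj (A n)).continuous.comp hw)).norm.continuousOn)
    (fun t _ m n hmn => ?_) continuousOn_const (fun t _ => ?_)
  · have hsub : IsBddSymbol (fun x => (1 : ℂ) - (A n).indicator (fun _ => 1) x) :=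
      (IsBddSymbol.const 1).sub (isBddSymbol_indicator_one (hA.measurableSet n))
    have hsub' : IsBddSymbol (fun x => (1 : ℂ) - (A m).indicator (fun _ => 1) x) :=
      (IsBddSymbol.const 1).sub (isBddSymbol_indicator_one (hA.measurableSet m))
    have e : ∀ i, w t - proj (A i) (w t) =
        mulOp (fun x => (1 : ℂ) - (A i).indicator (fun _ => 1) x) (w t) := fun i => by
      rw [mulOp_sub_symbol (IsBddSymbol.const 1)
        (isBddSymbol_indicator_one (hA.measurableSet i)), mulOp_one]
      rfl
    have e2 : w t - proj (A n) (w t) =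
        mulOp (fun x => (1 : ℂ) - (A n).indicator (fun _ => 1) x) (w t - proj (A m) (w t)) := by
      rw [e n, e m]
      refine (mulOp_mulOp_eq hsub hsub' (fun x => ?_) _).symm
      by_cases hx : x ∈ A n
      · simp [hx]
      · have : x ∉ A m := fun h => hx (hA.mono hmn h)
        simp [hx, this]
    show ‖w t - proj (A n) (w t)‖ ≤ ‖w t - proj (A m) (w t)‖
    rw [e2]
    refine norm_mulOp_le_one hsub.1 (fun x => ?_) _
    by_cases hx : x ∈ A n <;> simp [hx]
  · have h := (hA.tendsto_proj (w t)).const_sub (w t)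
    simpa using h.norm

/-- A curve whose cut-offs are all differentiable, with the cut-offs of one continuous curve as
derivatives, is differentiable. -/
theorem IsExhaustion.hasDerivAt (hA : IsExhaustion A) {Y H : ℝ → Lp ℂ 2 μ} (hH : Continuous H)
    (h : ∀ n t, HasDerivAt (fun τ => proj (A n) (Y τ)) (proj (A n) (H t)) t) (t : ℝ) :
    HasDerivAt Y (H t) t := by
  have h1 : ∀ t, Y t = Y 0 + ∫ τ in (0 : ℝ)..t, H τ := fun t => by
    rw [← sub_eq_zero]
    refine hA.eq_zero (A := A) fun n => ?_
    have h2 : ∫ τ in (0 : ℝ)..t, proj (A n) (H τ) = proj (A n) (Y t) - proj (A n) (Y 0) :=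
      intervalIntegral.integral_eq_sub_of_hasDerivAt (fun τ _ => h n τ)
        (((proj (A n)).continuous.comp hH).intervalIntegrable _ _)
    rw [map_sub, map_add, ← ContinuousLinearMap.intervalIntegral_comp_comm _
      (hH.intervalIntegrable _ _), h2]
    abel
  have h3 := (hH.integral_hasStrictDerivAt 0 t).hasDerivAt.const_add (Y 0)
  rwa [← funext h1] at h3

/-! ### Conservation of energy -/

theorem HasPotential.abs_sub_le (hN : HasPotential N Γ L) (Z h : Lp ℂ 2 μ) :
    |Γ (Z + h) - Γ Z| ≤ L * ‖Z‖ * ‖h‖ + L * ‖h‖ ^ 2 := by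
  have h1 := hN.expand Z h
  have h2 : |(inner ℂ (N Z) h).re| ≤ L * ‖Z‖ * ‖h‖ := by
    refine (Complex.abs_re_le_norm _).trans ((norm_inner_le_norm _ _).trans ?_)
    have := hN.lipschitz.dist_le_mul Z 0
    rw [hN.map_zero, dist_zero_right, dist_zero_right] at this
    gcongr
  have := abs_add_le (Γ (Z + h) - Γ Z - (inner ℂ (N Z) h).re) (inner ℂ (N Z) h).re
  rw [sub_add_cancel] at this
  linarith

theorem HasPotential.continuous (hN : HasPotential N Γ L) : Continuous Γ := by
  refine continuous_iff_continuousAt.mpr fun Z => ?_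
  rw [ContinuousAt, tendsto_iff_norm_sub_tendsto_zero]
  refine squeeze_zero (fun _ => norm_nonneg _)
    (g := fun W => L * ‖Z‖ * ‖W - Z‖ + L * ‖W - Z‖ ^ 2) (fun W => ?_) ?_
  · have := hN.abs_sub_le Z (W - Z)
    rwa [add_sub_cancel] at this
  · have : Continuous fun W : Lp ℂ 2 μ => L * ‖Z‖ * ‖W - Z‖ + L * ‖W - Z‖ ^ 2 := by fun_prop
    simpa using this.tendsto Z

theorem HasPotential.hasDerivAt_comp (hN : HasPotential N Γ L) {D : Lp ℂ 2 μ} {t : ℝ}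
    (hZ : HasDerivAt Z D t) : HasDerivAt (fun τ => Γ (Z τ)) (inner ℂ (N (Z t)) D).re t := by
  have h1 : HasDerivAt (fun τ => (inner ℂ (N (Z t)) (Z τ - Z t)).re)
      (inner ℂ (N (Z t)) D).re t := by
    have h2 : HasDerivAt (fun τ => inner ℂ (N (Z t)) (Z τ - Z t)) (inner ℂ (N (Z t)) D) t := by
      simpa using (hasDerivAt_const t (N (Z t))).inner ℂ (hZ.sub_const (Z t))
    exact Complex.reCLM.hasFDerivAt.comp_hasDerivAt t h2
  rw [hasDerivAt_iff_isLittleO] at h1 ⊢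
  have h3 : (fun τ => Γ (Z τ) - Γ (Z t) - (inner ℂ (N (Z t)) (Z τ - Z t)).re) =o[𝓝 t]
      fun τ => τ - t := by
    have h4 : (fun τ => Γ (Z τ) - Γ (Z t) - (inner ℂ (N (Z t)) (Z τ - Z t)).re) =O[𝓝 t]
        fun τ => ‖Z τ - Z t‖ ^ 2 := by
      refine Asymptotics.IsBigO.of_bound L (Eventually.of_forall fun τ => ?_)
      have := hN.expand (Z t) (Z τ - Z t)
      rw [add_sub_cancel] at this
      simpa using this
    refine (h4.trans ?_).trans_isLittleO (Asymptotics.isLittleO_pow_sub_sub t one_lt_two)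
    exact (hZ.isBigO_sub.norm_norm).pow 2
  refine (h3.add h1).congr_left fun τ => ?_
  simp

theorem inner_mulOp_ofReal_self_im {c : α → ℝ} (hc : IsBddSymbol fun x => (c x : ℂ))
    (f : Lp ℂ 2 μ) : (inner ℂ f (mulOp (fun x => (c x : ℂ)) f)).im = 0 := by
  have h := inner_mulOp_ofReal hc f f
  rw [← inner_conj_symm] at h
  exact Complex.conj_eq_iff_im.mp h

end Semilinear

section SemilinearEnergy

open Filter Topology

variable {α : Type*} {ω k a : α → ℝ}

/-- The frequencies at which `ω` and `1 / a` are at most about `n`. -/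
def levelSet (ω a : α → ℝ) (n : ℕ) : Set α := {x | |ω x| ≤ n ∧ ((n : ℝ) + 1)⁻¹ ≤ a x}

theorem ofReal_indicator (c : α → ℝ) (A : Set α) :
    (A.indicator fun x => (c x : ℂ)) = fun x => ((A.indicator c x : ℝ) : ℂ) := by
  funext x; by_cases hx : x ∈ A <;> simp [hx]

variable [MeasurableSpace α] {μ : Measure α}
  {N : Lp ℂ 2 μ → Lp ℂ 2 μ} {Γ : Lp ℂ 2 μ → ℝ} {L : NNReal} {Z : ℝ → Lp ℂ 2 μ}

theorem isExhaustion_levelSet (hω : Measurable ω) (ha : Measurable a) (ha0 : ∀ x, 0 < a x) :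
    IsExhaustion (levelSet ω a) where
  measurableSet n := (measurableSet_le (measurable_norm.comp hω) measurable_const).inter
    (measurableSet_le measurable_const ha)
  mono := fun m n hmn x hx => by
    have hmn' : (m : ℝ) ≤ n := Nat.cast_le.mpr hmn
    exact ⟨hx.1.trans hmn', le_trans (by gcongr) hx.2⟩
  exists_mem x := by
    obtain ⟨m, hm⟩ := exists_nat_ge (max |ω x| (a x)⁻¹)
    have h1 : (a x)⁻¹ ≤ (m : ℝ) + 1 := by linarith [(le_max_right _ _).trans hm]
    exact ⟨m, (le_max_left _ _).trans hm, inv_le_of_inv_le₀ (ha0 x) h1⟩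

theorem isBddSymbol_indicator_ofReal {c : α → ℝ} (hc : Measurable c) {A : Set α}
    (hA : MeasurableSet A) {R : ℝ} (h : ∀ x ∈ A, |c x| ≤ R) :
    IsBddSymbol fun x => ((A.indicator c x : ℝ) : ℂ) := by
  refine ⟨Complex.measurable_ofReal.comp (hc.indicator hA), |R|, fun x => ?_⟩
  by_cases hx : x ∈ A
  · simpa [hx] using (h x hx).trans (le_abs_self R)
  · simp [hx]

theorem isBddSymbol_inv_levelSet (hω : Measurable ω) (ha : Measurable a) (ha0 : ∀ x, 0 < a x)
    (n : ℕ) : IsBddSymbol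
      fun x => (((levelSet ω a n).indicator (fun y => (a y)⁻¹) x : ℝ) : ℂ) :=
  isBddSymbol_indicator_ofReal ha.inv ((isExhaustion_levelSet hω ha ha0).measurableSet n)
    (R := n + 1) (fun x hx => by
      rw [Pi.inv_apply, abs_of_pos (inv_pos.mpr (ha0 x))]
      exact inv_le_of_inv_le₀ (by positivity) hx.2)

/-- A solution of the truncated equation that starts in the range of the cut-off stays there. -/
theorem IsMildSolution.proj_eq (hω : Measurable ω) {A : Set α} (hA : MeasurableSet A)
    (hk : IsBddSymbol fun x => ((A.indicator k x : ℝ) : ℂ))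
    (hZ : IsMildSolution ω (A.indicator k) N Z) (h0 : proj A (Z 0) = Z 0) (t : ℝ) :
    proj A (Z t) = Z t := by
  have h1 : ∀ t, HasDerivAt (fun τ => flow ω τ (Z τ) - proj A (flow ω τ (Z τ))) 0 t := fun t => by
    have h2 := (hZ t).sub (((proj A : Lp ℂ 2 μ →L[ℂ] Lp ℂ 2 μ).restrictScalars
      ℝ).hasFDerivAt.comp_hasDerivAt t (hZ t))
    refine h2.congr_deriv ?_
    rw [ContinuousLinearMap.coe_restrictScalars', map_smul, sub_eq_zero, proj,
      mulOp_flow_comm hω (isBddSymbol_indicator_one hA)]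
    congr 2
    refine (mulOp_mulOp_eq (isBddSymbol_indicator_one hA) hk (fun x => ?_) _).symm
    by_cases hx : x ∈ A <;> simp [hx]
  have h3 := is_const_of_deriv_eq_zero (fun t => (h1 t).differentiableAt) (fun t => (h1 t).deriv)
    t 0
  simp only [flow_zero, h0, sub_self, sub_eq_zero] at h3
  rw [← flow_neg_flow hω t (Z t)]
  conv_rhs => rw [h3]
  rw [proj, mulOp_flow_comm hω (isBddSymbol_indicator_one hA)]

/-- The energy `½ ‖a⁻¹ Z‖² + Γ(Z)` of the truncated equation is constant. -/
theorem IsMildSolution.truncated_energy (hω : Measurable ω) (ha : Measurable a)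
    (ha0 : ∀ x, 0 < a x) (hk : Measurable k) {C : ℝ} (hkC : ∀ x, |k x| ≤ C)
    (hka : ∀ x, k x = ω x * a x ^ 2) (hN : HasPotential N Γ L) (n : ℕ)
    (hZ : IsMildSolution ω ((levelSet ω a n).indicator k) N Z)
    (h0 : proj (levelSet ω a n) (Z 0) = Z 0) (t : ℝ) :
    ‖mulOp (fun x => (((levelSet ω a n).indicator (fun y => (a y)⁻¹) x : ℝ) : ℂ)) (Z t)‖ ^ 2 / 2
        + Γ (Z t) =
      ‖mulOp (fun x => (((levelSet ω a n).indicator (fun y => (a y)⁻¹) x : ℝ) : ℂ)) (Z 0)‖ ^ 2 / 2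
        + Γ (Z 0) := by
  have hA := (isExhaustion_levelSet hω ha ha0).measurableSet n
  set A := levelSet ω a n with hAdef
  have hωA : ∀ x ∈ A, |ω x| ≤ n := fun x hx => hx.1
  have hbω := isBddSymbol_indicator_ofReal hω hA hωA
  have hbk := isBddSymbol_indicator_ofReal hk hA (fun x _ => hkC x)
  have hbm : IsBddSymbol fun x => ((A.indicator (fun y => (a y)⁻¹) x : ℝ) : ℂ) :=
    isBddSymbol_inv_levelSet hω ha ha0 n
  set Ω : Lp ℂ 2 μ →L[ℂ] Lp ℂ 2 μ := mulOp fun x => ((A.indicator ω x : ℝ) : ℂ) with hΩ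
  set κ : Lp ℂ 2 μ →L[ℂ] Lp ℂ 2 μ := mulOp fun x => ((A.indicator k x : ℝ) : ℂ) with hκ
  set m : Lp ℂ 2 μ →L[ℂ] Lp ℂ 2 μ :=
    mulOp fun x => ((A.indicator (fun y => (a y)⁻¹) x : ℝ) : ℂ) with hm
  have hproj := hZ.proj_eq hω hA hbk h0
  have hZ' : ∀ t, HasDerivAt Z (-Complex.I • (Ω (Z t) + κ (N (Z t)))) t := fun t => by
    have h1 := hasDerivAt_proj_flow_neg hω hA hωA (hZ t)
    simp only [flow_neg_flow hω, hproj, map_smul] at h1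
    refine h1.congr_deriv ?_
    rw [ofReal_indicator, smul_add, sub_eq_add_neg, add_comm, ← neg_smul, proj,
      mulOp_mulOp_eq (isBddSymbol_indicator_one hA) hbk
        (c := fun x => ((A.indicator k x : ℝ) : ℂ)) (fun x => by by_cases hx : x ∈ A <;> simp [hx])]
  have hE : ∀ t, HasDerivAt (fun τ => ‖m (Z τ)‖ ^ 2 / 2 + Γ (Z τ)) 0 t := fun t => by
    set D := -Complex.I • (Ω (Z t) + κ (N (Z t))) with hD
    have h1 : HasDerivAt (fun τ => m (Z τ)) (m D) t :=
      (m.restrictScalars ℝ).hasFDerivAt.comp_hasDerivAt t (hZ' t)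
    have h2 : HasDerivAt (fun τ => ‖m (Z τ)‖ ^ 2 / 2) (inner ℂ (m (Z t)) (m D)).re t := by
      have h3 := Complex.reCLM.hasFDerivAt.comp_hasDerivAt t (h1.inner ℂ h1)
      have h4 : (fun τ => ‖m (Z τ)‖ ^ 2 / 2) =
          fun τ => (Complex.reCLM ∘ fun τ => inner ℂ (m (Z τ)) (m (Z τ))) τ / 2 := by
        funext τ
        simp only [Function.comp_apply, Complex.reCLM_apply]
        rw [← inner_self_eq_norm_sq (𝕜 := ℂ)]
        rfl
      rw [h4]
      refine (h3.div_const 2).congr_deriv ?_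
      simp only [Complex.reCLM_apply, Complex.add_re]
      rw [← inner_conj_symm (m D) (m (Z t)), Complex.conj_re]
      ring
    refine (h2.add (hN.hasDerivAt_comp (hZ' t))).congr_deriv ?_
    have hmΩ : m (Ω (Z t)) = Ω (m (Z t)) := mulOp_comm hbm hbω _
    -- `a⁻² k = ω` makes the two mixed terms conjugate to each other
    have hmmκ : inner ℂ (m (Z t)) (m (κ (N (Z t)))) = inner ℂ (Ω (Z t)) (N (Z t)) := by
      rw [hm, inner_mulOp_ofReal hbm, mulOp_mulOp_eq hbm hbm (fun _ => rfl), hκ,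
        mulOp_mulOp_eq (hbm.mul hbm) hbk (c := fun x => ((A.indicator ω x : ℝ) : ℂ)), hΩ,
        inner_mulOp_ofReal hbω]
      intro x
      by_cases hx : x ∈ A
      · have := (ha0 x).ne'
        simp only [hx, indicator_of_mem, hka x]
        push_cast
        have : (a x : ℂ) ≠ 0 := by exact_mod_cast this
        field_simp
      · simp [hx]
    have i1 := inner_mulOp_ofReal_self_im hbω (m (Z t))
    have i2 := inner_mulOp_ofReal_self_im hbk (N (Z t))
    have i3 : (inner ℂ (N (Z t)) (Ω (Z t))).im = -(inner ℂ (Ω (Z t)) (N (Z t))).im := by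
      rw [← inner_conj_symm, Complex.conj_im]
    rw [hD, map_smul, map_add, hmΩ, inner_smul_right, inner_smul_right, inner_add_right,
      inner_add_right, hmmκ]
    simp only [← hΩ, ← hκ] at i1 i2
    simp only [Complex.mul_re, Complex.neg_re, Complex.neg_im, Complex.I_re, Complex.I_im,
      Complex.add_im, i1, i2, i3]
    ring
  exact is_const_of_deriv_eq_zero (fun t => (hE t).differentiableAt) (fun t => (hE t).deriv) t 0

/-- Convergence of the solutions of the truncated equations. -/
theorem IsMildSolution.tendsto_truncated (hω : Measurable ω) (hk : Measurable k) {C : NNReal}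
    (hkC : ∀ x, |k x| ≤ C) (hN : LipschitzWith L N) {A : ℕ → Set α} (hA : IsExhaustion A)
    (hZ : IsMildSolution ω k N Z) {Zn : ℕ → ℝ → Lp ℂ 2 μ}
    (hZn : ∀ n, IsMildSolution ω ((A n).indicator k) N (Zn n))
    (h0 : ∀ n, Zn n 0 = proj (A n) (Z 0)) {t : ℝ} (ht : 0 ≤ t) :
    Tendsto (fun n => Zn n t) atTop (𝓝 (Z t)) := by
  have hbk : ∀ n, IsBddSymbol fun x => (((A n).indicator k x : ℝ) : ℂ) := fun n =>
    isBddSymbol_indicator_ofReal hk (hA.measurableSet n) (fun x _ => hkC x)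
  have hbk0 : IsBddSymbol fun x => (k x : ℂ) :=
    ⟨Complex.measurable_ofReal.comp hk, C, fun x => by simpa using hkC x⟩
  have hbp : ∀ n, IsBddSymbol ((A n).indicator fun _ => (1 : ℂ)) := fun n =>
    isBddSymbol_indicator_one (hA.measurableSet n)
  have hkn : ∀ n x, |(A n).indicator k x| ≤ C := fun n x => by
    by_cases hx : x ∈ A n
    · simpa [hx] using hkC x
    · simp [hx]
  have hcontw : ∀ {k' : α → ℝ} {Z' : ℝ → Lp ℂ 2 μ}, IsMildSolution ω k' N Z' →
      Continuous fun τ => flow ω τ (Z' τ) := fun h =>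
    continuous_iff_continuousAt.mpr fun t => (h t).continuousAt
  have hpZ : ∀ n τ, proj (A n) (flow ω τ (Z τ)) = flow ω τ (proj (A n) (Z τ)) := fun n τ =>
    mulOp_flow_comm hω (hbp n) τ _
  have key : Tendsto (fun n => ‖flow ω t (Zn n t) - proj (A n) (flow ω t (Z t))‖) atTop (𝓝 0) := by
    rw [Metric.tendsto_atTop]
    intro ε hε
    have hg : Tendsto (fun δ => gronwallBound 0 (C * L : NNReal) δ (t - 0)) (𝓝 0) (𝓝 0) := by
      have := (gronwallBound_continuous_ε 0 (C * L : NNReal) (t - 0)).tendsto 0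
      rwa [gronwallBound_ε0_δ0] at this
    obtain ⟨δ, hδ, hδε⟩ := Metric.eventually_nhds_iff.mp (hg.eventually (gt_mem_nhds hε))
    obtain ⟨n₀, hn₀⟩ := eventually_atTop.mp (Metric.tendstoUniformlyOn_iff.mp
      (hA.tendstoUniformlyOn (hcontw hZ) t) (δ / 2 / ((C * L : NNReal) + 1)) (by positivity))
    refine ⟨n₀, fun n hn => ?_⟩
    rw [dist_zero_right, norm_norm]
    have hG := dist_le_of_approx_trajectories_ODE (a := 0) (b := t) (δ := 0) (εf := 0)
      (εg := δ / 2) (lipschitzWith_interaction hω (hk.indicator (hA.measurableSet n)) (hkn n) hN)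
      (hcontw (hZn n)).continuousOn (fun τ _ => (hZn n τ).hasDerivWithinAt)
      (fun τ _ => by simp [flow_neg_flow hω])
      ((proj (A n)).continuous.comp (hcontw hZ)).continuousOn
      (fun τ _ => (((proj (A n) : Lp ℂ 2 μ →L[ℂ] Lp ℂ 2 μ).restrictScalars
        ℝ).hasFDerivAt.comp_hasDerivAt τ (hZ τ)).hasDerivWithinAt)
      (fun τ hτ => by
        have hτ' := hn₀ n hn τ (Ico_subset_Icc_self hτ)
        rw [dist_zero_left, norm_norm] at hτ'
        have e1 : proj (A n) (-Complex.I • flow ω τ (mulOp (fun x => (k x : ℂ)) (N (Z τ)))) =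
            -Complex.I • flow ω τ (mulOp (fun x => (((A n).indicator k x : ℝ) : ℂ)) (N (Z τ))) := by
          rw [map_smul, proj, mulOp_flow_comm hω (hbp n),
            mulOp_mulOp_eq (hbp n) hbk0 (fun x => ?_)]
          by_cases hx : x ∈ A n <;> simp [hx]
        have hlip := (lipschitzWith_interaction hω (hk.indicator (hA.measurableSet n)) (hkn n)
          hN τ).dist_le_mul (flow ω τ (Z τ)) (proj (A n) (flow ω τ (Z τ)))
        simp only [flow_neg_flow hω] at hlip
        rw [ContinuousLinearMap.coe_restrictScalars', e1]
        refine hlip.trans ?_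
        rw [dist_eq_norm]
        calc _ ≤ ((C * L : NNReal) + 1 : ℝ) * (δ / 2 / ((C * L : NNReal) + 1)) := by
              gcongr
              linarith
          _ = δ / 2 := by field_simp)
      (by simp [h0, flow_zero]) t (right_mem_Icc.mpr ht)
    rw [dist_eq_norm, zero_add] at hG
    refine hG.trans_lt (hδε ?_)
    rw [dist_zero_right, Real.norm_of_nonneg (by positivity)]
    linarith
  have key2 : Tendsto (fun n => flow ω (-t) (flow ω t (Zn n t) - proj (A n) (flow ω t (Z t))))
      atTop (𝓝 0) := by
    rw [tendsto_zero_iff_norm_tendsto_zero]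
    simpa only [norm_flow hω] using key
  have key3 := key2.add (hA.tendsto_proj (Z t))
  simpa [hpZ, flow_neg_flow hω] using key3

theorem IsMildSolution.energy_le_of_nonneg (hω : Measurable ω) (ha : Measurable a)
    (ha0 : ∀ x, 0 < a x) {Ca : ℝ} (haC : ∀ x, a x ≤ Ca) (hk : Measurable k) {C : NNReal}
    (hkC : ∀ x, |k x| ≤ C) (hka : ∀ x, k x = ω x * a x ^ 2) (hN : HasPotential N Γ L)
    (hZ : IsMildSolution ω k N Z) {Y₀ : Lp ℂ 2 μ} (hY₀ : mulOp (fun x => (a x : ℂ)) Y₀ = Z 0)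
    {t : ℝ} (ht : 0 ≤ t) :
    ∃ Y : Lp ℂ 2 μ, mulOp (fun x => (a x : ℂ)) Y = Z t ∧
      ‖Y‖ ^ 2 / 2 + Γ (Z t) ≤ ‖Y₀‖ ^ 2 / 2 + Γ (Z 0) := by
  have hA := isExhaustion_levelSet hω ha ha0
  have hbp : ∀ n, IsBddSymbol ((levelSet ω a n).indicator fun _ => (1 : ℂ)) := fun n =>
    isBddSymbol_indicator_one (hA.measurableSet n)
  have hba : IsBddSymbol fun x => (a x : ℂ) :=
    ⟨Complex.measurable_ofReal.comp ha, Ca, fun x => by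
      simpa [abs_of_pos (ha0 x)] using haC x⟩
  have hbm := isBddSymbol_inv_levelSet hω ha ha0
  choose Zn hZn0 hZn using fun n => exists_isMildSolution (μ := μ) hω (C := C)
    (hk.indicator (hA.measurableSet n)) (fun x => by
      by_cases hx : x ∈ levelSet ω a n
      · simpa [hx] using hkC x
      · simp [hx]) hN.lipschitz hN.map_zero (proj (levelSet ω a n) (Z 0))
  have hlim := hZ.tendsto_truncated hω hk hkC hN.lipschitz hA hZn hZn0 ht
  have hE : ∀ n, ‖mulOp (fun x => (((levelSet ω a n).indicator (fun y => (a y)⁻¹) x : ℝ) : ℂ))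
      (Zn n t)‖ ^ 2 / 2 + Γ (Zn n t) ≤
        ‖Y₀‖ ^ 2 / 2 + Γ (proj (levelSet ω a n) (Z 0)) := fun n => by
    have h1 := (hZn n).truncated_energy hω ha ha0 hk hkC hka hN n (by
      rw [hZn0, proj, mulOp_mulOp_eq (hbp n) (hbp n) (fun x => ?_)]
      by_cases hx : x ∈ levelSet ω a n <;> simp [hx]) t
    rw [h1, hZn0, ← hY₀]
    have h2 : mulOp (fun x => (((levelSet ω a n).indicator (fun y => (a y)⁻¹) x : ℝ) : ℂ))
        (proj (levelSet ω a n) (mulOp (fun x => (a x : ℂ)) Y₀)) = proj (levelSet ω a n) Y₀ := by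
      rw [proj, mulOp_mulOp_eq (hbp n) hba (fun _ => rfl),
        mulOp_mulOp_eq (hbm n) ((hbp n).mul hba) (fun x => ?_)]
      by_cases hx : x ∈ levelSet ω a n
      · have : (a x : ℂ) ≠ 0 := by exact_mod_cast (ha0 x).ne'
        simp [hx, this]
      · simp [hx]
    rw [h2]
    gcongr
    exact norm_proj_le (hA.measurableSet n) Y₀
  have hlimE : ∀ j, ‖mulOp (fun x => (((levelSet ω a j).indicator (fun y => (a y)⁻¹) x : ℝ) : ℂ))
      (Z t)‖ ^ 2 / 2 + Γ (Z t) ≤ ‖Y₀‖ ^ 2 / 2 + Γ (Z 0) := fun j => by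
    refine le_of_tendsto_of_tendsto
      (((((mulOp _).continuous.tendsto _).comp hlim).norm.pow 2).div_const 2 |>.add
        ((hN.continuous.tendsto _).comp hlim))
      (tendsto_const_nhds.add ((hN.continuous.tendsto _).comp (hA.tendsto_proj (Z 0)))) ?_
    filter_upwards [eventually_ge_atTop j] with n hn
    refine le_trans ?_ (hE n)
    have h3 : mulOp (fun x => (((levelSet ω a j).indicator (fun y => (a y)⁻¹) x : ℝ) : ℂ))
        (Zn n t) = proj (levelSet ω a j)
        (mulOp (fun x => (((levelSet ω a n).indicator (fun y => (a y)⁻¹) x : ℝ) : ℂ)) (Zn n t)) := by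
      refine (mulOp_mulOp_eq (hbp j) (hbm n) (fun x => ?_) _).symm
      by_cases hx : x ∈ levelSet ω a j
      · have := hA.mono hn hx
        simp [hx, this]
      · simp [hx]
    simp only [Function.comp_apply]
    rw [h3]
    gcongr
    exact norm_proj_le (hA.measurableSet j) _
  obtain ⟨Y, hY, hYR⟩ := exists_mulOp_eq_of_norm_le (μ := μ) hba
    (fun x => by exact_mod_cast (ha0 x).ne') hbm (fun x => by
      refine tendsto_const_nhds.congr' ?_
      filter_upwards [hA.eventually_mem x] with n hn
      simp [hn]) (Z := Z t) (R := Real.sqrt (2 * (‖Y₀‖ ^ 2 / 2 + Γ (Z 0) - Γ (Z t))))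
      (fun n => Real.le_sqrt_of_sq_le (by linarith [hlimE n]))
  refine ⟨Y, hY, ?_⟩
  have hpos : 0 ≤ 2 * (‖Y₀‖ ^ 2 / 2 + Γ (Z 0) - Γ (Z t)) := by
    have := hlimE 0
    have h5 := sq_nonneg ‖mulOp (fun x => (((levelSet ω a 0).indicator
      (fun y => (a y)⁻¹) x : ℝ) : ℂ)) (Z t)‖
    linarith
  have := (Real.le_sqrt (norm_nonneg _) hpos).mp hYR
  linarith

/-- The energy inequality between any two times. The equation runs backwards in time when the signs
of `ω` and `k` are reversed. -/
theorem IsMildSolution.energy_le (hω : Measurable ω) (ha : Measurable a)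
    (ha0 : ∀ x, 0 < a x) {Ca : ℝ} (haC : ∀ x, a x ≤ Ca) (hk : Measurable k) {C : NNReal}
    (hkC : ∀ x, |k x| ≤ C) (hka : ∀ x, k x = ω x * a x ^ 2) (hN : HasPotential N Γ L)
    (hZ : IsMildSolution ω k N Z) {s : ℝ} {Y₀ : Lp ℂ 2 μ}
    (hY₀ : mulOp (fun x => (a x : ℂ)) Y₀ = Z s) (t : ℝ) :
    ∃ Y : Lp ℂ 2 μ, mulOp (fun x => (a x : ℂ)) Y = Z t ∧
      ‖Y‖ ^ 2 / 2 + Γ (Z t) ≤ ‖Y₀‖ ^ 2 / 2 + Γ (Z s) := by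
  have hZs := hZ.comp_add hω s
  have hbk0 : IsBddSymbol fun x => (k x : ℂ) :=
    ⟨Complex.measurable_ofReal.comp hk, C, fun x => by simpa using hkC x⟩
  rcases le_total s t with h | h
  · have := hZs.energy_le_of_nonneg hω ha ha0 haC hk hkC hka hN (Y₀ := Y₀) (by simpa using hY₀)
      (t := t - s) (by linarith)
    simpa using this
  · have := (hZs.comp_neg hbk0).energy_le_of_nonneg hω.neg ha ha0 haC hk.neg (C := C)
      (fun x => by simpa using hkC x) (fun x => by simp [hka x]) hN (Y₀ := Y₀)
      (by simpa using hY₀) (t := s - t) (by linarith)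
    simpa using this

/-- **Conservation of energy.** If `Z(0) = a Y(0)` with `Y(0)` in `L²`, where `k = ω a²`, then
the solution of `Z' = -i ω Z - i k N(Z)` is global, `Z = a Y` with `Y` continuous in `L²`, and
the energy is constant. The continuity of `Y` is a consequence of its weak continuity and of the
continuity of its norm, which is that of `Γ(Z)`. -/
theorem exists_isMildSolution_energy (hω : Measurable ω) (ha : Measurable a)
    (ha0 : ∀ x, 0 < a x) {Ca : ℝ} (haC : ∀ x, a x ≤ Ca) (hk : Measurable k) {C : NNReal}
    (hkC : ∀ x, |k x| ≤ C) (hka : ∀ x, k x = ω x * a x ^ 2) (hN : HasPotential N Γ L)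
    (Y₀ : Lp ℂ 2 μ) :
    ∃ Y : ℝ → Lp ℂ 2 μ, Continuous Y ∧ Y 0 = Y₀ ∧
      IsMildSolution ω k N (fun t => mulOp (fun x => (a x : ℂ)) (Y t)) ∧
      ∀ t, ‖Y t‖ ^ 2 / 2 + Γ (mulOp (fun x => (a x : ℂ)) (Y t)) =
        ‖Y₀‖ ^ 2 / 2 + Γ (mulOp (fun x => (a x : ℂ)) Y₀) := by
  have hba : IsBddSymbol fun x => (a x : ℂ) :=
    ⟨Complex.measurable_ofReal.comp ha, Ca, fun x => by
      simpa [abs_of_pos (ha0 x)] using haC x⟩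
  have hinj : Function.Injective (mulOp (fun x => (a x : ℂ)) : Lp ℂ 2 μ →L[ℂ] Lp ℂ 2 μ) :=
    mulOp_injective hba (Eventually.of_forall fun x => by exact_mod_cast (ha0 x).ne')
  obtain ⟨Z, hZ0, hZ⟩ := exists_isMildSolution (μ := μ) hω hk hkC hN.lipschitz hN.map_zero
    (mulOp (fun x => (a x : ℂ)) Y₀)
  have hle := fun (s t : ℝ) (Y₁ : Lp ℂ 2 μ) (h : mulOp (fun x => (a x : ℂ)) Y₁ = Z s) =>
    hZ.energy_le hω ha ha0 haC hk hkC hka hN h t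
  choose Y hY hYE using fun t => hle 0 t Y₀ hZ0.symm
  have hY0 : Y 0 = Y₀ := hinj (by rw [hY 0, hZ0])
  have hE : ∀ t, ‖Y t‖ ^ 2 / 2 + Γ (Z t) = ‖Y₀‖ ^ 2 / 2 + Γ (Z 0) := fun t => by
    refine le_antisymm (hYE t) ?_
    obtain ⟨Y', hY', hE'⟩ := hle t 0 (Y t) (hY t)
    rwa [hinj (hY'.trans hZ0)] at hE'
  have hZc := hZ.continuous hω
  have hA := isExhaustion_levelSet hω ha ha0
  have hbp : ∀ n, IsBddSymbol ((levelSet ω a n).indicator fun _ => (1 : ℂ)) := fun n =>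
    isBddSymbol_indicator_one (hA.measurableSet n)
  have hnorm : Continuous fun t => ‖Y t‖ ^ 2 := by
    have : (fun t => ‖Y t‖ ^ 2) = fun t => 2 * (‖Y₀‖ ^ 2 / 2 + Γ (Z 0) - Γ (Z t)) := by
      funext t; linarith [hE t]
    rw [this]
    have := hN.continuous.comp hZc
    exact continuous_const.mul (continuous_const.sub this)
  have hprojc : ∀ n, Continuous fun t => proj (levelSet ω a n) (Y t) := fun n => by
    have hbm := isBddSymbol_inv_levelSet hω ha ha0 n
    have : (fun t => proj (levelSet ω a n) (Y t)) = fun t =>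
        mulOp (fun x => (((levelSet ω a n).indicator (fun y => (a y)⁻¹) x : ℝ) : ℂ)) (Z t) := by
      funext t
      rw [← hY t]
      refine (mulOp_mulOp_eq hbm hba (fun x => ?_) _).symm
      by_cases hx : x ∈ levelSet ω a n
      · have : (a x : ℂ) ≠ 0 := by exact_mod_cast (ha0 x).ne'
        simp [hx, this]
      · simp [hx]
    rw [this]
    exact (mulOp _).continuous.comp hZc
  have hYc : Continuous Y := by
    refine continuous_iff_continuousAt.mpr fun t₀ => ?_
    have hin : Continuous fun t => inner ℂ (Y t) (Y t₀) := by
      set R := Real.sqrt (2 * (‖Y₀‖ ^ 2 / 2 + Γ (Z 0))) with hRdef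
      have hR : ∀ t, ‖Y t‖ ≤ R := fun t =>
        Real.le_sqrt_of_sq_le (by linarith [hE t, hN.nonneg (Z t)])
      have hunif : TendstoUniformly
          (fun n t => inner ℂ (proj (levelSet ω a n) (Y t)) (Y t₀))
          (fun t => inner ℂ (Y t) (Y t₀)) atTop := by
        rw [Metric.tendstoUniformly_iff]
        intro ε hε
        have h1 := (((hA.tendsto_proj (Y t₀)).const_sub (Y t₀)).norm).const_mul R
        rw [sub_self, norm_zero, mul_zero] at h1
        filter_upwards [h1.eventually (gt_mem_nhds hε)] with n hn t
        have h2 : inner ℂ (proj (levelSet ω a n) (Y t)) (Y t₀) =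
            inner ℂ (Y t) (proj (levelSet ω a n) (Y t₀)) := by
          have := inner_mulOp_left (hbp n) (Y t) (Y t₀)
          have e : (fun x => starRingEnd ℂ ((levelSet ω a n).indicator (fun _ => (1 : ℂ)) x)) =
              (levelSet ω a n).indicator fun _ => 1 := by
            funext x; by_cases hx : x ∈ levelSet ω a n <;> simp [hx]
          rw [e] at this
          exact this
        rw [dist_eq_norm, h2, ← inner_sub_right]
        refine (norm_inner_le_norm _ _).trans_lt (lt_of_le_of_lt ?_ hn)
        gcongr
        exact hR t
      exact hunif.continuous
        (Frequently.of_forall fun n => (hprojc n).inner continuous_const)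
    rw [ContinuousAt, tendsto_iff_norm_sub_tendsto_zero]
    have hsq : Tendsto (fun t => ‖Y t - Y t₀‖ ^ 2) (𝓝 t₀) (𝓝 0) := by
      have h1 : ∀ t, ‖Y t - Y t₀‖ ^ 2 =
          ‖Y t‖ ^ 2 - 2 * (inner ℂ (Y t) (Y t₀)).re + ‖Y t₀‖ ^ 2 := fun t =>
        norm_sub_sq (𝕜 := ℂ) (Y t) (Y t₀)
      simp_rw [h1]
      have h2 := ((hnorm.tendsto t₀).sub
        (((Complex.continuous_re.comp hin).tendsto t₀).const_mul 2)).add_const (‖Y t₀‖ ^ 2)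
      have h3 : (inner ℂ (Y t₀) (Y t₀)).re = ‖Y t₀‖ ^ 2 := inner_self_eq_norm_sq (𝕜 := ℂ) _
      simp only [Function.comp_apply, h3] at h2
      convert h2 using 2
      ring
    have := (Real.continuous_sqrt.tendsto 0).comp hsq
    simpa [Function.comp_def] using this
  refine ⟨Y, hYc, hY0, ?_, fun t => ?_⟩
  · have : (fun t => mulOp (fun x => (a x : ℂ)) (Y t)) = Z := funext hY
    rw [this]; exact hZ
  · rw [hY t, hE t, hZ0]

end SemilinearEnergy

/-! ### Distributions represented by functions -/

section Representation

open Filter Topology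

theorem RepresentedBy.locallyIntegrable {u : 𝓢'(ℝ, ℂ)} {f : ℝ → ℂ} (h : RepresentedBy u f) :
    LocallyIntegrable f := by
  intro x
  let χ : ContDiffBump x := ⟨1, 2, one_pos, one_lt_two⟩
  have hc : HasCompactSupport fun y => ((χ y : ℝ) : ℂ) :=
    χ.hasCompactSupport.comp_left (g := ((↑) : ℝ → ℂ)) (by simp)
  have hd : ContDiff ℝ (⊤ : ℕ∞) fun y => ((χ y : ℝ) : ℂ) :=
    Complex.ofRealCLM.contDiff.comp χ.contDiff
  have h1 := (h (hc.toSchwartzMap hd)).1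
  refine ⟨Metric.ball x 1, Metric.ball_mem_nhds x one_pos, ?_⟩
  refine (h1.integrableOn (s := Metric.ball x 1)).congr_fun (fun y hy => ?_) measurableSet_ball
  have : χ y = 1 := χ.one_of_mem_closedBall (Metric.ball_subset_closedBall hy)
  simp [this]

theorem RepresentedBy.ae_eq {u : 𝓢'(ℝ, ℂ)} {f g : ℝ → ℂ} (hf : RepresentedBy u f)
    (hg : RepresentedBy u g) : f =ᵐ[volume] g := by
  refine ae_eq_of_integral_contDiff_smul_eq hf.locallyIntegrable hg.locallyIntegrable
    fun χ hχ hc => ?_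
  have hc' : HasCompactSupport fun y => ((χ y : ℝ) : ℂ) :=
    hc.comp_left (g := ((↑) : ℝ → ℂ)) (by simp)
  have hd : ContDiff ℝ (⊤ : ℕ∞) fun y => ((χ y : ℝ) : ℂ) := Complex.ofRealCLM.contDiff.comp hχ
  have h1 := (hf (hc'.toSchwartzMap hd)).2
  rw [(hg (hc'.toSchwartzMap hd)).2] at h1
  simpa using h1.symm

theorem RepresentedBy.eq {u v : 𝓢'(ℝ, ℂ)} {f g : ℝ → ℂ} (hf : RepresentedBy u f)
    (hg : RepresentedBy v g) (h : f =ᵐ[volume] g) : u = v := by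
  ext η
  rw [(hf η).2, (hg η).2]
  exact integral_congr_ae (h.mono fun x hx => by simp only [hx])

theorem RepresentedBy.congr {u : 𝓢'(ℝ, ℂ)} {f g : ℝ → ℂ} (hf : RepresentedBy u f)
    (h : f =ᵐ[volume] g) : RepresentedBy u g := fun η => by
  have h' : (fun x => η x * f x) =ᵐ[volume] fun x => η x * g x :=
    h.mono fun x hx => by simp only [hx]
  exact ⟨(hf η).1.congr h', by rw [(hf η).2, integral_congr_ae h']⟩

theorem representedBy_toTemperedDistribution (f : Lp ℂ 2 (volume : Measure ℝ)) :
    RepresentedBy (f : 𝓢'(ℝ, ℂ)) f := fun η =>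
  ⟨MemLp.integrable_mul (p := 2) (q := 2) (η.memLp 2) (Lp.memLp f), by simp⟩

theorem RepresentedBy.smulLeftCLM {u : 𝓢'(ℝ, ℂ)} {f : ℝ → ℂ} (hf : RepresentedBy u f) {c : ℝ → ℂ}
    (hc : c.HasTemperateGrowth) :
    RepresentedBy (TemperedDistribution.smulLeftCLM ℂ c u) (fun x => c x * f x) := fun η => by
  have h := hf (SchwartzMap.smulLeftCLM ℂ c η)
  have e : (fun x => SchwartzMap.smulLeftCLM ℂ c η x * f x) = fun x => η x * (c x * f x) := by
    funext x
    rw [SchwartzMap.smulLeftCLM_apply_apply hc, smul_eq_mul]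
    ring
  rw [e] at h
  exact h

theorem representedBy_fourier (f : Lp ℂ 2 (volume : Measure ℝ)) :
    RepresentedBy (𝓕 (f : 𝓢'(ℝ, ℂ))) (𝓕 f : Lp ℂ 2 (volume : Measure ℝ)) := by
  rw [Lp.fourier_toTemperedDistribution_eq]
  exact representedBy_toTemperedDistribution _

theorem fourier_dxx (u : 𝓢'(ℝ, ℂ)) : 𝓕 (dxx u) =
    TemperedDistribution.smulLeftCLM ℂ (fun ξ : ℝ => ((-(2 * Real.pi * ξ) ^ 2 : ℝ) : ℂ)) (𝓕 u) := by
  have hg : (fun ξ : ℝ => ((-(2 * Real.pi * ξ) ^ 2 : ℝ) : ℂ)).HasTemperateGrowth := by fun_prop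
  ext η
  rw [TemperedDistribution.smulLeftCLM_apply_apply, TemperedDistribution.fourier_apply,
    TemperedDistribution.fourier_apply, dxx, TemperedDistribution.derivCLM_apply_apply,
    TemperedDistribution.derivCLM_apply_apply]
  congr 1
  have hd : ∀ θ : 𝓢(ℝ, ℂ), SchwartzMap.derivCLM ℂ ℂ (𝓕 θ) =
      𝓕 (SchwartzMap.smulLeftCLM ℂ (fun ξ : ℝ => (-(2 * Real.pi * ξ) : ℂ) * Complex.I) θ) :=
    fun θ => by
      have hg' : (fun ξ : ℝ => (-(2 * Real.pi * ξ) : ℂ) * Complex.I).HasTemperateGrowth := by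
        fun_prop
      ext x
      rw [SchwartzMap.derivCLM_apply, SchwartzMap.fourier_coe, SchwartzMap.fourier_coe,
        Real.deriv_fourier θ.integrable]
      · refine congrFun (congrArg _ (funext fun ξ => ?_)) x
        rw [SchwartzMap.smulLeftCLM_apply_apply hg']
        simp only [smul_eq_mul]
        ring
      · have := θ.integrable_pow_mul volume 1
        refine (integrable_norm_iff (by fun_prop)).mp ?_
        simpa [norm_smul] using this
  rw [map_neg, neg_neg, hd, hd, SchwartzMap.smulLeftCLM_smulLeftCLM_apply (by fun_prop)
    (by fun_prop)]
  congr 3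
  funext ξ
  simp only [Pi.mul_apply]
  push_cast
  ring_nf
  simp

theorem RepresentedBy.dxx {u : 𝓢'(ℝ, ℂ)} {f : ℝ → ℂ} (hf : RepresentedBy (𝓕 u) f) :
    RepresentedBy (𝓕 (dxx u)) (fun ξ => ((-(2 * Real.pi * ξ) ^ 2 : ℝ) : ℂ) * f ξ) := by
  rw [fourier_dxx]
  exact hf.smulLeftCLM (by fun_prop)

/-- The Fourier multipliers of the distributions with Fourier transform `f`, in terms of `f`. -/
theorem IsMultiplier.representedBy {m : ℝ → ℝ} {u v : 𝓢'(ℝ, ℂ)} {f : ℝ → ℂ}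
    (h : IsMultiplier m u v) (hf : RepresentedBy (𝓕 u) f) :
    RepresentedBy (𝓕 v) (fun ξ => (m (2 * Real.pi * ξ) : ℂ) * f ξ) := by
  obtain ⟨f', hf', hv⟩ := h
  exact hv.congr ((hf'.ae_eq hf).mono fun ξ hξ => by simp only [hξ])

end Representation

/-! ### Real distributions and the conjugate reflection -/

section Reflection

open Filter Topology

/-- The conjugate reflection `f ↦ conj (f (-ξ))` on `L²`: on the side of the Fourier transform, it
is the complex conjugation. -/
def conjRefl : Lp ℂ 2 (volume : Measure ℝ) →L[ℝ] Lp ℂ 2 (volume : Measure ℝ) :=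
  (Complex.conjCLE : ℂ →L[ℝ] ℂ).compLpL 2 volume ∘L
    (Lp.compMeasurePreservingₗᵢ ℝ (fun x : ℝ => -x)
      (Measure.measurePreserving_neg volume)).toContinuousLinearMap

theorem ae_neg {p : ℝ → Prop} (h : ∀ᵐ x, p x) : ∀ᵐ x : ℝ, p (-x) :=
  (Measure.measurePreserving_neg volume).quasiMeasurePreserving.ae h

theorem coeFn_conjRefl (f : Lp ℂ 2 (volume : Measure ℝ)) :
    conjRefl f =ᵐ[volume] fun x => starRingEnd ℂ (f (-x)) := by
  have h1 := ContinuousLinearMap.coeFn_compLpL (p := 2) (μ := (volume : Measure ℝ))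
    (Complex.conjCLE : ℂ →L[ℝ] ℂ) (Lp.compMeasurePreserving (fun x : ℝ => -x)
      (Measure.measurePreserving_neg volume) f)
  have h2 := Lp.coeFn_compMeasurePreserving f (Measure.measurePreserving_neg (volume : Measure ℝ))
  filter_upwards [h1, h2] with x hx hx'
  refine hx.trans ?_
  rw [hx']
  simp

theorem norm_conjRefl_le (f : Lp ℂ 2 (volume : Measure ℝ)) : ‖conjRefl f‖ ≤ ‖f‖ := by
  have h1 : ‖conjRefl f‖ ≤ 1 * ‖Lp.compMeasurePreserving (fun x : ℝ => -x)
      (Measure.measurePreserving_neg volume) f‖ := by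
    refine Lp.norm_le_mul_norm_of_ae_le_mul ?_
    filter_upwards [coeFn_conjRefl f,
      Lp.coeFn_compMeasurePreserving f (Measure.measurePreserving_neg (volume : Measure ℝ))]
      with x h1 h2
    rw [h1, h2]
    simp
  rwa [one_mul, Lp.norm_compMeasurePreserving] at h1

theorem conjRefl_conjRefl (f : Lp ℂ 2 (volume : Measure ℝ)) : conjRefl (conjRefl f) = f := by
  refine Lp.ext ?_
  filter_upwards [coeFn_conjRefl (conjRefl f), ae_neg (coeFn_conjRefl f)] with x h1 h2
  rw [h1, h2]
  simp

theorem conjRefl_smul (c : ℂ) (f : Lp ℂ 2 (volume : Measure ℝ)) :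
    conjRefl (c • f) = starRingEnd ℂ c • conjRefl f := by
  refine Lp.ext ?_
  filter_upwards [coeFn_conjRefl (c • f), ae_neg (Lp.coeFn_smul c f), coeFn_conjRefl f,
    Lp.coeFn_smul (starRingEnd ℂ c) (conjRefl f)] with x h1 h2 h3 h4
  rw [h1, h2, h4, Pi.smul_apply, Pi.smul_apply, h3]
  simp

/-- An even real multiplier commutes with the conjugate reflection. -/
theorem conjRefl_mulOp {a : ℝ → ℂ} (ha : IsBddSymbol a)
    (h : ∀ x, starRingEnd ℂ (a (-x)) = a x) (f : Lp ℂ 2 (volume : Measure ℝ)) :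
    conjRefl (mulOp a f) = mulOp a (conjRefl f) := by
  refine Lp.ext ?_
  filter_upwards [coeFn_conjRefl (mulOp a f), ae_neg (coeFn_mulOp ha f), coeFn_conjRefl f,
    coeFn_mulOp ha (conjRefl f)] with x h1 h2 h3 h4
  rw [h1, h2, h4, h3, map_mul, h]

/-- The complex conjugate of a Schwartz function. -/
def conjSchwartz (η : 𝓢(ℝ, ℂ)) : 𝓢(ℝ, ℂ) :=
  SchwartzMap.postcompCLM (𝕜 := ℝ) (Complex.conjCLE : ℂ →L[ℝ] ℂ) η

theorem conjSchwartz_apply (η : 𝓢(ℝ, ℂ)) (x : ℝ) :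
    conjSchwartz η x = starRingEnd ℂ (η x) := by
  simp [conjSchwartz]

theorem fourierInv_conj (f : ℝ → ℂ) (x : ℝ) :
    𝓕⁻ (fun y => starRingEnd ℂ (f y)) x = starRingEnd ℂ (𝓕⁻ f (-x)) := by
  rw [Real.fourierInv_eq', Real.fourierInv_eq', ← integral_conj]
  congr 1
  funext y
  simp only [smul_eq_mul, map_mul, ← Complex.exp_conj]
  congr 2
  simp [Complex.conj_ofNat]

theorem fourierInv_conjSchwartz (η : 𝓢(ℝ, ℂ)) (x : ℝ) :
    𝓕⁻ (conjSchwartz η) x = starRingEnd ℂ (𝓕⁻ η (-x)) := by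
  rw [SchwartzMap.fourierInv_coe, SchwartzMap.fourierInv_coe, ← fourierInv_conj]
  rfl

/-- The inverse Fourier transform turns the conjugate reflection into the conjugation. -/
theorem coeFn_fourierInv_conjRefl (f : Lp ℂ 2 (volume : Measure ℝ)) :
    (𝓕⁻ (conjRefl f) : Lp ℂ 2 (volume : Measure ℝ)) =ᵐ[volume]
      fun x => starRingEnd ℂ ((𝓕⁻ f : Lp ℂ 2 (volume : Measure ℝ)) x) := by
  set c : Lp ℂ 2 (volume : Measure ℝ) →L[ℝ] Lp ℂ 2 (volume : Measure ℝ) :=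
    (Complex.conjCLE : ℂ →L[ℝ] ℂ).compLpL 2 volume with hc
  have hcc : ∀ g : Lp ℂ 2 (volume : Measure ℝ), c g =ᵐ[volume] fun x => starRingEnd ℂ (g x) :=
    fun g => (ContinuousLinearMap.coeFn_compLpL (p := 2) (μ := (volume : Measure ℝ))
      (Complex.conjCLE : ℂ →L[ℝ] ℂ) g).trans (Eventually.of_forall fun x => by simp)
  suffices h : 𝓕⁻ (conjRefl f) = c (𝓕⁻ f) by rw [h]; exact hcc _
  refine DenseRange.induction_on (p := fun f => 𝓕⁻ (conjRefl f) = c (𝓕⁻ f))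
    (SchwartzMap.denseRange_toLpCLM (F := ℂ) (E := ℝ) (μ := volume) (p := 2)
      ENNReal.ofNat_ne_top) f ?_ fun η => ?_
  · have hF : Continuous fun f : Lp ℂ 2 (volume : Measure ℝ) => 𝓕⁻ f :=
      (Lp.fourierTransformₗᵢ ℝ ℂ).symm.continuous
    exact isClosed_eq (hF.comp conjRefl.continuous) (c.continuous.comp hF)
  · set η' : 𝓢(ℝ, ℂ) := conjSchwartz (SchwartzMap.compCLMOfContinuousLinearEquiv ℂ
      (ContinuousLinearEquiv.neg ℝ (M := ℝ)) η) with hη'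
    have hη'x : ∀ x, η' x = starRingEnd ℂ (η (-x)) := fun x => by
      rw [hη', conjSchwartz_apply]; rfl
    have e1 : conjRefl (η.toLp 2 volume) = η'.toLp 2 volume := by
      refine Lp.ext ?_
      filter_upwards [coeFn_conjRefl (η.toLp 2 volume), ae_neg (η.coeFn_toLp 2 volume),
        η'.coeFn_toLp 2 volume] with x h1 h2 h3
      rw [h1, h2, h3, hη'x]
    show 𝓕⁻ (conjRefl (η.toLp 2 volume)) = c (𝓕⁻ (η.toLp 2 volume))
    rw [e1, SchwartzMap.toLp_fourierInv_eq, SchwartzMap.toLp_fourierInv_eq]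
    refine Lp.ext ?_
    filter_upwards [(𝓕⁻ η').coeFn_toLp 2 volume, (𝓕⁻ η).coeFn_toLp 2 volume,
      hcc ((𝓕⁻ η).toLp 2 volume)] with x h1 h2 h3
    rw [h1, h3, h2, hη', fourierInv_conjSchwartz]
    congr 1
    rw [SchwartzMap.fourierInv_coe, SchwartzMap.fourierInv_coe, Real.fourierInv_eq',
      Real.fourierInv_eq', ← integral_neg_eq_self]
    congr 1
    funext y
    simp

theorem RepresentedBy.conj_apply_conjSchwartz {u : 𝓢'(ℝ, ℂ)} {f : ℝ → ℂ}
    (hf : RepresentedBy (𝓕 u) f) (η : 𝓢(ℝ, ℂ)) :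
    starRingEnd ℂ (u (conjSchwartz η)) = ∫ ξ, 𝓕⁻ η ξ * starRingEnd ℂ (f (-ξ)) := by
  have h1 : u (conjSchwartz η) = ∫ ξ, 𝓕⁻ (conjSchwartz η) ξ * f ξ := by
    rw [← (hf _).2, TemperedDistribution.fourier_apply, fourier_fourierInv_eq]
  rw [h1, ← integral_conj, ← integral_neg_eq_self]
  congr 1
  funext ξ
  rw [fourierInv_conjSchwartz]
  simp

theorem RepresentedBy.apply {u : 𝓢'(ℝ, ℂ)} {f : ℝ → ℂ}
    (hf : RepresentedBy (𝓕 u) f) (η : 𝓢(ℝ, ℂ)) : u η = ∫ ξ, 𝓕⁻ η ξ * f ξ := by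
  rw [← (hf _).2, TemperedDistribution.fourier_apply, fourier_fourierInv_eq]

theorem isRealDistribution_of_hermitian {u : 𝓢'(ℝ, ℂ)} {f : ℝ → ℂ}
    (hf : RepresentedBy (𝓕 u) f) (h : ∀ᵐ ξ, starRingEnd ℂ (f (-ξ)) = f ξ) :
    IsRealDistribution u := by
  intro η hη
  have h1 : conjSchwartz η = η := by
    ext x
    rw [conjSchwartz_apply]
    exact Complex.conj_eq_iff_im.mpr (hη x)
  have h2 := hf.conj_apply_conjSchwartz η
  rw [h1, integral_congr_ae (g := fun ξ => 𝓕⁻ η ξ * f ξ)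
    (h.mono fun ξ hξ => by simp only [hξ]), ← hf.apply] at h2
  exact Complex.conj_eq_iff_im.mp h2

theorem IsRealDistribution.hermitian {u : 𝓢'(ℝ, ℂ)} {f : ℝ → ℂ} (hu : IsRealDistribution u)
    (hf : RepresentedBy (𝓕 u) f) : ∀ᵐ ξ, starRingEnd ℂ (f (-ξ)) = f ξ := by
  have h1 : ∀ η, starRingEnd ℂ (u (conjSchwartz η)) = u η := fun η => by
    set η₁ : 𝓢(ℝ, ℂ) := (2⁻¹ : ℂ) • (η + conjSchwartz η) with h₁
    set η₂ : 𝓢(ℝ, ℂ) := (-Complex.I / 2) • (η - conjSchwartz η) with h₂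
    have r₁ : (u η₁).im = 0 := hu _ fun x => by
      simp [h₁, conjSchwartz_apply]
    have r₂ : (u η₂).im = 0 := hu _ fun x => by
      simp [h₂, conjSchwartz_apply]
    have e₁ : η = η₁ + Complex.I • η₂ := by
      ext x
      simp only [h₁, h₂, add_apply, smul_apply, sub_apply, smul_eq_mul]
      linear_combination ((η x - conjSchwartz η x) / 2) * Complex.I_mul_I
    have e₂ : conjSchwartz η = η₁ - Complex.I • η₂ := by
      ext x
      simp only [h₁, h₂, add_apply, smul_apply, sub_apply, smul_eq_mul]
      linear_combination (-(η x - conjSchwartz η x) / 2) * Complex.I_mul_I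
    clear_value η₁ η₂
    rw [e₂]
    conv_rhs => rw [e₁]
    rw [map_sub, map_add, map_smul, map_sub, smul_eq_mul, map_mul,
      Complex.conj_eq_iff_im.mpr r₁, Complex.conj_eq_iff_im.mpr r₂, Complex.conj_I]
    ring
  have h2 : RepresentedBy (𝓕 u) fun ξ => starRingEnd ℂ (f (-ξ)) := fun η => by
    constructor
    · have h3 := (hf (𝓕⁻ (conjSchwartz (𝓕 η)))).1
      have h4 := (Complex.conjCLE.integrable_comp_iff.mpr h3).comp_neg
      refine h4.congr (Eventually.of_forall fun ξ => ?_)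
      have : 𝓕⁻ (conjSchwartz (𝓕 η)) (-ξ) = starRingEnd ℂ (η ξ) := by
        rw [fourierInv_conjSchwartz, neg_neg, fourierInv_fourier_eq]
      simp only [Complex.conjCLE_apply, map_mul, this]
      simp
    · rw [TemperedDistribution.fourier_apply, ← h1, hf.conj_apply_conjSchwartz,
        fourierInv_fourier_eq]
  exact h2.ae_eq hf

end Reflection

/-! ### Sobolev spaces on the side of the Fourier transform -/

section SobolevFourier

open Filter Topology

/-- The weight `(1 + ξ²)^(s/2)`. -/
def jap (s : ℝ) (ξ : ℝ) : ℝ := (1 + ‖ξ‖ ^ 2) ^ (s / 2)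

theorem jap_pos (s ξ : ℝ) : 0 < jap s ξ := by unfold jap; positivity

theorem jap_eq (s ξ : ℝ) : jap s ξ = (1 + ξ ^ 2) ^ (s / 2) := by
  rw [jap, Real.norm_eq_abs, sq_abs]

theorem jap_add (s t ξ : ℝ) : jap (s + t) ξ = jap s ξ * jap t ξ := by
  rw [jap, jap, jap, ← Real.rpow_add (by positivity), add_div]

theorem jap_zero (ξ : ℝ) : jap 0 ξ = 1 := by simp [jap]

theorem jap_neg_mul (s ξ : ℝ) : jap (-s) ξ * jap s ξ = 1 := by
  rw [← jap_add, neg_add_cancel, jap_zero]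

theorem jap_neg (s ξ : ℝ) : jap s (-ξ) = jap s ξ := by simp [jap]

theorem jap_mono {s t : ℝ} (h : s ≤ t) (ξ : ℝ) : jap s ξ ≤ jap t ξ :=
  Real.rpow_le_rpow_of_exponent_le (by nlinarith [norm_nonneg ξ]) (by linarith)

theorem jap_le_one {s : ℝ} (h : s ≤ 0) (ξ : ℝ) : jap s ξ ≤ 1 := by
  simpa [jap_zero] using jap_mono h ξ

theorem jap_two (ξ : ℝ) : jap 2 ξ = 1 + ξ ^ 2 := by simp [jap_eq]

theorem hasTemperateGrowth_jap (s : ℝ) : (fun ξ => (jap s ξ : ℂ)).HasTemperateGrowth := by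
  unfold jap
  fun_prop

theorem measurable_jap (s : ℝ) : Measurable (jap s) := by
  unfold jap
  fun_prop

theorem isBddSymbol_jap {s : ℝ} (hs : s ≤ 0) : IsBddSymbol fun ξ => (jap s ξ : ℂ) :=
  ⟨Complex.measurable_ofReal.comp (measurable_jap s), 1, fun ξ => by
    rw [Complex.norm_real, Real.norm_of_nonneg (jap_pos s ξ).le]
    exact jap_le_one hs ξ⟩

/-- The Fourier transform of an element of `H^s`, times the weight `(1 + ξ²)^(s/2)`. -/
def hat (s : ℝ) : Sobolev s →ₗᵢ[ℝ] Lp ℂ 2 (volume : Measure ℝ) where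
  toFun u := 𝓕 (Sobolev.bessel s u)
  map_add' u v := by rw [map_add, FourierTransform.fourier_add]
  map_smul' c u := by
    rw [map_smul, RingHom.id_apply]
    exact map_smul (Lp.fourierTransformₗᵢ ℝ ℂ) (c : ℂ) (Sobolev.bessel s u)
  norm_map' u := Lp.norm_fourier_eq _

theorem representedBy_hat {s : ℝ} (u : Sobolev s) :
    RepresentedBy (𝓕 u.toDist) (fun ξ => (jap (-s) ξ : ℂ) * hat s u ξ) := by
  have h1 : RepresentedBy (𝓕 (TemperedDistribution.besselPotential ℝ ℂ s u.toDist)) (hat s u) := by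
    rw [Sobolev.bessel_spec]
    exact representedBy_fourier _
  have h2 := h1.smulLeftCLM (hasTemperateGrowth_jap (-s))
  have h3 : u.toDist = TemperedDistribution.besselPotential ℝ ℂ (-s)
      (TemperedDistribution.besselPotential ℝ ℂ s u.toDist) := by simp
  rw [h3, TemperedDistribution.fourier_besselPotential_eq_smulLeftCLM_fourier_apply]
  exact h2

theorem conjRefl_hat {s : ℝ} (u : Sobolev s) : conjRefl (hat s u) = hat s u := by
  refine Lp.ext ?_
  filter_upwards [u.isReal.hermitian (representedBy_hat u), coeFn_conjRefl (hat s u)] with ξ h1 h2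
  rw [h2]
  rw [map_mul, Complex.conj_ofReal, jap_neg] at h1
  exact mul_left_cancel₀ (by exact_mod_cast (jap_pos (-s) ξ).ne') h1

theorem exists_hat_eq {s : ℝ} {W : Lp ℂ 2 (volume : Measure ℝ)} (hW : conjRefl W = W) :
    ∃ u : Sobolev s, hat s u = W := by
  set d : 𝓢'(ℝ, ℂ) := TemperedDistribution.besselPotential ℝ ℂ (-s)
    ((𝓕⁻ W : Lp ℂ 2 (volume : Measure ℝ)) : 𝓢'(ℝ, ℂ)) with hd
  have h0 : TemperedDistribution.besselPotential ℝ ℂ s d =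
      ((𝓕⁻ W : Lp ℂ 2 (volume : Measure ℝ)) : 𝓢'(ℝ, ℂ)) := by
    rw [hd]; simp
  have hrep : RepresentedBy (𝓕 d) (fun ξ => (jap (-s) ξ : ℂ) * W ξ) := by
    rw [hd, TemperedDistribution.fourier_besselPotential_eq_smulLeftCLM_fourier_apply]
    have := (representedBy_fourier (𝓕⁻ W)).smulLeftCLM (hasTemperateGrowth_jap (-s))
    rw [fourier_fourierInv_eq] at this
    exact this
  have hreal : IsRealDistribution d := by
    refine isRealDistribution_of_hermitian hrep ?_
    have h1 := coeFn_conjRefl W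
    rw [hW] at h1
    filter_upwards [h1] with ξ hξ
    rw [map_mul, Complex.conj_ofReal, jap_neg, ← hξ]
  let u : Sobolev s := ⟨d, hreal, _, h0⟩
  refine ⟨u, ?_⟩
  have h1 : Sobolev.bessel s u = 𝓕⁻ W := by
    apply Sobolev.lp_toDist_injective
    rw [← Sobolev.bessel_spec]
    exact h0
  show 𝓕 (Sobolev.bessel s u) = W
  rw [h1, fourier_fourierInv_eq]

theorem continuousOn_of_hat {s : ℝ} {u : ℝ → Sobolev s} {S : Set ℝ}
    (h : ContinuousOn (fun t => hat s (u t)) S) : ContinuousOn u S :=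
  (hat s).isometry.isUniformInducing.isInducing.continuousOn_iff.mpr h

theorem hasDerivWithinAt_of_hat {s : ℝ} {u : ℝ → Sobolev s} {u' : Sobolev s} {S : Set ℝ} {t : ℝ}
    (h : HasDerivWithinAt (fun t => hat s (u t)) (hat s u') S t) : HasDerivWithinAt u u' S t := by
  rw [hasDerivWithinAt_iff_isLittleO] at h ⊢
  refine (Asymptotics.isLittleO_norm_left.mp ?_)
  refine (Asymptotics.isLittleO_norm_left.mpr h).congr_left fun τ => ?_
  rw [← map_smul, ← map_sub, ← map_sub, (hat s).norm_map]

theorem toDist_eq_of_hat {s σ : ℝ} {u : Sobolev s} {v : Sobolev σ}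
    (h : ∀ᵐ ξ, hat σ v ξ = (jap (σ - s) ξ : ℂ) * hat s u ξ) : v.toDist = u.toDist := by
  have h1 : 𝓕 v.toDist = 𝓕 u.toDist := by
    refine (representedBy_hat v).eq (representedBy_hat u) (h.mono fun ξ hξ => ?_)
    simp only
    rw [hξ, ← mul_assoc, ← Complex.ofReal_mul, ← jap_add]
    congr 3
    ring
  have h2 := congrArg 𝓕⁻ h1
  rwa [fourierInv_fourier_eq, fourierInv_fourier_eq] at h2

theorem hat_eq_of_toDist {s σ : ℝ} {u : Sobolev s} {v : Sobolev σ} (h : v.toDist = u.toDist) :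
    ∀ᵐ ξ, hat σ v ξ = (jap (σ - s) ξ : ℂ) * hat s u ξ := by
  have h1 := representedBy_hat v
  rw [h] at h1
  filter_upwards [h1.ae_eq (representedBy_hat u)] with ξ hξ
  have h2 : (jap σ ξ : ℂ) * ((jap (-σ) ξ : ℂ) * hat σ v ξ) = hat σ v ξ := by
    rw [← mul_assoc, ← Complex.ofReal_mul, mul_comm (jap σ ξ), jap_neg_mul]; simp
  rw [← h2, hξ, ← mul_assoc, ← Complex.ofReal_mul, ← jap_add, ← sub_eq_add_neg]

/-- An element of `H^s`, `s ≥ 0`, is the inverse Fourier transform of an `L²` function. -/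
theorem representedBy_fourierInv {s : ℝ} (hs : 0 ≤ s) (u : Sobolev s) :
    RepresentedBy u.toDist (𝓕⁻ (mulOp (fun ξ => (jap (-s) ξ : ℂ)) (hat s u)) :
      Lp ℂ 2 (volume : Measure ℝ)) := by
  set P := mulOp (fun ξ => (jap (-s) ξ : ℂ)) (hat s u) with hP
  have h1 : 𝓕 u.toDist = (P : 𝓢'(ℝ, ℂ)) :=
    (representedBy_hat u).eq (representedBy_toTemperedDistribution P)
      (coeFn_mulOp (isBddSymbol_jap (by linarith)) _).symm
  have h2 : u.toDist = ((𝓕⁻ P : Lp ℂ 2 (volume : Measure ℝ)) : 𝓢'(ℝ, ℂ)) := by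
    rw [← Lp.fourierInv_toTemperedDistribution_eq, ← h1, fourierInv_fourier_eq]
  rw [h2]
  exact representedBy_toTemperedDistribution _

/-- The inverse Fourier transforms on `L²` and on `L¹` agree. -/
theorem coeFn_fourierInv {P : Lp ℂ 2 (volume : Measure ℝ)} (hP : Integrable P) :
    (𝓕⁻ P : Lp ℂ 2 (volume : Measure ℝ)) =ᵐ[volume] 𝓕⁻ (P : ℝ → ℂ) := by
  have h1 : RepresentedBy ((𝓕⁻ P : Lp ℂ 2 (volume : Measure ℝ)) : 𝓢'(ℝ, ℂ))
      (𝓕⁻ (P : ℝ → ℂ)) := fun η => by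
    constructor
    · have hb : ∀ x, ‖𝓕⁻ (P : ℝ → ℂ) x‖ ≤ ∫ ξ, ‖P ξ‖ := fun x => by
        rw [Real.fourierInv_eq']
        refine (norm_integral_le_integral_norm _).trans (le_of_eq ?_)
        congr 1
        funext ξ
        rw [norm_smul, Complex.norm_exp_ofReal_mul_I, one_mul]
      have hc : Continuous (𝓕⁻ (P : ℝ → ℂ)) := by
        have := VectorFourier.fourierIntegral_continuous Real.continuous_fourierChar
          (μ := (volume : Measure ℝ)) (L := -(innerₗ ℝ)) (by fun_prop) hP
        exact this
      exact η.integrable.mul_bdd (c := ∫ ξ, ‖P ξ‖) hc.aestronglyMeasurable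
        (Eventually.of_forall hb)
    · rw [← Lp.fourierInv_toTemperedDistribution_eq, TemperedDistribution.fourierInv_apply,
        Lp.toTemperedDistribution_apply]
      have := VectorFourier.integral_fourierIntegral_smul_eq_flip (μ := (volume : Measure ℝ))
        (ν := (volume : Measure ℝ)) (L := -(innerₗ ℝ)) Real.continuous_fourierChar
        (by fun_prop) η.integrable hP
      have hflip : (-(innerₗ ℝ) : ℝ →ₗ[ℝ] ℝ →ₗ[ℝ] ℝ).flip = -(innerₗ ℝ) := by
        ext; simp
      rw [hflip] at this
      simp only [SchwartzMap.fourierInv_coe]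
      exact this
  exact (representedBy_toTemperedDistribution _).ae_eq h1

theorem integrable_jap {s : ℝ} (hs : s < -1) : Integrable (jap s) := by
  have := integrable_rpow_neg_one_add_norm_sq (E := ℝ) (μ := volume) (r := -s)
    (by simp; linarith)
  rw [funext (jap_eq s)]
  simpa using this

/-- The Sobolev embedding `H^s ⊆ L^∞` for `s > 1/2`. -/
theorem exists_sobolev_bound {s : ℝ} (hs : 1 / 2 < s) : ∃ C : ℝ, 0 ≤ C ∧
    ∀ W : Lp ℂ 2 (volume : Measure ℝ), ∀ᵐ x : ℝ,
      ‖(𝓕⁻ (mulOp (fun ξ => (jap (-s) ξ : ℂ)) W) : Lp ℂ 2 (volume : Measure ℝ)) x‖ ≤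
        C * ‖W‖ := by
  have hj : MemLp (fun ξ => (jap (-s) ξ : ℂ)) 2 := by
    refine (memLp_two_iff_integrable_sq_norm
      (Complex.measurable_ofReal.comp (measurable_jap _)).aestronglyMeasurable).mpr ?_
    refine (integrable_jap (s := -s + -s) (by linarith)).congr (Eventually.of_forall fun ξ => ?_)
    simp only [jap_add, Function.comp_apply]
    rw [Complex.norm_real, Real.norm_of_nonneg (jap_pos _ _).le, sq]
  refine ⟨‖hj.toLp _‖, norm_nonneg _, fun W => ?_⟩
  set P := mulOp (fun ξ => (jap (-s) ξ : ℂ)) W with hPdef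
  have hPe := coeFn_mulOp (isBddSymbol_jap (s := -s) (by linarith)) W
  have hP : Integrable P := (hj.integrable_mul (Lp.memLp W)).congr hPe.symm
  have hle : ∫ ξ, ‖P ξ‖ ≤ ‖hj.toLp _‖ * ‖W‖ := by
    have e : ∫ ξ, ‖P ξ‖ = ∫ ξ, jap (-s) ξ * ‖W ξ‖ := by
      refine integral_congr_ae ?_
      filter_upwards [hPe] with ξ hξ
      rw [hξ, norm_mul, Complex.norm_real, Real.norm_of_nonneg (jap_pos _ _).le]
    have hW : MemLp (fun ξ => ((‖W ξ‖ : ℝ) : ℂ)) 2 := (Lp.memLp W).norm.ofReal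
    have h1 : ‖inner ℂ (hj.toLp _) (hW.toLp _)‖ = ∫ ξ, jap (-s) ξ * ‖W ξ‖ := by
      rw [L2.inner_def]
      have : ∫ ξ, inner ℂ (hj.toLp _ ξ) (hW.toLp _ ξ) =
          ∫ ξ, ((jap (-s) ξ * ‖W ξ‖ : ℝ) : ℂ) := by
        refine integral_congr_ae ?_
        filter_upwards [hj.coeFn_toLp, hW.coeFn_toLp] with ξ h1 h2
        rw [h1, h2]
        simp [mul_comm]
      rw [this, integral_complex_ofReal, Complex.norm_real, Real.norm_of_nonneg]
      exact integral_nonneg fun ξ => mul_nonneg (jap_pos _ _).le (norm_nonneg _)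
    have h2 : ‖hW.toLp _‖ = ‖W‖ := by
      rw [Lp.norm_toLp, Lp.norm_def]
      congr 1
      refine eLpNorm_congr_norm_ae (Eventually.of_forall fun ξ => by simp)
    rw [e, ← h1, ← h2]
    exact norm_inner_le_norm _ _
  filter_upwards [coeFn_fourierInv hP] with x hx
  rw [hx, Real.fourierInv_eq']
  refine (norm_integral_le_integral_norm _).trans (le_trans (le_of_eq ?_) hle)
  congr 1
  funext ξ
  rw [norm_smul, Complex.norm_exp_ofReal_mul_I, one_mul]

end SobolevFourier

/-! ### Globally Lipschitz nonlinearities with a nonnegative primitive -/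

section Truncation

open Filter Topology

/-- A nonnegative primitive stays nonnegative when it is continued by a suitable parabola. -/
theorem exists_parabola_nonneg {g : ℝ → ℝ} (hg : Continuous g)
    (hG : ∀ v : ℝ, 0 ≤ ∫ p in (0 : ℝ)..v, g p) (m : ℝ) :
    ∃ κ : ℝ, 0 ≤ κ ∧ ∀ κ' ≥ κ, ∀ h : ℝ,
      0 ≤ (∫ p in (0 : ℝ)..m, g p) + g m * h + κ' * h ^ 2 / 2 := by
  have hd : HasDerivAt (fun v => ∫ p in (0 : ℝ)..v, g p) (g m) m :=
    intervalIntegral.integral_hasDerivAt_right (hg.intervalIntegrable _ _)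
      (hg.stronglyMeasurableAtFilter _ _) hg.continuousAt
  -- At a zero of the primitive, which is a minimum, `g` vanishes as well; elsewhere the parabola
  -- has a nonpositive discriminant once `κ` is large.
  rcases (hG m).eq_or_lt with h0 | h0
  · have hmin : IsLocalMin (fun v => ∫ p in (0 : ℝ)..v, g p) m :=
      Eventually.of_forall fun v => by simpa [← h0] using hG v
    have hz : g m = 0 := hmin.hasDerivAt_eq_zero hd
    refine ⟨0, le_rfl, fun κ' hκ h => ?_⟩
    rw [← h0, hz]
    have h1 : 0 ≤ κ' := hκ
    have h2 : 0 ≤ κ' * h ^ 2 / 2 := by positivity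
    linarith
  · set A := ∫ p in (0 : ℝ)..m, g p with hA
    refine ⟨g m ^ 2 / (2 * A), by positivity, fun κ' hκ h => ?_⟩
    have h1 : A + g m * h + (g m ^ 2 / (2 * A)) * h ^ 2 / 2 = (A + g m * h / 2) ^ 2 / A := by
      field_simp
      ring
    have h2 : 0 ≤ (A + g m * h / 2) ^ 2 / A := by positivity
    nlinarith [sq_nonneg h, mul_le_mul_of_nonneg_right hκ (sq_nonneg h)]

/-- A `C¹` function with a nonnegative primitive agrees on `[-M, M]` with a globally Lipschitz
function with a nonnegative primitive. -/
theorem exists_lipschitz_truncation {g : ℝ → ℝ} (hg : ContDiff ℝ 1 g)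
    (hG : ∀ v : ℝ, 0 ≤ ∫ p in (0 : ℝ)..v, g p) {M : ℝ} (hM : 0 ≤ M) :
    ∃ (γ : ℝ → ℝ) (L : NNReal), LipschitzWith L γ ∧ (∀ v ∈ Icc (-M) M, γ v = g v) ∧
      ∀ v : ℝ, 0 ≤ ∫ p in (0 : ℝ)..v, γ p := by
  obtain ⟨κ₁, hκ₁, h₁⟩ := exists_parabola_nonneg hg.continuous hG M
  obtain ⟨κ₂, hκ₂, h₂⟩ := exists_parabola_nonneg hg.continuous hG (-M)
  have hMM : -M ≤ M := by linarith
  set κ := κ₁ + κ₂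
  have hc : LipschitzWith 1 fun v : ℝ => max (-M) (min M v) :=
    (LipschitzWith.id.const_min M).const_max (-M)
  have hmem : ∀ v : ℝ, max (-M) (min M v) ∈ Icc (-M) M := fun v =>
    ⟨le_max_left _ _, max_le hMM (min_le_left _ _)⟩
  have hceq : ∀ v ∈ Icc (-M) M, max (-M) (min M v) = v := fun v hv => by
    rw [min_eq_right hv.2, max_eq_right hv.1]
  obtain ⟨K, hK⟩ : ∃ K : NNReal, LipschitzOnWith K g (Icc (-M) M) :=
    hg.contDiffOn.exists_lipschitzOnWith one_ne_zero (convex_Icc _ _) isCompact_Icc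
  -- Outside `[-M, M]` the function is continued linearly, with a slope `κ` that is steep enough to
  -- keep the primitive nonnegative.
  let γ : ℝ → ℝ := fun v => g (max (-M) (min M v)) + κ * (v - max (-M) (min M v))
  have hγeq : ∀ v ∈ Icc (-M) M, γ v = g v := fun v hv => by
    simp only [γ, hceq v hv, sub_self, mul_zero, add_zero]
  obtain ⟨L, hL⟩ : ∃ L : NNReal, LipschitzWith L γ := by
    have e1 : LipschitzWith (K * 1) fun v => g (max (-M) (min M v)) := by
      rw [← lipschitzOnWith_univ] at hc ⊢
      exact hK.comp hc fun v _ => hmem v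
    have e2 : LipschitzWith (‖κ‖₊ * (1 + 1)) fun v : ℝ => κ * (v - max (-M) (min M v)) :=
      (lipschitzWith_smul κ).comp (LipschitzWith.id.sub hc)
    exact ⟨_, e1.add e2⟩
  have hint : ∀ a b : ℝ, IntervalIntegrable γ volume a b := fun a b =>
    hL.continuous.intervalIntegrable a b
  have hin : ∀ v ∈ Icc (-M) M, ∫ p in (0 : ℝ)..v, γ p = ∫ p in (0 : ℝ)..v, g p := fun v hv => by
    refine intervalIntegral.integral_congr fun p hp => hγeq p ?_
    exact uIcc_subset_Icc ⟨by linarith, hM⟩ hv hp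
  refine ⟨γ, L, hL, hγeq, fun v => ?_⟩
  have hpar : ∀ m h : ℝ, ∫ p in m..(m + h), (g m + κ * (p - m)) = g m * h + κ * h ^ 2 / 2 := by
    intro m h
    rw [intervalIntegral.integral_comp_sub_right (fun p => g m + κ * p) m]
    rw [intervalIntegral.integral_add (Continuous.intervalIntegrable (by fun_prop) _ _)
      (Continuous.intervalIntegrable (by fun_prop) _ _), intervalIntegral.integral_const_mul]
    simp
    ring
  rcases le_total v M with hvM | hvM
  · rcases le_total (-M) v with hvm | hvm
    · rw [hin v ⟨hvm, hvM⟩]; exact hG v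
    · have e : ∫ p in (-M)..v, γ p = ∫ p in (-M)..(-M + (v - -M)), (g (-M) + κ * (p - -M)) := by
        rw [add_sub_cancel]
        refine intervalIntegral.integral_congr fun p hp => ?_
        rw [uIcc_of_ge hvm] at hp
        simp only [γ, min_eq_right (hp.2.trans hMM), max_eq_left hp.2]
      rw [← intervalIntegral.integral_add_adjacent_intervals (hint 0 (-M)) (hint (-M) v), e, hpar,
        hin (-M) ⟨le_rfl, hMM⟩, ← add_assoc]
      exact h₂ _ (by simp [κ, hκ₁]) _
  · have e : ∫ p in M..v, γ p = ∫ p in M..(M + (v - M)), (g M + κ * (p - M)) := by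
      rw [add_sub_cancel]
      refine intervalIntegral.integral_congr fun p hp => ?_
      rw [uIcc_of_le hvM] at hp
      simp only [γ, min_eq_left hp.1, max_eq_right hMM]
    rw [← intervalIntegral.integral_add_adjacent_intervals (hint 0 M) (hint M v), e, hpar,
      hin M ⟨hMM, le_rfl⟩, ← add_assoc]
    exact h₁ _ (by simp [κ, hκ₂]) _

variable {γ : ℝ → ℝ} {L : NNReal}

theorem abs_primitive_sub_le (hγ : LipschitzWith L γ) (v h : ℝ) :
    |(∫ p in (0 : ℝ)..(v + h), γ p) - (∫ p in (0 : ℝ)..v, γ p) - γ v * h| ≤ L * h ^ 2 := by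
  have hint : ∀ a b : ℝ, IntervalIntegrable γ volume a b := fun a b =>
    hγ.continuous.intervalIntegrable a b
  have e : (∫ p in (0 : ℝ)..(v + h), γ p) - (∫ p in (0 : ℝ)..v, γ p) - γ v * h =
      ∫ p in v..(v + h), (γ p - γ v) := by
    rw [intervalIntegral.integral_sub (hint _ _) (by simp),
      intervalIntegral.integral_interval_sub_left (hint _ _) (hint _ _)]
    simp [mul_comm]
  rw [e, ← Real.norm_eq_abs]
  have := intervalIntegral.norm_integral_le_of_norm_le_const (a := v) (b := v + h)
    (f := fun p => γ p - γ v) (C := L * |h|) fun p hp => by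
      have h1 := hγ.dist_le_mul p v
      rw [Real.dist_eq, Real.dist_eq] at h1
      refine h1.trans (mul_le_mul_of_nonneg_left ?_ L.2)
      rcases le_total 0 h with h0 | h0
      · rw [uIoc_of_le (by linarith)] at hp
        rw [abs_of_nonneg (by linarith [hp.1]), abs_of_nonneg h0]; linarith [hp.2]
      · rw [uIoc_of_ge (by linarith)] at hp
        rw [abs_of_nonpos (by linarith [hp.2]), abs_of_nonpos h0]; linarith [hp.1]
  refine this.trans (le_of_eq ?_)
  rw [add_sub_cancel_left, mul_assoc, ← sq, sq_abs]

theorem abs_primitive_le (hγ : LipschitzWith L γ) (h0 : γ 0 = 0) (v : ℝ) :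
    |∫ p in (0 : ℝ)..v, γ p| ≤ L * v ^ 2 := by
  simpa [h0] using abs_primitive_sub_le hγ 0 v

theorem lipschitzWith_ofReal_re (hγ : LipschitzWith L γ) :
    LipschitzWith L fun z : ℂ => (γ z.re : ℂ) := by
  refine LipschitzWith.of_dist_le_mul fun z w => ?_
  rw [dist_eq_norm, ← Complex.ofReal_sub, Complex.norm_real]
  refine (hγ.dist_le_mul z.re w.re).trans (mul_le_mul_of_nonneg_left ?_ L.2)
  rw [dist_eq_norm, dist_eq_norm, ← Complex.sub_re]
  exact Complex.abs_re_le_norm _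

/-- The superposition operator `Z ↦ 𝓕 (γ (Re 𝓕⁻¹ Z))`. -/
def nonlin (hγ : LipschitzWith L γ) (h0 : γ 0 = 0) (Z : Lp ℂ 2 (volume : Measure ℝ)) :
    Lp ℂ 2 (volume : Measure ℝ) :=
  𝓕 ((lipschitzWith_ofReal_re hγ).compLp (by simp [h0]) (𝓕⁻ Z))

/-- The potential `∫ G (Re 𝓕⁻¹ Z)`, where `G` is the primitive of `γ`. -/
def potential (γ : ℝ → ℝ) (Z : Lp ℂ 2 (volume : Measure ℝ)) : ℝ :=
  ∫ x, ∫ p in (0 : ℝ)..((𝓕⁻ Z : Lp ℂ 2 (volume : Measure ℝ)) x).re, γ p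

theorem coeFn_fourierInv_nonlin (hγ : LipschitzWith L γ) (h0 : γ 0 = 0)
    (Z : Lp ℂ 2 (volume : Measure ℝ)) :
    (𝓕⁻ (nonlin hγ h0 Z) : Lp ℂ 2 (volume : Measure ℝ)) =ᵐ[volume]
      fun x => (γ ((𝓕⁻ Z : Lp ℂ 2 (volume : Measure ℝ)) x).re : ℂ) := by
  rw [nonlin, fourierInv_fourier_eq]
  exact (lipschitzWith_ofReal_re hγ).coeFn_compLp _ _

theorem conjRefl_nonlin (hγ : LipschitzWith L γ) (h0 : γ 0 = 0)
    (Z : Lp ℂ 2 (volume : Measure ℝ)) : conjRefl (nonlin hγ h0 Z) = nonlin hγ h0 Z := by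
  have h1 : (𝓕⁻ (conjRefl (nonlin hγ h0 Z)) : Lp ℂ 2 (volume : Measure ℝ)) =
      𝓕⁻ (nonlin hγ h0 Z) := by
    refine Lp.ext ?_
    filter_upwards [coeFn_fourierInv_conjRefl (nonlin hγ h0 Z), coeFn_fourierInv_nonlin hγ h0 Z]
      with x h1 h2
    rw [h1, h2, Complex.conj_ofReal]
  have h2 := congrArg 𝓕 h1
  rwa [fourier_fourierInv_eq, fourier_fourierInv_eq] at h2

theorem nonlin_congr {γ₁ γ₂ : ℝ → ℝ} {L₁ L₂ : NNReal} (h₁ : LipschitzWith L₁ γ₁)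
    (h₂ : LipschitzWith L₂ γ₂) (h01 : γ₁ 0 = 0) (h02 : γ₂ 0 = 0)
    {Z₁ Z₂ : Lp ℂ 2 (volume : Measure ℝ)}
    (h : ∀ᵐ x, γ₁ ((𝓕⁻ Z₁ : Lp ℂ 2 (volume : Measure ℝ)) x).re =
      γ₂ ((𝓕⁻ Z₂ : Lp ℂ 2 (volume : Measure ℝ)) x).re) :
    nonlin h₁ h01 Z₁ = nonlin h₂ h02 Z₂ := by
  have h1 : (𝓕⁻ (nonlin h₁ h01 Z₁) : Lp ℂ 2 (volume : Measure ℝ)) =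
      𝓕⁻ (nonlin h₂ h02 Z₂) := by
    refine Lp.ext ?_
    filter_upwards [coeFn_fourierInv_nonlin h₁ h01 Z₁, coeFn_fourierInv_nonlin h₂ h02 Z₂, h]
      with x e1 e2 e3
    rw [e1, e2, e3]
  have h2 := congrArg 𝓕 h1
  rwa [fourier_fourierInv_eq, fourier_fourierInv_eq] at h2

theorem lipschitzWith_nonlin (hγ : LipschitzWith L γ) (h0 : γ 0 = 0) :
    LipschitzWith L (nonlin hγ h0) :=
  LipschitzWith.of_dist_le_mul fun Z W => by
    have h1 := (Lp.fourierTransformₗᵢ ℝ ℂ).dist_map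
      ((lipschitzWith_ofReal_re hγ).compLp (by simp [h0]) (𝓕⁻ Z))
      ((lipschitzWith_ofReal_re hγ).compLp (by simp [h0]) (𝓕⁻ W))
    refine h1.le.trans (((lipschitzWith_ofReal_re hγ).lipschitzWith_compLp
      (by simp [h0])).dist_le_mul _ _ |>.trans (le_of_eq ?_))
    exact congrArg _ ((Lp.fourierTransformₗᵢ ℝ ℂ).symm.dist_map Z W)

/-- The superposition operator is the gradient of the potential: under the isometry `𝓕⁻¹` this is
the Taylor expansion of the primitive of `γ`, integrated in `x`. -/
theorem hasPotential_nonlin (hγ : LipschitzWith L γ) (h0 : γ 0 = 0)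
    (hG : ∀ v : ℝ, 0 ≤ ∫ p in (0 : ℝ)..v, γ p) :
    HasPotential (nonlin hγ h0) (potential γ) L where
  lipschitz := lipschitzWith_nonlin hγ h0
  map_zero := by
    have h1 : (𝓕⁻ (0 : Lp ℂ 2 (volume : Measure ℝ)) : Lp ℂ 2 (volume : Measure ℝ)) = 0 :=
      map_zero (Lp.fourierTransformₗᵢ ℝ ℂ).symm
    rw [nonlin, h1, LipschitzWith.compLp_zero]
    exact map_zero (Lp.fourierTransformₗᵢ ℝ ℂ)
  nonneg Z := integral_nonneg fun x => hG _
  expand Z h := by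
    set f : Lp ℂ 2 (volume : Measure ℝ) := 𝓕⁻ Z with hf
    set e : Lp ℂ 2 (volume : Measure ℝ) := 𝓕⁻ h with he
    have hGc : Continuous fun v : ℝ => ∫ p in (0 : ℝ)..v, γ p :=
      intervalIntegral.continuous_primitive (fun a b => hγ.continuous.intervalIntegrable a b) 0
    have hsq : ∀ w : Lp ℂ 2 (volume : Measure ℝ), Integrable fun x => ‖w x‖ ^ 2 := fun w =>
      (memLp_two_iff_integrable_sq_norm (Lp.aestronglyMeasurable w)).mp (Lp.memLp w)
    have hint : ∀ w : Lp ℂ 2 (volume : Measure ℝ),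
        Integrable fun x => ∫ p in (0 : ℝ)..(w x).re, γ p := fun w => by
      refine ((hsq w).const_mul (L : ℝ)).mono' ?_ (Eventually.of_forall fun x => ?_)
      · exact hGc.comp_aestronglyMeasurable
          (Complex.continuous_re.comp_aestronglyMeasurable (Lp.aestronglyMeasurable w))
      · refine (abs_primitive_le hγ h0 _).trans (mul_le_mul_of_nonneg_left ?_ L.2)
        rw [← sq_abs]
        gcongr
        exact Complex.abs_re_le_norm _
    have hin : inner ℂ (nonlin hγ h0 Z) h =
        ∫ x, inner ℂ ((γ (f x).re : ℂ)) (e x) := by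
      have h1 : inner ℂ (nonlin hγ h0 Z) h = inner ℂ (𝓕⁻ (nonlin hγ h0 Z)) e :=
        ((Lp.fourierTransformₗᵢ ℝ ℂ).symm.inner_map_map _ _).symm
      rw [h1, L2.inner_def]
      refine integral_congr_ae ?_
      filter_upwards [coeFn_fourierInv_nonlin hγ h0 Z] with x hx
      rw [hx]
    have hii : Integrable fun x => inner ℂ ((γ (f x).re : ℂ)) (e x) := by
      refine (L2.integrable_inner (𝕜 := ℂ) (𝓕⁻ (nonlin hγ h0 Z)) e).congr ?_
      filter_upwards [coeFn_fourierInv_nonlin hγ h0 Z] with x hx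
      rw [hx]
    have hre : (inner ℂ (nonlin hγ h0 Z) h).re = ∫ x, γ (f x).re * (e x).re := by
      rw [hin]
      refine (integral_re hii).symm.trans ?_
      congr 1
      funext x
      simp [mul_comm]
    have hre_int : Integrable fun x => γ (f x).re * (e x).re := by
      refine hii.re.congr (Eventually.of_forall fun x => ?_)
      simp [mul_comm]
    have hadd : potential γ (Z + h) = ∫ x, ∫ p in (0 : ℝ)..((f x).re + (e x).re), γ p := by
      refine integral_congr_ae ?_
      have h1 : (𝓕⁻ (Z + h) : Lp ℂ 2 (volume : Measure ℝ)) = f + e :=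
        map_add (Lp.fourierTransformₗᵢ ℝ ℂ).symm _ _
      rw [h1]
      filter_upwards [Lp.coeFn_add f e] with x hx
      rw [hx, Pi.add_apply, Complex.add_re]
    have hint' : Integrable fun x => ∫ p in (0 : ℝ)..((f x).re + (e x).re), γ p := by
      refine (hint (f + e)).congr ?_
      filter_upwards [Lp.coeFn_add f e] with x hx
      rw [hx, Pi.add_apply, Complex.add_re]
    have hpot : potential γ Z = ∫ x, ∫ p in (0 : ℝ)..(f x).re, γ p := rfl
    have hsub : Integrable fun x => (∫ p in (0 : ℝ)..((f x).re + (e x).re), γ p) -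
      ∫ p in (0 : ℝ)..(f x).re, γ p := hint'.sub (hint f)
    rw [hadd, hpot, hre, ← integral_sub hint' (hint f), ← integral_sub hsub hre_int]
    have hn : ‖h‖ ^ 2 = ∫ x, ‖e x‖ ^ 2 := by
      rw [show ‖h‖ = ‖e‖ from ((Lp.fourierTransformₗᵢ ℝ ℂ).symm.norm_map h).symm, ← @inner_self_eq_norm_sq ℂ, L2.inner_def,
        ← integral_re (L2.integrable_inner e e)]
      congr 1
      funext x
      exact inner_self_eq_norm_sq (𝕜 := ℂ) _
    rw [hn, ← integral_const_mul, ← Real.norm_eq_abs]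
    refine norm_integral_le_of_norm_le ((hsq e).const_mul _) (Eventually.of_forall fun x => ?_)
    refine (abs_primitive_sub_le hγ _ _).trans (mul_le_mul_of_nonneg_left ?_ L.2)
    rw [← sq_abs]
    gcongr
    exact Complex.abs_re_le_norm _

end Truncation

/-! ### The symbols of the equation -/

section Symbols

open Filter Topology

/-- `f` is a symbol of order `t`: it is `O((1 + ξ²)^(t/2))`. -/
def IsOrder (t : ℝ) (f : ℝ → ℝ) : Prop := Measurable f ∧ ∃ C, ∀ ξ, |f ξ| ≤ C * jap t ξ

theorem IsOrder.exists_pos {t : ℝ} {f : ℝ → ℝ} (hf : IsOrder t f) :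
    ∃ C > 0, ∀ ξ, |f ξ| ≤ C * jap t ξ := by
  obtain ⟨C, hC⟩ := hf.2
  refine ⟨|C| + 1, by positivity, fun ξ => (hC ξ).trans ?_⟩
  exact mul_le_mul_of_nonneg_right ((le_abs_self C).trans (by linarith)) (jap_pos t ξ).le

theorem isOrder_jap (t : ℝ) : IsOrder t (jap t) :=
  ⟨measurable_jap t, 1, fun ξ => by rw [abs_of_pos (jap_pos t ξ), one_mul]⟩

theorem IsOrder.mul {t u : ℝ} {f g : ℝ → ℝ} (hf : IsOrder t f) (hg : IsOrder u g) :
    IsOrder (t + u) (fun ξ => f ξ * g ξ) := by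
  obtain ⟨C, hC0, hC⟩ := hf.exists_pos
  obtain ⟨D, hD0, hD⟩ := hg.exists_pos
  refine ⟨hf.1.mul hg.1, C * D, fun ξ => ?_⟩
  rw [abs_mul, jap_add, mul_mul_mul_comm]
  exact mul_le_mul (hC ξ) (hD ξ) (abs_nonneg _) (mul_pos hC0 (jap_pos t ξ)).le

theorem IsOrder.mono {t u : ℝ} {f : ℝ → ℝ} (hf : IsOrder t f) (h : t ≤ u) : IsOrder u f := by
  obtain ⟨C, hC0, hC⟩ := hf.exists_pos
  exact ⟨hf.1, C, fun ξ => (hC ξ).trans (mul_le_mul_of_nonneg_left (jap_mono h ξ) hC0.le)⟩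

theorem IsOrder.exists_abs_le {t : ℝ} {f : ℝ → ℝ} (hf : IsOrder t f) (ht : t ≤ 0) :
    ∃ C > 0, ∀ ξ, |f ξ| ≤ C := by
  obtain ⟨C, hC0, hC⟩ := hf.exists_pos
  exact ⟨C, hC0, fun ξ => (hC ξ).trans (mul_le_of_le_one_right hC0.le (jap_le_one ht ξ))⟩

theorem IsOrder.isBddSymbol {t : ℝ} {f : ℝ → ℝ} (hf : IsOrder t f) (ht : t ≤ 0) :
    IsBddSymbol fun ξ => (f ξ : ℂ) := by
  obtain ⟨C, hC0, hC⟩ := hf.exists_abs_le ht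
  exact ⟨Complex.measurable_ofReal.comp hf.1, C, fun ξ => by
    rw [Complex.norm_real]; exact hC ξ⟩

theorem IsOrder.indicator {t : ℝ} {f : ℝ → ℝ} (hf : IsOrder t f) {A : Set ℝ}
    (hA : MeasurableSet A) {R : ℝ} (hR : ∀ ξ ∈ A, |ξ| ≤ R) :
    IsBddSymbol fun ξ => ((A.indicator f ξ : ℝ) : ℂ) := by
  obtain ⟨C, hC0, hC⟩ := (hf.mono (le_max_left t 0)).exists_pos
  refine isBddSymbol_indicator_ofReal hf.1 hA (R := C * jap (max t 0) R) fun ξ hξ =>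
    (hC ξ).trans (mul_le_mul_of_nonneg_left ?_ hC0.le)
  rw [jap_eq, jap_eq]
  refine Real.rpow_le_rpow (by positivity) ?_ (by positivity)
  have := sq_le_sq' (by linarith [abs_nonneg ξ, hR ξ hξ, neg_abs_le ξ]) (hR ξ hξ)
  rw [sq_abs] at this
  linarith

theorem exists_jap_dilation_le (t : ℝ) :
    ∃ C > 0, ∀ ξ, jap t (2 * Real.pi * ξ) ≤ C * jap t ξ := by
  have hpi := Real.two_le_pi
  have h1 : ∀ ξ : ℝ, 1 + ξ ^ 2 ≤ 1 + (2 * Real.pi * ξ) ^ 2 := fun ξ => by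
    have : 1 ≤ (2 * Real.pi) ^ 2 := by nlinarith
    nlinarith [mul_le_mul_of_nonneg_right this (sq_nonneg ξ)]
  rcases le_total 0 t with ht | ht
  · refine ⟨(1 + (2 * Real.pi) ^ 2) ^ (t / 2), by positivity, fun ξ => ?_⟩
    rw [jap_eq, jap_eq, ← Real.mul_rpow (by positivity) (by positivity)]
    refine Real.rpow_le_rpow (by positivity) ?_ (by positivity)
    nlinarith [sq_nonneg ξ, sq_nonneg (2 * Real.pi)]
  · refine ⟨1, one_pos, fun ξ => ?_⟩
    rw [jap_eq, jap_eq, one_mul]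
    exact Real.rpow_le_rpow_of_nonpos (by positivity) (h1 ξ) (by linarith)

theorem IsOrder.dilation {t : ℝ} {f : ℝ → ℝ} (hf : IsOrder t f) :
    IsOrder t (fun ξ => f (2 * Real.pi * ξ)) := by
  obtain ⟨C, hC0, hC⟩ := hf.exists_pos
  obtain ⟨D, hD0, hD⟩ := exists_jap_dilation_le t
  refine ⟨hf.1.comp (measurable_const_mul _), C * D, fun ξ => (hC _).trans ?_⟩
  rw [mul_assoc C]
  exact mul_le_mul_of_nonneg_left (hD ξ) hC0.le

theorem sqrt_jap (t ξ : ℝ) : √(jap t ξ) = jap (t / 2) ξ := by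
  rw [jap, jap, Real.sqrt_eq_rpow, ← Real.rpow_mul (by positivity)]
  congr 1
  ring

theorem abs_le_jap_one (ξ : ℝ) : |ξ| ≤ jap 1 ξ := by
  rw [show (1 : ℝ) = 2 / 2 by norm_num, ← sqrt_jap, jap_two]
  exact Real.abs_le_sqrt (by linarith)

/-- The hypotheses on the symbols `l`, `b` of the operators `L`, `B`. -/
structure IsSymbolPair (ρ r : ℝ) (l b : ℝ → ℝ) : Prop where
  hρ : 0 ≤ ρ
  hr : 0 ≤ r
  hrρ : 1 ≤ r + ρ / 2
  hs : 1 / 2 < r / 2 + ρ / 2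
  hl_meas : Measurable l
  hb_meas : Measurable b
  hl_even : ∀ ξ, l (-ξ) = l ξ
  hb_even : ∀ ξ, b (-ξ) = b ξ
  hl : ∃ c₁ > (0 : ℝ), ∃ c₂ > (0 : ℝ), ∀ ξ : ℝ,
    c₁ ^ 2 * (1 + ξ ^ 2) ^ (ρ / 2) ≤ l ξ ∧ l ξ ≤ c₂ ^ 2 * (1 + ξ ^ 2) ^ (ρ / 2)
  hb : ∃ c₃ > (0 : ℝ), ∀ ξ : ℝ, 0 < b ξ ∧ b ξ ≤ c₃ ^ 2 * (1 + ξ ^ 2) ^ (-r / 2)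

/-- The dispersion relation `|ξ| l(ξ)^(1/2)`, at the angular frequency `2πξ`. -/
def freq (l : ℝ → ℝ) (ξ : ℝ) : ℝ := |2 * Real.pi * ξ| * √(l (2 * Real.pi * ξ))

/-- The symbol `(b / l)^(1/2)`, at the angular frequency `2πξ`. -/
def amp (l b : ℝ → ℝ) (ξ : ℝ) : ℝ := √(b (2 * Real.pi * ξ) / l (2 * Real.pi * ξ))

/-- The symbol `|ξ| b l^(-1/2)` in front of the nonlinearity, at the angular frequency `2πξ`. -/
def coupling (l b : ℝ → ℝ) (ξ : ℝ) : ℝ := freq l ξ * amp l b ξ ^ 2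

variable {ρ r : ℝ} {l b : ℝ → ℝ}

theorem IsSymbolPair.l_pos (h : IsSymbolPair ρ r l b) (ξ : ℝ) : 0 < l ξ := by
  obtain ⟨c₁, h1, c₂, h2, hc⟩ := h.hl
  exact lt_of_lt_of_le (by positivity) (hc ξ).1

theorem IsSymbolPair.b_pos (h : IsSymbolPair ρ r l b) (ξ : ℝ) : 0 < b ξ := by
  obtain ⟨c₃, h3, hc⟩ := h.hb
  exact (hc ξ).1

theorem IsSymbolPair.isOrder_sqrt_l (h : IsSymbolPair ρ r l b) :
    IsOrder (ρ / 2) (fun ξ => √(l (2 * Real.pi * ξ))) := by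
  obtain ⟨c₁, h1, c₂, h2, hc⟩ := h.hl
  have e : IsOrder (ρ / 2) (fun ξ => √(l ξ)) := by
    refine ⟨h.hl_meas.sqrt, c₂, fun ξ => ?_⟩
    rw [abs_of_nonneg (Real.sqrt_nonneg _), ← sqrt_jap, ← Real.sqrt_sq h2.le,
      ← Real.sqrt_mul (sq_nonneg _), jap_eq]
    exact Real.sqrt_le_sqrt (hc ξ).2
  exact e.dilation

theorem IsSymbolPair.isOrder_freq (h : IsSymbolPair ρ r l b) : IsOrder (1 + ρ / 2) (freq l) := by
  have e : IsOrder 1 (fun ξ : ℝ => |ξ|) :=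
    ⟨measurable_norm, 1, fun ξ => by rw [abs_abs, one_mul]; exact abs_le_jap_one ξ⟩
  exact e.dilation.mul h.isOrder_sqrt_l

theorem IsSymbolPair.isOrder_amp (h : IsSymbolPair ρ r l b) :
    IsOrder (-(r / 2 + ρ / 2)) (amp l b) := by
  obtain ⟨c₁, h1, c₂, h2, hc⟩ := h.hl
  obtain ⟨c₃, h3, hd⟩ := h.hb
  have e : IsOrder (-(r / 2 + ρ / 2)) (fun ξ => √(b ξ / l ξ)) := by
    refine ⟨(h.hb_meas.div h.hl_meas).sqrt, c₃ / c₁, fun ξ => ?_⟩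
    have hq : 0 ≤ c₃ / c₁ := by positivity
    rw [abs_of_nonneg (Real.sqrt_nonneg _), show -(r / 2 + ρ / 2) = -(r + ρ) / 2 by ring,
      ← sqrt_jap, ← Real.sqrt_sq hq, ← Real.sqrt_mul (sq_nonneg _)]
    refine Real.sqrt_le_sqrt ?_
    rw [div_le_iff₀ (h.l_pos ξ)]
    calc b ξ ≤ c₃ ^ 2 * jap (-r) ξ := by rw [jap_eq]; exact (hd ξ).2
      _ = (c₃ / c₁) ^ 2 * jap (-(r + ρ)) ξ * (c₁ ^ 2 * jap ρ ξ) := by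
        rw [show -r = -(r + ρ) + ρ by ring, jap_add]
        field_simp
      _ ≤ (c₃ / c₁) ^ 2 * jap (-(r + ρ)) ξ * l ξ := by
        refine mul_le_mul_of_nonneg_left ?_ (mul_nonneg (sq_nonneg _) (jap_pos _ _).le)
        rw [jap_eq]; exact (hc ξ).1
  exact e.dilation

theorem IsSymbolPair.isOrder_coupling (h : IsSymbolPair ρ r l b) :
    IsOrder (1 - r - ρ / 2) (coupling l b) := by
  have := h.isOrder_freq.mul (h.isOrder_amp.mul h.isOrder_amp)
  convert this using 1
  · ring
  · funext ξ; rw [coupling, sq]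

theorem freq_nonneg (l : ℝ → ℝ) (ξ : ℝ) : 0 ≤ freq l ξ := by unfold freq; positivity

theorem IsSymbolPair.freq_sq (h : IsSymbolPair ρ r l b) (ξ : ℝ) :
    freq l ξ ^ 2 = (2 * Real.pi * ξ) ^ 2 * l (2 * Real.pi * ξ) := by
  rw [freq, mul_pow, sq_abs, Real.sq_sqrt (h.l_pos _).le]

theorem IsSymbolPair.amp_pos (h : IsSymbolPair ρ r l b) (ξ : ℝ) : 0 < amp l b ξ :=
  Real.sqrt_pos.mpr (div_pos (h.b_pos _) (h.l_pos _))

theorem IsSymbolPair.amp_sq (h : IsSymbolPair ρ r l b) (ξ : ℝ) :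
    amp l b ξ ^ 2 = b (2 * Real.pi * ξ) / l (2 * Real.pi * ξ) :=
  Real.sq_sqrt (div_pos (h.b_pos _) (h.l_pos _)).le

theorem IsSymbolPair.freq_mul_coupling (h : IsSymbolPair ρ r l b) (ξ : ℝ) :
    freq l ξ * coupling l b ξ = (2 * Real.pi * ξ) ^ 2 * b (2 * Real.pi * ξ) := by
  rw [coupling, ← mul_assoc, ← sq, h.freq_sq, h.amp_sq]
  field_simp [(h.l_pos (2 * Real.pi * ξ)).ne']

theorem IsSymbolPair.freq_pos (h : IsSymbolPair ρ r l b) {ξ : ℝ} (hξ : ξ ≠ 0) : 0 < freq l ξ := by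
  have := h.l_pos (2 * Real.pi * ξ)
  unfold freq
  positivity

theorem IsSymbolPair.freq_neg (h : IsSymbolPair ρ r l b) (ξ : ℝ) : freq l (-ξ) = freq l ξ := by
  rw [freq, freq, mul_neg, abs_neg, h.hl_even]

theorem IsSymbolPair.amp_neg (h : IsSymbolPair ρ r l b) (ξ : ℝ) :
    amp l b (-ξ) = amp l b ξ := by
  rw [amp, amp, mul_neg, h.hl_even, h.hb_even]

theorem IsSymbolPair.coupling_neg (h : IsSymbolPair ρ r l b) (ξ : ℝ) :
    coupling l b (-ξ) = coupling l b ξ := by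
  rw [coupling, coupling, h.freq_neg, h.amp_neg]

/-- The multiplication by a real symbol. -/
def mulReal (f : ℝ → ℝ) : Lp ℂ 2 (volume : Measure ℝ) →L[ℂ] Lp ℂ 2 (volume : Measure ℝ) :=
  mulOp fun ξ => (f ξ : ℂ)

theorem coeFn_mulReal {f : ℝ → ℝ} (hf : IsBddSymbol fun ξ => (f ξ : ℂ))
    (W : Lp ℂ 2 (volume : Measure ℝ)) : mulReal f W =ᵐ[volume] fun ξ => (f ξ : ℂ) * W ξ :=
  coeFn_mulOp hf W

theorem mulReal_mulReal {f g k : ℝ → ℝ} (hf : IsBddSymbol fun ξ => (f ξ : ℂ))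
    (hg : IsBddSymbol fun ξ => (g ξ : ℂ)) (hk : ∀ᵐ ξ, k ξ = f ξ * g ξ)
    (hkb : IsBddSymbol fun ξ => (k ξ : ℂ)) (W : Lp ℂ 2 (volume : Measure ℝ)) :
    mulReal f (mulReal g W) = mulReal k W := by
  refine Lp.ext ?_
  filter_upwards [coeFn_mulReal hf (mulReal g W), coeFn_mulReal hg W, coeFn_mulReal hkb W, hk]
    with ξ h1 h2 h3 h4
  rw [h1, h2, h3, h4, Complex.ofReal_mul, mul_assoc]

theorem conjRefl_mulReal {f : ℝ → ℝ} (hf : IsBddSymbol fun ξ => (f ξ : ℂ))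
    (he : ∀ ξ, f (-ξ) = f ξ) (W : Lp ℂ 2 (volume : Measure ℝ)) :
    conjRefl (mulReal f W) = mulReal f (conjRefl W) :=
  conjRefl_mulOp hf (fun ξ => by rw [he, Complex.conj_ofReal]) W

/-- The pairing `∫ ζ W` of a function in `L²` with a test function. -/
def pair (ζ : 𝓢(ℝ, ℂ)) : Lp ℂ 2 (volume : Measure ℝ) →L[ℂ] ℂ :=
  innerSL ℂ ((conjSchwartz ζ).toLp 2)

theorem pair_apply (ζ : 𝓢(ℝ, ℂ)) (W : Lp ℂ 2 (volume : Measure ℝ)) :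
    pair ζ W = ∫ x, ζ x * W x := by
  rw [pair, innerSL_apply_apply, L2.inner_def]
  refine integral_congr_ae ?_
  filter_upwards [(conjSchwartz ζ).coeFn_toLp 2] with x hx
  rw [hx, conjSchwartz_apply]
  simp [mul_comm]

theorem eq_zero_of_pair {W : Lp ℂ 2 (volume : Measure ℝ)} (hW : ∀ ζ, pair ζ W = 0) : W = 0 := by
  apply Sobolev.lp_toDist_injective
  ext ζ
  rw [(representedBy_toTemperedDistribution W ζ).2, ← pair_apply, hW,
    (representedBy_toTemperedDistribution 0 ζ).2, ← pair_apply, map_zero]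

/-- A distribution whose Fourier transform is `W` times a power of `(1 + ξ²)^(1/2)`. -/
theorem RepresentedBy.apply_eq_pair {u : 𝓢'(ℝ, ℂ)} {W : Lp ℂ 2 (volume : Measure ℝ)} {m : ℝ}
    (hu : RepresentedBy (𝓕 u) (fun ξ => (jap m ξ : ℂ) * W ξ)) (η : 𝓢(ℝ, ℂ)) :
    u η = pair (SchwartzMap.smulLeftCLM ℂ (fun ξ => (jap m ξ : ℂ)) (𝓕⁻ η)) W := by
  rw [hu.apply, pair_apply]
  congr 1
  funext ξ
  rw [SchwartzMap.smulLeftCLM_apply_apply (hasTemperateGrowth_jap m), smul_eq_mul]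
  ring

theorem exists_smulLeftCLM_eq (m : ℝ) (ζ : 𝓢(ℝ, ℂ)) :
    ∃ η : 𝓢(ℝ, ℂ), SchwartzMap.smulLeftCLM ℂ (fun ξ => (jap m ξ : ℂ)) (𝓕⁻ η) = ζ := by
  refine ⟨𝓕 (SchwartzMap.smulLeftCLM ℂ (fun ξ => (jap (-m) ξ : ℂ)) ζ), ?_⟩
  rw [fourierInv_fourier_eq]
  ext ξ
  rw [SchwartzMap.smulLeftCLM_apply_apply (hasTemperateGrowth_jap m),
    SchwartzMap.smulLeftCLM_apply_apply (hasTemperateGrowth_jap (-m)), smul_eq_mul, smul_eq_mul,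
    ← mul_assoc, ← Complex.ofReal_mul, mul_comm (jap m ξ), jap_neg_mul]
  simp

theorem exists_representedBy_fourier (W : Lp ℂ 2 (volume : Measure ℝ)) (m : ℝ) :
    ∃ u : 𝓢'(ℝ, ℂ), RepresentedBy (𝓕 u) (fun ξ => (jap m ξ : ℂ) * W ξ) := by
  refine ⟨𝓕⁻ (TemperedDistribution.smulLeftCLM ℂ (fun ξ => (jap m ξ : ℂ)) (W : 𝓢'(ℝ, ℂ))), ?_⟩
  rw [fourier_fourierInv_eq]
  exact (representedBy_toTemperedDistribution W).smulLeftCLM (hasTemperateGrowth_jap m)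

/-- A curve in `L²` whose weak derivative is continuous in `L²` is differentiable. -/
theorem hasDerivAt_of_pair {S R : ℝ → Lp ℂ 2 (volume : Measure ℝ)} {s : Set ℝ} (hs : IsOpen s)
    (hsc : s.OrdConnected) (hR : ContinuousOn R s)
    (h : ∀ ζ, ∀ t ∈ s, HasDerivAt (fun τ => pair ζ (S τ)) (pair ζ (R t)) t) {t : ℝ} (ht : t ∈ s) :
    HasDerivAt S (R t) t := by
  have hint : ∀ a ∈ s, ∀ c ∈ s, IntervalIntegrable R volume a c := fun a ha c hc =>
    (hR.mono (hsc.uIcc_subset ha hc)).intervalIntegrable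
  have key : ∀ τ ∈ s, S τ = S t + ∫ x in t..τ, R x := fun τ hτ => by
    rw [← sub_eq_zero]
    refine eq_zero_of_pair fun ζ => ?_
    rw [map_sub, map_add, ← (pair ζ).intervalIntegral_comp_comm (hint t ht τ hτ)]
    have h1 := intervalIntegral.integral_eq_sub_of_hasDerivAt (a := t) (b := τ)
      (f := fun τ => pair ζ (S τ)) (f' := fun τ => pair ζ (R τ))
      (fun x hx => h ζ x (hsc.uIcc_subset ht hτ hx))
      (((pair ζ).continuous.comp_continuousOn
        (hR.mono (hsc.uIcc_subset ht hτ))).intervalIntegrable)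
    rw [h1]
    ring
  have h2 : HasDerivAt (fun τ => S t + ∫ x in t..τ, R x) (R t) t :=
    (intervalIntegral.integral_hasDerivAt_right (hint t ht t ht)
      (hR.stronglyMeasurableAtFilter hs t ht) (hR.continuousAt (hs.mem_nhds ht))).const_add _
  exact h2.congr_of_eventuallyEq (Filter.eventually_of_mem (hs.mem_nhds ht) key)

end Symbols

/-! ### The equation on the side of the Fourier transform -/

section Equation

open Filter Topology

variable {ρ r : ℝ} {l b : ℝ → ℝ}

/-- The Fourier transform of an element of `H^s`, `s ≥ 0`, as an `L²` function. -/
def fourierFun {s : ℝ} (u : Sobolev s) : Lp ℂ 2 (volume : Measure ℝ) :=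
  mulReal (jap (-s)) (hat s u)

/-- The Fourier transform of `L u_xx`, with the weight `(1 + ξ²)^(-(2+ρ)/2)`, in terms of the
Fourier transform of `u`. -/
def dispersionTerm (ρ : ℝ) (l : ℝ → ℝ) :
    Lp ℂ 2 (volume : Measure ℝ) →L[ℂ] Lp ℂ 2 (volume : Measure ℝ) :=
  -mulReal fun ξ => jap (-(2 + ρ)) ξ * freq l ξ ^ 2

/-- The Fourier transform of `B w_xx`, with the weight `(1 + ξ²)^(-(2+ρ)/2)`, in terms of the
Fourier transform of `w`. -/
def forcingTerm (ρ : ℝ) (l b : ℝ → ℝ) :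
    Lp ℂ 2 (volume : Measure ℝ) →L[ℂ] Lp ℂ 2 (volume : Measure ℝ) :=
  -mulReal fun ξ => jap (-(2 + ρ)) ξ * (freq l ξ * coupling l b ξ)

theorem conjRefl_fourierFun {s : ℝ} (hs : 0 ≤ s) (u : Sobolev s) :
    conjRefl (fourierFun u) = fourierFun u := by
  rw [fourierFun, conjRefl_mulReal (isBddSymbol_jap (by linarith)) (jap_neg _), conjRefl_hat]

theorem representedBy_fourierFun {s : ℝ} (hs : 0 ≤ s) (u : Sobolev s) :
    RepresentedBy (𝓕 u.toDist) (fourierFun u) :=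
  (representedBy_hat u).congr (coeFn_mulReal (isBddSymbol_jap (by linarith)) _).symm

theorem representedBy_re_fourierInv {s : ℝ} (hs : 0 ≤ s) (u : Sobolev s) :
    RepresentedBy u.toDist
      (fun x => (((𝓕⁻ (fourierFun u) : Lp ℂ 2 (volume : Measure ℝ)) x).re : ℂ)) := by
  refine (representedBy_fourierInv hs u).congr ?_
  have h := coeFn_fourierInv_conjRefl (fourierFun u)
  rw [conjRefl_fourierFun hs] at h
  filter_upwards [h] with x hx
  exact (Complex.conj_eq_iff_re.mp hx.symm).symm

theorem IsSymbolPair.isBddSymbol_dispersion (h : IsSymbolPair ρ r l b) :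
    IsBddSymbol fun ξ => ((jap (-(2 + ρ)) ξ * freq l ξ ^ 2 : ℝ) : ℂ) := by
  have := (isOrder_jap (-(2 + ρ))).mul (h.isOrder_freq.mul h.isOrder_freq)
  simp only [← sq] at this
  exact this.isBddSymbol (by linarith)

theorem IsSymbolPair.isBddSymbol_forcing (h : IsSymbolPair ρ r l b) :
    IsBddSymbol fun ξ => ((jap (-(2 + ρ)) ξ * (freq l ξ * coupling l b ξ) : ℝ) : ℂ) :=
  ((isOrder_jap (-(2 + ρ))).mul (h.isOrder_freq.mul h.isOrder_coupling)).isBddSymbol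
    (by linarith [h.hr, h.hρ])

theorem IsSymbolPair.coeFn_dispersionTerm (h : IsSymbolPair ρ r l b)
    (P : Lp ℂ 2 (volume : Measure ℝ)) :
    (fun ξ => (l (2 * Real.pi * ξ) : ℂ) * (((-(2 * Real.pi * ξ) ^ 2 : ℝ) : ℂ) * P ξ)) =ᵐ[volume]
      fun ξ => (jap (2 + ρ) ξ : ℂ) * dispersionTerm ρ l P ξ := by
  filter_upwards [coeFn_mulReal h.isBddSymbol_dispersion P,
    Lp.coeFn_neg (mulReal (fun ξ => jap (-(2 + ρ)) ξ * freq l ξ ^ 2) P)] with ξ h1 h2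
  have h3 : dispersionTerm ρ l P ξ = -(mulReal (fun ξ => jap (-(2 + ρ)) ξ * freq l ξ ^ 2) P ξ) := h2
  have h4 : (jap (2 + ρ) ξ : ℂ) * (jap (-(2 + ρ)) ξ : ℂ) = 1 := by
    rw [← Complex.ofReal_mul, mul_comm, jap_neg_mul, Complex.ofReal_one]
  rw [h3, h1, h.freq_sq]
  push_cast
  linear_combination (2 * (Real.pi : ℂ) * ξ) ^ 2 * (l (2 * Real.pi * ξ) : ℂ) * P ξ * h4

theorem IsSymbolPair.coeFn_forcingTerm (h : IsSymbolPair ρ r l b)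
    (W : Lp ℂ 2 (volume : Measure ℝ)) :
    (fun ξ => (b (2 * Real.pi * ξ) : ℂ) * (((-(2 * Real.pi * ξ) ^ 2 : ℝ) : ℂ) * W ξ)) =ᵐ[volume]
      fun ξ => (jap (2 + ρ) ξ : ℂ) * forcingTerm ρ l b W ξ := by
  filter_upwards [coeFn_mulReal h.isBddSymbol_forcing W,
    Lp.coeFn_neg (mulReal (fun ξ => jap (-(2 + ρ)) ξ * (freq l ξ * coupling l b ξ)) W)]
    with ξ h1 h2
  have h3 : forcingTerm ρ l b W ξ =
    -(mulReal (fun ξ => jap (-(2 + ρ)) ξ * (freq l ξ * coupling l b ξ)) W ξ) := h2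
  have h4 : (jap (2 + ρ) ξ : ℂ) * (jap (-(2 + ρ)) ξ : ℂ) = 1 := by
    rw [← Complex.ofReal_mul, mul_comm, jap_neg_mul, Complex.ofReal_one]
  rw [h3, h1, h.freq_mul_coupling]
  push_cast
  linear_combination (2 * (Real.pi : ℂ) * ξ) ^ 2 * (b (2 * Real.pi * ξ) : ℂ) * W ξ * h4

/-- The Fourier transform of an element of `H^σ`, with the weight `(1 + ξ²)^(-(2+ρ)/2)`. This weight
makes all terms of the equation elements of `L²`. -/
def weighted (ρ : ℝ) {σ : ℝ} (w : Sobolev σ) : Lp ℂ 2 (volume : Measure ℝ) :=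
  mulReal (jap (-(2 + ρ) - σ)) (hat σ w)

theorem apply_eq_pair_weighted {σ : ℝ} (hσ : 0 ≤ 2 + ρ + σ) (w : Sobolev σ) (η : 𝓢(ℝ, ℂ)) :
    w.toDist η = pair (SchwartzMap.smulLeftCLM ℂ (fun ξ => (jap (2 + ρ) ξ : ℂ)) (𝓕⁻ η))
      (weighted ρ w) := by
  refine RepresentedBy.apply_eq_pair ((representedBy_hat w).congr ?_) η
  filter_upwards [coeFn_mulReal (f := jap (-(2 + ρ) - σ)) (isBddSymbol_jap (by linarith))
    (hat σ w)] with ξ hξ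
  rw [weighted, hξ, ← mul_assoc, ← Complex.ofReal_mul, ← jap_add]
  congr 3
  ring

variable {g γ : ℝ → ℝ} {L : NNReal}

/-- The weak form of the equation at time `t`, in `L²` on the side of the Fourier transform. -/
theorem SolvesAt.hasDerivAt_pair (h : IsSymbolPair ρ r l b) (hγ : LipschitzWith L γ)
    (h0 : γ 0 = 0) {u : ℝ → Sobolev (r / 2 + ρ / 2)} {vt : ℝ → Sobolev (r / 2 - 1)} {t : ℝ}
    (hsol : SolvesAt l b g (fun τ => (u τ).toDist) (fun τ => (vt τ).toDist) t)
    (hgγ : ∀ᵐ x, γ ((𝓕⁻ (fourierFun (u t)) : Lp ℂ 2 (volume : Measure ℝ)) x).re =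
      g ((𝓕⁻ (fourierFun (u t)) : Lp ℂ 2 (volume : Measure ℝ)) x).re) (ζ : 𝓢(ℝ, ℂ)) :
    HasDerivAt (fun τ => pair ζ (weighted ρ (vt τ)))
      (pair ζ (dispersionTerm ρ l (fourierFun (u t)) +
        forcingTerm ρ l b (nonlin hγ h0 (fourierFun (u t))))) t := by
  have hs := h.hs
  obtain ⟨f, gu, Luxx, Bgxx, hf, hgu, hL, hB, hd⟩ := hsol
  set P := fourierFun (u t) with hP
  have hfP := (representedBy_re_fourierInv (by linarith) (u t)).ae_eq hf
  have hgu' : gu = ((𝓕⁻ (nonlin hγ h0 P) : Lp ℂ 2 (volume : Measure ℝ)) : 𝓢'(ℝ, ℂ)) := by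
    refine hgu.eq (representedBy_toTemperedDistribution _) ?_
    filter_upwards [hfP, coeFn_fourierInv_nonlin hγ h0 P, hgγ] with x h1 h2 h3
    rw [h2, h3, Complex.ofReal_injective h1]
  have hgF : RepresentedBy (𝓕 gu) (nonlin hγ h0 P) := by
    have := representedBy_fourier (𝓕⁻ (nonlin hγ h0 P))
    rwa [fourier_fourierInv_eq, ← hgu'] at this
  obtain ⟨η, rfl⟩ := exists_smulLeftCLM_eq (2 + ρ) ζ
  have h1 := ((hL.representedBy (representedBy_fourierFun (by linarith) (u t)).dxx).congr
    (h.coeFn_dispersionTerm P)).apply_eq_pair η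
  have h2 := ((hB.representedBy hgF.dxx).congr
    (h.coeFn_forcingTerm (nonlin hγ h0 P))).apply_eq_pair η
  rw [map_add, ← h1, ← h2]
  refine (hd η).congr_of_eventuallyEq (Eventually.of_forall fun τ => ?_)
  exact (apply_eq_pair_weighted (by linarith [h.hr, h.hρ]) (vt τ) η).symm

/-- The converse: a derivative in weighted `L²` is one in the sense of distributions. -/
theorem solvesAt_of_hasDerivAt (h : IsSymbolPair ρ r l b) (hγ : LipschitzWith L γ)
    (h0 : γ 0 = 0) {u : ℝ → Sobolev (r / 2 + ρ / 2)} {vt : ℝ → Sobolev (r / 2 - 1)} {t : ℝ}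
    (hgγ : ∀ᵐ x, γ ((𝓕⁻ (fourierFun (u t)) : Lp ℂ 2 (volume : Measure ℝ)) x).re =
      g ((𝓕⁻ (fourierFun (u t)) : Lp ℂ 2 (volume : Measure ℝ)) x).re)
    (hd : HasDerivAt (fun τ => weighted ρ (vt τ)) (dispersionTerm ρ l (fourierFun (u t)) +
        forcingTerm ρ l b (nonlin hγ h0 (fourierFun (u t)))) t) :
    SolvesAt l b g (fun τ => (u τ).toDist) (fun τ => (vt τ).toDist) t := by
  have hs := h.hs
  set P := fourierFun (u t) with hP
  obtain ⟨Luxx, hL⟩ := exists_representedBy_fourier (dispersionTerm ρ l P) (2 + ρ)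
  obtain ⟨Bgxx, hB⟩ := exists_representedBy_fourier (forcingTerm ρ l b (nonlin hγ h0 P)) (2 + ρ)
  have hgF := representedBy_fourier (𝓕⁻ (nonlin hγ h0 P))
  rw [fourier_fourierInv_eq] at hgF
  refine ⟨fun x => ((𝓕⁻ P : Lp ℂ 2 (volume : Measure ℝ)) x).re,
    ((𝓕⁻ (nonlin hγ h0 P) : Lp ℂ 2 (volume : Measure ℝ)) : 𝓢'(ℝ, ℂ)), Luxx, Bgxx,
    representedBy_re_fourierInv (by linarith) (u t), ?_,
    ⟨_, (representedBy_fourierFun (by linarith) (u t)).dxx,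
      hL.congr (h.coeFn_dispersionTerm P).symm⟩,
    ⟨_, hgF.dxx, hB.congr (h.coeFn_forcingTerm _).symm⟩, fun η => ?_⟩
  · refine (representedBy_toTemperedDistribution _).congr ?_
    filter_upwards [coeFn_fourierInv_nonlin hγ h0 P, hgγ] with x h2 h3
    rw [h2, h3]
  · rw [hL.apply_eq_pair, hB.apply_eq_pair, ← map_add]
    have := ((pair (SchwartzMap.smulLeftCLM ℂ (fun ξ => (jap (2 + ρ) ξ : ℂ))
      (𝓕⁻ η))).restrictScalars ℝ).hasFDerivAt.comp_hasDerivAt t hd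
    refine this.congr_of_eventuallyEq (Eventually.of_forall fun τ => ?_)
    exact apply_eq_pair_weighted (by linarith [h.hr, h.hρ]) (vt τ) η

end Equation

/-! ### Uniqueness -/

section Gronwall

open Filter Topology

variable {α : Type*} [MeasurableSpace α] {μ : Measure α}

/-- Grönwall's lemma for the integral of `D`. -/
theorem eq_zero_of_le_integral {D : ℝ → ℝ} {K T : ℝ} (hT : 0 ≤ T)
    (hc : ContinuousOn D (Icc 0 T)) (h0 : ∀ t ∈ Icc 0 T, 0 ≤ D t)
    (h : ∀ t ∈ Icc 0 T, D t ≤ K * ∫ τ in (0 : ℝ)..t, D τ) : ∀ t ∈ Icc 0 T, D t = 0 := by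
  set D' : ℝ → ℝ := IccExtend hT ((Icc 0 T).domRestrict D) with hD'
  have hc' : Continuous D' := (continuousOn_iff_continuous_domRestrict.mp hc).Icc_extend'
  have heq : ∀ t ∈ Icc 0 T, D' t = D t := fun t ht => IccExtend_of_mem hT _ ht
  have hnn : ∀ t, 0 ≤ D' t := fun t => h0 _ (projIcc 0 T hT t).2
  have hI : ∀ t ∈ Icc 0 T, ∫ τ in (0 : ℝ)..t, D τ = ∫ τ in (0 : ℝ)..t, D' τ := fun t ht =>
    intervalIntegral.integral_congr fun τ hτ =>
      (heq τ (uIcc_subset_Icc ⟨le_rfl, hT⟩ ht hτ)).symm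
  have hd : ∀ t, HasDerivAt (fun t => ∫ τ in (0 : ℝ)..t, D' τ) (D' t) t := fun t =>
    intervalIntegral.integral_hasDerivAt_right (hc'.intervalIntegrable _ _)
      (hc'.stronglyMeasurableAtFilter _ _) hc'.continuousAt
  have hg := norm_le_gronwallBound_of_norm_deriv_right_le (a := 0) (b := T) (δ := 0) (ε := 0)
    (K := K) (f := fun t => ∫ τ in (0 : ℝ)..t, D' τ) (f' := D')
    (fun t _ => (hd t).continuousAt.continuousWithinAt) (fun t _ => (hd t).hasDerivWithinAt)
    (by simp) (fun t ht => by
      have ht' : t ∈ Icc 0 T := ⟨ht.1, ht.2.le⟩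
      rw [Real.norm_of_nonneg (hnn t), Real.norm_of_nonneg
        (intervalIntegral.integral_nonneg ht.1 fun τ _ => hnn τ), add_zero, heq t ht',
        ← hI t ht']
      exact h t ht')
  intro t ht
  have h1 := hg t ht
  rw [gronwallBound_ε0_δ0] at h1
  have h2 := norm_le_zero_iff.mp h1
  refine le_antisymm ((h t ht).trans ?_) (h0 t ht)
  rw [hI t ht, h2, mul_zero]

/-- The energy estimate for `d' = ω e`, `e' = -ω d - Δ` on a set of bounded frequencies. The
bound does not involve `e`, nor does its constant depend on the set, so that it survives the passage
to the limit of all frequencies, where `e` need not make sense in `L²`. -/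
theorem norm_proj_sq_le_integral {A : Set α} (hA : MeasurableSet A) {ω : α → ℝ}
    (hω : IsBddSymbol fun x => ((A.indicator ω x : ℝ) : ℂ)) {d e Δ : ℝ → Lp ℂ 2 μ} {K T : ℝ}
    (hK : 0 ≤ K)
    (hd : ∀ t ∈ Ioo 0 T, HasDerivAt (fun τ => proj A (d τ))
      (mulOp (fun x => ((A.indicator ω x : ℝ) : ℂ)) (e t)) t)
    (he : ∀ t ∈ Ioo 0 T, HasDerivAt e
      (-mulOp (fun x => ((A.indicator ω x : ℝ) : ℂ)) (d t) - Δ t) t)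
    (hΔ : ∀ t ∈ Ioo 0 T, ‖Δ t‖ ≤ K * ‖d t‖) (hdc : ContinuousOn d (Icc 0 T))
    (hec : ContinuousOn e (Icc 0 T)) (hd0 : d 0 = 0) (he0 : e 0 = 0) {t : ℝ}
    (ht : t ∈ Icc 0 T) :
    Real.exp (-K * t) * ‖proj A (d t)‖ ^ 2 ≤
      K * ∫ τ in (0 : ℝ)..t, Real.exp (-K * τ) * ‖d τ‖ ^ 2 := by
  have hT : 0 ≤ T := ht.1.trans ht.2
  set E : ℝ → ℝ := fun t => ‖proj A (d t)‖ ^ 2 + ‖e t‖ ^ 2 with hE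
  set D : ℝ → ℝ := fun τ => Real.exp (-K * τ) * ‖d τ‖ ^ 2 with hD
  have hDc : ContinuousOn D (Icc 0 T) := by
    refine ContinuousOn.mul (Continuous.continuousOn (by fun_prop)) (hdc.norm.pow 2)
  have hDi : ∀ t ∈ Icc 0 T, IntervalIntegrable D volume 0 t := fun t ht =>
    (hDc.mono (uIcc_subset_Icc ⟨le_rfl, hT⟩ ht)).intervalIntegrable
  set I : ℝ → ℝ := fun t => ∫ τ in (0 : ℝ)..t, D τ with hI
  have hIc : ContinuousOn I (Icc 0 T) := by
    have := intervalIntegral.continuousOn_primitive_interval' (hDi T ⟨hT, le_rfl⟩) left_mem_uIcc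
    rwa [uIcc_of_le hT] at this
  have hEc : ContinuousOn E (Icc 0 T) :=
    (((proj A).continuous.comp_continuousOn hdc).norm.pow 2).add (hec.norm.pow 2)
  have hId : ∀ t ∈ Ioo 0 T, HasDerivAt I (D t) t := fun t ht =>
    intervalIntegral.integral_hasDerivAt_right (hDi t (Ioo_subset_Icc_self ht))
      ((hDc.mono Ioo_subset_Icc_self).stronglyMeasurableAtFilter isOpen_Ioo t ht)
      (hDc.continuousAt (Icc_mem_nhds ht.1 ht.2))
  let _ : InnerProductSpace ℝ (Lp ℂ 2 μ) := InnerProductSpace.rclikeToReal ℂ (Lp ℂ 2 μ)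
  have hre : ∀ f g : Lp ℂ 2 μ,
      @inner ℝ _ (InnerProductSpace.rclikeToReal ℂ (Lp ℂ 2 μ)).toInner f g = (inner ℂ f g).re :=
    fun f g => real_inner_eq_re_inner ℂ f g
  have hEd : ∀ t ∈ Ioo 0 T, ∃ E', HasDerivAt E E' t ∧ E' ≤ K * E t + K * ‖d t‖ ^ 2 := by
    intro t ht
    refine ⟨_, (hd t ht).norm_sq.add (he t ht).norm_sq, ?_⟩
    set m : Lp ℂ 2 μ →L[ℂ] Lp ℂ 2 μ := mulOp (fun x => ((A.indicator ω x : ℝ) : ℂ)) with hm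
    have h1 : (inner ℂ (proj A (d t)) (m (e t))).re = (inner ℂ (e t) (m (d t))).re := by
      have e1 : inner ℂ (e t) (m (d t)) = inner ℂ (m (e t)) (d t) :=
        (inner_mulOp_ofReal hω (e t) (d t)).symm
      have e2 : inner ℂ (proj A (d t)) (m (e t)) = inner ℂ (d t) (m (e t)) := by
        rw [proj, inner_mulOp_left (isBddSymbol_indicator_one hA), hm,
          mulOp_mulOp_eq (isBddSymbol_indicator_one hA).conj hω (fun x => ?_)]
        by_cases hx : x ∈ A <;> simp [hx]
      rw [e1, e2, ← inner_conj_symm, Complex.conj_re]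
    have h2 : -(inner ℂ (e t) (Δ t)).re ≤ ‖e t‖ * (K * ‖d t‖) := by
      refine (neg_le_abs _).trans ((Complex.abs_re_le_norm _).trans ?_)
      exact (norm_inner_le_norm _ _).trans
        (mul_le_mul_of_nonneg_left (hΔ t ht) (norm_nonneg _))
    rw [hre, hre, inner_sub_right, inner_neg_right, Complex.sub_re, Complex.neg_re, h1]
    have h3 : 2 * (‖e t‖ * ‖d t‖) ≤ ‖e t‖ ^ 2 + ‖d t‖ ^ 2 := by
      nlinarith [sq_nonneg (‖e t‖ - ‖d t‖)]
    have h4 := mul_le_mul_of_nonneg_left h3 hK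
    have h5 : 0 ≤ K * ‖proj A (d t)‖ ^ 2 := by positivity
    simp only [hE]
    nlinarith
  have hanti : AntitoneOn (fun t => Real.exp (-K * t) * E t - K * I t) (Icc 0 T) := by
    have hder : ∀ t ∈ Ioo 0 T, ∃ F', HasDerivAt (fun t => Real.exp (-K * t) * E t - K * I t) F' t ∧
        F' ≤ 0 := fun t ht => by
      obtain ⟨E', hE', hle⟩ := hEd t ht
      have hexp : HasDerivAt (fun t => Real.exp (-K * t)) (Real.exp (-K * t) * -K) t := by
        have h1 : HasDerivAt (fun t : ℝ => -K * t) (-K) t := by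
          simpa using (hasDerivAt_id t).const_mul (-K)
        exact h1.exp
      refine ⟨_, (hexp.mul hE').sub ((hId t ht).const_mul K), ?_⟩
      have := mul_le_mul_of_nonneg_left hle (Real.exp_pos (-K * t)).le
      simp only [hD]
      nlinarith
    refine antitoneOn_of_deriv_nonpos (convex_Icc 0 T) ?_ ?_ ?_
    · exact (ContinuousOn.mul (Continuous.continuousOn (by fun_prop)) hEc).sub
        (continuousOn_const.mul hIc)
    · rw [interior_Icc]
      intro t ht
      obtain ⟨F', hF, -⟩ := hder t ht
      exact hF.differentiableAt.differentiableWithinAt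
    · rw [interior_Icc]
      intro t ht
      obtain ⟨F', hF, hle⟩ := hder t ht
      rw [hF.deriv]; exact hle
  have h1 := hanti ⟨le_rfl, hT⟩ ht ht.1
  simp only [hE, hI, hd0, he0, map_zero, norm_zero, intervalIntegral.integral_same] at h1
  have h2 : 0 ≤ Real.exp (-K * t) * ‖e t‖ ^ 2 := by positivity
  nlinarith

end Gronwall

section Uniqueness

open Filter Topology

variable {ρ r : ℝ} {l b : ℝ → ℝ} {g : ℝ → ℝ}

/-- The frequencies that are bounded and, except for `ξ = 0`, stay away from the zero of the
dispersion relation. The point `ξ = 0` is included to have an exhaustion of the whole line; there the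
convention `0⁻¹ = 0` keeps `ω⁻¹` bounded, and as a null set it does not matter. -/
def freqSet (l : ℝ → ℝ) (n : ℕ) : Set ℝ := {ξ | |ξ| ≤ n ∧ (((n : ℝ) + 1)⁻¹ ≤ freq l ξ ∨ ξ = 0)}

theorem IsSymbolPair.isExhaustion_freqSet (h : IsSymbolPair ρ r l b) :
    IsExhaustion (freqSet l) where
  measurableSet n := (measurableSet_le measurable_norm measurable_const).inter
    ((measurableSet_le measurable_const h.isOrder_freq.1).union (measurableSet_singleton 0))
  mono := fun m n hmn ξ hξ => by
    have hmn' : (m : ℝ) ≤ n := Nat.cast_le.mpr hmn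
    exact ⟨hξ.1.trans hmn', hξ.2.imp_left fun h1 => le_trans (by gcongr) h1⟩
  exists_mem ξ := by
    rcases eq_or_ne ξ 0 with rfl | hξ
    · exact ⟨0, by simp [freqSet]⟩
    · obtain ⟨m, hm⟩ := exists_nat_ge (max |ξ| (freq l ξ)⁻¹)
      refine ⟨m, (le_max_left _ _).trans hm, Or.inl ?_⟩
      rw [inv_le_comm₀ (by positivity) (h.freq_pos hξ)]
      linarith [(le_max_right |ξ| (freq l ξ)⁻¹).trans hm]

theorem abs_inv_freq_le {n : ℕ} {ξ : ℝ} (hξ : ξ ∈ freqSet l n) : |(freq l ξ)⁻¹| ≤ n + 1 := by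
  rw [abs_of_nonneg (inv_nonneg.mpr (freq_nonneg l ξ))]
  rcases hξ.2 with h1 | rfl
  · exact inv_le_of_inv_le₀ (by positivity) h1
  · simp only [freq, mul_zero, abs_zero, zero_mul, inv_zero]
    positivity

theorem IsSymbolPair.ae_freq_ne_zero (h : IsSymbolPair ρ r l b) : ∀ᵐ ξ : ℝ, freq l ξ ≠ 0 := by
  have h1 : ∀ᵐ ξ : ℝ, ξ ≠ 0 := by simp [ae_iff]
  exact h1.mono fun ξ hξ => (h.freq_pos hξ).ne'

theorem IsSymbolPair.isBddSymbol_freqSet (h : IsSymbolPair ρ r l b) {t : ℝ} {f : ℝ → ℝ}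
    (hf : IsOrder t f) (n : ℕ) : IsBddSymbol fun ξ => (((freqSet l n).indicator f ξ : ℝ) : ℂ) :=
  hf.indicator (h.isExhaustion_freqSet.measurableSet n) (R := n) fun _ hξ => hξ.1

theorem IsSymbolPair.isBddSymbol_freqSet_inv (h : IsSymbolPair ρ r l b) {t : ℝ} {f : ℝ → ℝ}
    (hf : IsOrder t f) (n : ℕ) :
    IsBddSymbol fun ξ => (((freqSet l n).indicator (fun ξ => f ξ * (freq l ξ)⁻¹) ξ : ℝ) : ℂ) := by
  have h1 : IsBddSymbol fun ξ => (((freqSet l n).indicator (fun ξ => (freq l ξ)⁻¹) ξ : ℝ) : ℂ) :=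
    isBddSymbol_indicator_ofReal h.isOrder_freq.1.inv (h.isExhaustion_freqSet.measurableSet n)
      fun ξ hξ => abs_inv_freq_le hξ
  have h2 := (h.isBddSymbol_freqSet hf n).mul h1
  convert h2 using 2 with ξ
  by_cases hξ : ξ ∈ freqSet l n <;> simp [hξ]

theorem mulReal_indicator_one (A : Set ℝ) (W : Lp ℂ 2 (volume : Measure ℝ)) :
    mulReal (A.indicator fun _ => 1) W = proj A W := by
  rw [mulReal, proj, ← ofReal_indicator]
  simp

/-- On bounded frequencies the Fourier transform of a solution is differentiable, with a derivative
in terms of `u_t`. -/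
theorem IsSymbolPair.hasDerivAt_proj_fourierFun (h : IsSymbolPair ρ r l b)
    {u : ℝ → Sobolev (r / 2 + ρ / 2)} {v vt : ℝ → Sobolev (r / 2 - 1)}
    (hv : ∀ t ∈ Ici (0 : ℝ), (v t).toDist = (u t).toDist)
    (hvt : ∀ t ∈ Ici (0 : ℝ), HasDerivWithinAt v (vt t) (Ici 0) t) (n : ℕ) {t : ℝ} (ht : 0 < t) :
    HasDerivAt (fun τ => proj (freqSet l n) (fourierFun (u τ)))
      (mulReal ((freqSet l n).indicator (jap (-(r / 2 - 1)))) (hat (r / 2 - 1) (vt t))) t := by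
  have hs := h.hs
  have hb := h.isBddSymbol_freqSet (isOrder_jap (-(r / 2 - 1))) n
  have h1 : HasDerivAt v (vt t) t := (hvt t ht.le).hasDerivAt (Ici_mem_nhds ht)
  have h2 := (((mulReal ((freqSet l n).indicator (jap (-(r / 2 - 1))))).restrictScalars ℝ).comp
    (hat (r / 2 - 1)).toContinuousLinearMap).hasFDerivAt.comp_hasDerivAt t h1
  refine h2.congr_of_eventuallyEq (Filter.eventually_of_mem (Ioi_mem_nhds ht) fun τ hτ => ?_)
  refine Lp.ext ?_
  have hA := isBddSymbol_indicator_one (h.isExhaustion_freqSet.measurableSet n)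
  filter_upwards [coeFn_mulOp hA (fourierFun (u τ)), coeFn_mulReal hb (hat (r / 2 - 1) (v τ)),
    coeFn_mulReal (isBddSymbol_jap (s := -(r / 2 + ρ / 2)) (by linarith))
      (hat (r / 2 + ρ / 2) (u τ)), hat_eq_of_toDist (hv τ (show (0 : ℝ) ≤ τ from le_of_lt hτ))] with ξ e1 e2 e3 e4
  refine e1.trans (Eq.trans ?_ e2.symm)
  rw [e4, fourierFun, e3]
  by_cases hξ : ξ ∈ freqSet l n
  · simp only [hξ, indicator_of_mem, one_mul]
    rw [← mul_assoc, ← Complex.ofReal_mul, ← jap_add]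
    congr 3
    ring
  · simp [hξ]

theorem continuousOn_fourierFun {s : ℝ} {u : ℝ → Sobolev s} {S : Set ℝ}
    (hu : ContinuousOn u S) : ContinuousOn (fun t => fourierFun (u t)) S :=
  (mulReal (jap (-s))).continuous.comp_continuousOn ((hat s).continuous.comp_continuousOn hu)

theorem exists_bound_fourierFun {s T : ℝ} (hs : 1 / 2 < s) {u : ℝ → Sobolev s}
    (hu : ContinuousOn u (Ici 0)) : ∃ M : ℝ, 0 ≤ M ∧ ∀ t ∈ Icc 0 T, ∀ᵐ x,
      ((𝓕⁻ (fourierFun (u t)) : Lp ℂ 2 (volume : Measure ℝ)) x).re ∈ Icc (-M) M := by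
  obtain ⟨C, hC0, hC⟩ := exists_sobolev_bound hs
  obtain ⟨R, hR⟩ := isCompact_Icc.exists_bound_of_continuousOn
    (((hat s).continuous.comp_continuousOn hu).mono (Icc_subset_Ici_self : Icc 0 T ⊆ Ici 0))
  refine ⟨C * max R 0, by positivity, fun t ht => (hC (hat s (u t))).mono fun x hx => ?_⟩
  rw [mem_Icc, ← abs_le]
  refine (Complex.abs_re_le_norm _).trans (hx.trans (mul_le_mul_of_nonneg_left ?_ hC0))
  exact (hR t ht).trans (le_max_left _ _)

theorem eq_zero_of_primitive_nonneg {g : ℝ → ℝ} (hg : Continuous g)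
    (hG : ∀ v : ℝ, 0 ≤ ∫ p in (0 : ℝ)..v, g p) : g 0 = 0 := by
  have hmin : IsLocalMin (fun v => ∫ p in (0 : ℝ)..v, g p) 0 :=
    Eventually.of_forall fun v => by simpa using hG v
  exact hmin.hasDerivAt_eq_zero (intervalIntegral.integral_hasDerivAt_right
    (hg.intervalIntegrable _ _) (hg.stronglyMeasurableAtFilter _ _) hg.continuousAt)

/-- The weak equation determines a genuine derivative of `u_t`, in `L²` with a weight. -/
theorem IsSymbolPair.hasDerivAt_weighted (h : IsSymbolPair ρ r l b) {γ : ℝ → ℝ} {L : NNReal}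
    (hγ : LipschitzWith L γ) (h0 : γ 0 = 0) {T : ℝ} {u : ℝ → Sobolev (r / 2 + ρ / 2)}
    {vt : ℝ → Sobolev (r / 2 - 1)} (hu : ContinuousOn u (Ici 0))
    (hsol : ∀ t ∈ Ioi (0 : ℝ), SolvesAt l b g (fun τ => (u τ).toDist) (fun τ => (vt τ).toDist) t)
    (hgγ : ∀ t ∈ Icc 0 T, ∀ᵐ x,
      γ ((𝓕⁻ (fourierFun (u t)) : Lp ℂ 2 (volume : Measure ℝ)) x).re =
      g ((𝓕⁻ (fourierFun (u t)) : Lp ℂ 2 (volume : Measure ℝ)) x).re) {t : ℝ}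
    (ht : t ∈ Ioo 0 T) :
    HasDerivAt (fun τ => weighted ρ (vt τ)) (dispersionTerm ρ l (fourierFun (u t)) +
        forcingTerm ρ l b (nonlin hγ h0 (fourierFun (u t)))) t := by
  have hp : ContinuousOn (fun t => fourierFun (u t)) (Ioo 0 T) :=
    (continuousOn_fourierFun hu).mono fun t ht => ht.1.le
  refine hasDerivAt_of_pair isOpen_Ioo ordConnected_Ioo (R := fun t =>
    dispersionTerm ρ l (fourierFun (u t)) +
      forcingTerm ρ l b (nonlin hγ h0 (fourierFun (u t)))) ?_ (fun ζ τ hτ => ?_) ht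
  · have hN : Continuous (nonlin hγ h0) := by
      have : LipschitzWith L (nonlin hγ h0) := lipschitzWith_nonlin hγ h0
      exact this.continuous
    exact ((dispersionTerm ρ l).continuous.comp_continuousOn hp).add
      ((forcingTerm ρ l b).continuous.comp_continuousOn (hN.comp_continuousOn hp))
  · exact (hsol τ hτ.1).hasDerivAt_pair h hγ h0 (hgγ τ (Ioo_subset_Icc_self hτ)) ζ

/-- Division of the weighted equation by the dispersion relation. -/
theorem IsSymbolPair.mulReal_inv_freq (h : IsSymbolPair ρ r l b) (n : ℕ)
    (P W : Lp ℂ 2 (volume : Measure ℝ)) :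
    mulReal ((freqSet l n).indicator fun ξ => jap (2 + ρ) ξ * (freq l ξ)⁻¹)
      (dispersionTerm ρ l P + forcingTerm ρ l b W) =
    -mulReal ((freqSet l n).indicator (freq l)) P -
      mulReal ((freqSet l n).indicator (coupling l b)) W := by
  have hb := h.isBddSymbol_freqSet_inv (isOrder_jap (2 + ρ)) n
  have hj : ∀ ξ, jap (2 + ρ) ξ * jap (-(2 + ρ)) ξ = 1 := fun ξ => by
    rw [mul_comm, jap_neg_mul]
  have e1 := mulReal_mulReal hb h.isBddSymbol_dispersion
    (k := (freqSet l n).indicator (freq l)) (by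
      filter_upwards [h.ae_freq_ne_zero] with ξ hξ
      by_cases hm : ξ ∈ freqSet l n
      · simp only [hm, indicator_of_mem]
        linear_combination -(freq l ξ * ((freq l ξ)⁻¹ * freq l ξ)) * hj ξ -
          freq l ξ * inv_mul_cancel₀ hξ
      · simp [hm]) (h.isBddSymbol_freqSet h.isOrder_freq n) P
  have e2 := mulReal_mulReal hb h.isBddSymbol_forcing
    (k := (freqSet l n).indicator (coupling l b)) (by
      filter_upwards [h.ae_freq_ne_zero] with ξ hξ
      by_cases hm : ξ ∈ freqSet l n
      · simp only [hm, indicator_of_mem]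
        linear_combination -(coupling l b ξ * ((freq l ξ)⁻¹ * freq l ξ)) * hj ξ -
          coupling l b ξ * inv_mul_cancel₀ hξ
      · simp [hm]) (h.isBddSymbol_freqSet h.isOrder_coupling n) W
  rw [map_add, dispersionTerm, forcingTerm, neg_apply,
    neg_apply, map_neg, map_neg, e1, e2]
  abel

theorem IsSymbolPair.mulReal_freq_weighted (h : IsSymbolPair ρ r l b) (n : ℕ)
    (w : Sobolev (r / 2 - 1)) :
    mulReal ((freqSet l n).indicator (freq l))
      (mulReal ((freqSet l n).indicator fun ξ => jap (2 + ρ) ξ * (freq l ξ)⁻¹) (weighted ρ w)) =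
    mulReal ((freqSet l n).indicator (jap (-(r / 2 - 1)))) (hat _ w) := by
  have hbw : IsBddSymbol fun ξ => (jap (-(2 + ρ) - (r / 2 - 1)) ξ : ℂ) :=
    isBddSymbol_jap (by linarith [h.hr, h.hρ])
  have hbj := h.isBddSymbol_freqSet (isOrder_jap (2 + ρ)) n
  have e1 := mulReal_mulReal (h.isBddSymbol_freqSet h.isOrder_freq n)
    (h.isBddSymbol_freqSet_inv (isOrder_jap (2 + ρ)) n)
    (k := (freqSet l n).indicator (jap (2 + ρ))) (by
      filter_upwards [h.ae_freq_ne_zero] with ξ hξ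
      by_cases hm : ξ ∈ freqSet l n
      · simp only [hm, indicator_of_mem]
        linear_combination -(jap (2 + ρ) ξ) * inv_mul_cancel₀ hξ
      · simp [hm]) hbj (weighted ρ w)
  rw [e1, weighted]
  refine mulReal_mulReal hbj hbw (Eventually.of_forall fun ξ => ?_)
    (h.isBddSymbol_freqSet (isOrder_jap _) n) _
  by_cases hm : ξ ∈ freqSet l n
  · simp only [hm, indicator_of_mem]
    rw [← jap_add]
    congr 1
    ring
  · simp [hm]

/-- Two solutions of the Cauchy problem agree. -/
theorem IsSymbolPair.unique (h : IsSymbolPair ρ r l b) (hg : ContDiff ℝ 1 g)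
    (hG : ∀ v : ℝ, 0 ≤ ∫ p in (0 : ℝ)..v, g p) {φ : Sobolev (r / 2 + ρ / 2)}
    {ψ : Sobolev (r / 2 - 1)} {u₁ u₂ : ℝ → Sobolev (r / 2 + ρ / 2)}
    (h₁ : IsGlobalSolution l b g φ ψ u₁) (h₂ : IsGlobalSolution l b g φ ψ u₂) :
    EqOn u₁ u₂ (Ici 0) := by
  obtain ⟨hc₁, hi₁, v₁, vt₁, hv₁, hd₁, hvc₁, hvi₁, hsol₁⟩ := h₁
  obtain ⟨hc₂, hi₂, v₂, vt₂, hv₂, hd₂, hvc₂, hvi₂, hsol₂⟩ := h₂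
  intro T hT
  have hT0 : 0 ≤ T := hT
  have hs := h.hs
  obtain ⟨M₁, hM₁, hb₁⟩ := exists_bound_fourierFun (T := T) hs hc₁
  obtain ⟨M₂, hM₂, hb₂⟩ := exists_bound_fourierFun (T := T) hs hc₂
  have hM : 0 ≤ max M₁ M₂ := le_max_of_le_left hM₁
  obtain ⟨γ, L, hγ, hγg, -⟩ := exists_lipschitz_truncation hg hG hM
  have h0 : γ 0 = 0 := by
    rw [hγg 0 ⟨by linarith, hM⟩, eq_zero_of_primitive_nonneg hg.continuous hG]
  have hgγ₁ := fun t ht => (hb₁ t ht).mono fun x hx =>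
    hγg _ (Icc_subset_Icc (neg_le_neg (le_max_left M₁ M₂)) (le_max_left M₁ M₂) hx)
  have hgγ₂ := fun t ht => (hb₂ t ht).mono fun x hx =>
    hγg _ (Icc_subset_Icc (neg_le_neg (le_max_right M₁ M₂)) (le_max_right M₁ M₂) hx)
  obtain ⟨C, hC0, hC⟩ := h.isOrder_coupling.exists_abs_le (by linarith [h.hrρ])
  set N := nonlin hγ h0 with hN
  have hNl : LipschitzWith L N := lipschitzWith_nonlin hγ h0
  set d : ℝ → Lp ℂ 2 (volume : Measure ℝ) := fun t => fourierFun (u₁ t) - fourierFun (u₂ t)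
    with hd
  have hIcc : Icc 0 T ⊆ Ici 0 := Icc_subset_Ici_self
  have hdc : ContinuousOn d (Icc 0 T) :=
    ((continuousOn_fourierFun hc₁).sub (continuousOn_fourierFun hc₂)).mono hIcc
  have hw : ∀ {vt : ℝ → Sobolev (r / 2 - 1)}, ContinuousOn vt (Ici 0) →
      ContinuousOn (fun t => weighted ρ (vt t)) (Icc 0 T) := fun hvt =>
    (mulReal _).continuous.comp_continuousOn ((hat _).continuous.comp_continuousOn
      (hvt.mono hIcc))
  have key : ∀ n, ∀ t ∈ Icc 0 T, Real.exp (-(C * L) * t) * ‖proj (freqSet l n) (d t)‖ ^ 2 ≤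
      (C * L) * ∫ τ in (0 : ℝ)..t, Real.exp (-(C * L) * τ) * ‖d τ‖ ^ 2 := fun n t ht => by
    have hA := h.isExhaustion_freqSet.measurableSet n
    set m : Lp ℂ 2 (volume : Measure ℝ) →L[ℂ] Lp ℂ 2 (volume : Measure ℝ) :=
      mulReal ((freqSet l n).indicator fun ξ => jap (2 + ρ) ξ * (freq l ξ)⁻¹) with hm
    have hbm := h.isBddSymbol_freqSet_inv (isOrder_jap (2 + ρ)) n
    have hbk := h.isBddSymbol_freqSet h.isOrder_coupling n
    refine norm_proj_sq_le_integral hA (h.isBddSymbol_freqSet h.isOrder_freq n) (d := d)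
      (e := fun t => m (weighted ρ (vt₁ t) - weighted ρ (vt₂ t)))
      (Δ := fun t => mulReal ((freqSet l n).indicator (coupling l b))
        (N (fourierFun (u₁ t)) - N (fourierFun (u₂ t))))
      (by positivity) (fun t ht => ?_) (fun t ht => ?_) (fun t ht => ?_) hdc ?_ ?_ ?_ ht
    · have e1 := (h.hasDerivAt_proj_fourierFun hv₁ hd₁ n ht.1).sub
        (h.hasDerivAt_proj_fourierFun hv₂ hd₂ n ht.1)
      have e3 : mulOp (fun x => (((freqSet l n).indicator (freq l) x : ℝ) : ℂ))
          (m (weighted ρ (vt₁ t) - weighted ρ (vt₂ t))) =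
          mulReal ((freqSet l n).indicator (jap (-(r / 2 - 1)))) (hat _ (vt₁ t)) -
          mulReal ((freqSet l n).indicator (jap (-(r / 2 - 1)))) (hat _ (vt₂ t)) := by
        rw [← h.mulReal_freq_weighted, ← h.mulReal_freq_weighted, ← map_sub, ← map_sub]
        rfl
      rw [e3]
      refine e1.congr_of_eventuallyEq (Eventually.of_forall fun τ => ?_)
      simp only [hd, map_sub, Pi.sub_apply]
    · have e1 := (h.hasDerivAt_weighted hγ h0 hc₁ hsol₁ hgγ₁ ht).sub
        (h.hasDerivAt_weighted hγ h0 hc₂ hsol₂ hgγ₂ ht)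
      have e2 := (m.restrictScalars ℝ).hasFDerivAt.comp_hasDerivAt t e1
      have e3 : m (dispersionTerm ρ l (fourierFun (u₁ t)) +
          forcingTerm ρ l b (nonlin hγ h0 (fourierFun (u₁ t))) -
          (dispersionTerm ρ l (fourierFun (u₂ t)) +
          forcingTerm ρ l b (nonlin hγ h0 (fourierFun (u₂ t))))) =
          -mulReal ((freqSet l n).indicator (freq l)) (d t) -
          mulReal ((freqSet l n).indicator (coupling l b))
            (N (fourierFun (u₁ t)) - N (fourierFun (u₂ t))) := by
        rw [map_sub, hm, h.mulReal_inv_freq n, h.mulReal_inv_freq n, hd, map_sub, map_sub]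
        abel
      rw [ContinuousLinearMap.coe_restrictScalars', e3] at e2
      exact e2
    · have hΔ : ‖mulReal ((freqSet l n).indicator (coupling l b))
          (N (fourierFun (u₁ t)) - N (fourierFun (u₂ t)))‖ ≤
          C * ‖N (fourierFun (u₁ t)) - N (fourierFun (u₂ t))‖ :=
        norm_mulOp_le hbk (fun ξ => by
          rw [Complex.norm_real]
          exact (norm_indicator_le_norm_self _ _).trans (hC ξ)) _
      rw [mul_assoc]
      exact hΔ.trans (mul_le_mul_of_nonneg_left (hNl.norm_sub_le _ _) hC0.le)
    · exact m.continuous.comp_continuousOn ((hw hvc₁).sub (hw hvc₂))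
    · simp [hd, hi₁, hi₂]
    · simp [hvi₁, hvi₂]
  have hlim : ∀ t ∈ Icc 0 T, Real.exp (-(C * L) * t) * ‖d t‖ ^ 2 ≤
      (C * L) * ∫ τ in (0 : ℝ)..t, Real.exp (-(C * L) * τ) * ‖d τ‖ ^ 2 := fun t ht =>
    le_of_tendsto (((h.isExhaustion_freqSet.tendsto_proj (d t)).norm.pow 2).const_mul _)
      (Eventually.of_forall fun n => key n t ht)
  have hz := eq_zero_of_le_integral hT0
    (ContinuousOn.mul (Continuous.continuousOn (by fun_prop)) (hdc.norm.pow 2))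
    (fun t _ => mul_nonneg (Real.exp_pos _).le (sq_nonneg _)) hlim T ⟨hT0, le_rfl⟩
  have hz' : d T = 0 := by
    have := (mul_eq_zero.mp hz).resolve_left (Real.exp_pos _).ne'
    exact norm_eq_zero.mp (pow_eq_zero_iff two_ne_zero |>.mp this)
  refine (hat (r / 2 + ρ / 2)).injective ?_
  refine mulOp_injective (isBddSymbol_jap (s := -(r / 2 + ρ / 2)) (by linarith))
    (Eventually.of_forall fun ξ => ?_) (sub_eq_zero.mp hz')
  exact_mod_cast (jap_pos _ ξ).ne'

end Uniqueness

/-! ### Existence -/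

section RealParts

/-- The Fourier transform of the real part of a function, in terms of the Fourier transform of the
function. -/
def realPart : Lp ℂ 2 (volume : Measure ℝ) →L[ℝ] Lp ℂ 2 (volume : Measure ℝ) :=
  (2⁻¹ : ℂ) • (ContinuousLinearMap.id ℝ _ + conjRefl)

/-- The Fourier transform of the imaginary part of a function, in terms of the Fourier transform of
the function. -/
def imagPart : Lp ℂ 2 (volume : Measure ℝ) →L[ℝ] Lp ℂ 2 (volume : Measure ℝ) :=
  (-Complex.I / 2) • (ContinuousLinearMap.id ℝ _ - conjRefl)

theorem realPart_apply (W : Lp ℂ 2 (volume : Measure ℝ)) :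
    realPart W = (2⁻¹ : ℂ) • (W + conjRefl W) := rfl

theorem imagPart_apply (W : Lp ℂ 2 (volume : Measure ℝ)) :
    imagPart W = (-Complex.I / 2) • (W - conjRefl W) := rfl

theorem conjRefl_realPart (W : Lp ℂ 2 (volume : Measure ℝ)) :
    conjRefl (realPart W) = realPart W := by
  rw [realPart_apply, conjRefl_smul, map_add, conjRefl_conjRefl, add_comm]
  simp [Complex.conj_ofNat]

theorem conjRefl_imagPart (W : Lp ℂ 2 (volume : Measure ℝ)) :
    conjRefl (imagPart W) = imagPart W := by
  rw [imagPart_apply, conjRefl_smul, map_sub, conjRefl_conjRefl, ← neg_sub W, smul_neg, ← neg_smul]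
  congr 1
  simp [neg_div, Complex.conj_ofNat]

theorem realPart_of_conjRefl_eq {W : Lp ℂ 2 (volume : Measure ℝ)} (h : conjRefl W = W) :
    realPart W = W := by
  rw [realPart_apply, h, ← two_smul ℂ W, smul_smul]
  norm_num

theorem imagPart_of_conjRefl_eq {W : Lp ℂ 2 (volume : Measure ℝ)} (h : conjRefl W = W) :
    imagPart W = 0 := by
  rw [imagPart_apply, h, sub_self, smul_zero]

theorem realPart_neg_I_smul (W : Lp ℂ 2 (volume : Measure ℝ)) :
    realPart (-Complex.I • W) = imagPart W := by
  rw [realPart_apply, imagPart_apply, conjRefl_smul, map_neg, Complex.conj_I, neg_neg, neg_smul,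
    neg_add_eq_sub, ← neg_sub, ← smul_sub, smul_neg, smul_smul, ← neg_smul]
  congr 1
  ring

theorem imagPart_neg_I_smul (W : Lp ℂ 2 (volume : Measure ℝ)) :
    imagPart (-Complex.I • W) = -realPart W := by
  rw [realPart_apply, imagPart_apply, conjRefl_smul, map_neg, Complex.conj_I, neg_neg, neg_smul,
    ← neg_add', ← smul_add, smul_neg, smul_smul]
  congr 2
  linear_combination (-(1 : ℂ) / 2) * Complex.I_mul_I

theorem realPart_add_I_smul {W₁ W₂ : Lp ℂ 2 (volume : Measure ℝ)} (h₁ : conjRefl W₁ = W₁)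
    (h₂ : conjRefl W₂ = W₂) : realPart (W₁ + Complex.I • W₂) = W₁ := by
  have h3 : realPart (Complex.I • W₂) = 0 := by
    rw [realPart_apply, conjRefl_smul, Complex.conj_I, h₂, neg_smul, add_neg_cancel, smul_zero]
  rw [map_add, realPart_of_conjRefl_eq h₁, h3, add_zero]

theorem imagPart_add_I_smul {W₁ W₂ : Lp ℂ 2 (volume : Measure ℝ)} (h₁ : conjRefl W₁ = W₁)
    (h₂ : conjRefl W₂ = W₂) : imagPart (W₁ + Complex.I • W₂) = W₂ := by
  have h3 : imagPart (Complex.I • W₂) = W₂ := by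
    rw [imagPart_apply, conjRefl_smul, Complex.conj_I, h₂, neg_smul, sub_neg_eq_add,
      ← two_smul ℂ (Complex.I • W₂), smul_smul, smul_smul]
    have : -Complex.I / 2 * (2 * Complex.I) = 1 := by linear_combination -Complex.I_mul_I
    rw [mul_assoc, this, one_smul]
  rw [map_add, imagPart_of_conjRefl_eq h₁, h3, zero_add]

theorem norm_realPart_le (W : Lp ℂ 2 (volume : Measure ℝ)) : ‖realPart W‖ ≤ ‖W‖ := by
  rw [realPart_apply, norm_smul]
  have := (norm_add_le W (conjRefl W)).trans (add_le_add_right (norm_conjRefl_le W) _)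
  norm_num
  linarith

theorem mulReal_realPart {f : ℝ → ℝ} (hf : IsBddSymbol fun ξ => (f ξ : ℂ))
    (he : ∀ ξ, f (-ξ) = f ξ) (W : Lp ℂ 2 (volume : Measure ℝ)) :
    realPart (mulReal f W) = mulReal f (realPart W) := by
  rw [realPart_apply, realPart_apply, conjRefl_mulReal hf he, map_smul, map_add]

theorem mulReal_imagPart {f : ℝ → ℝ} (hf : IsBddSymbol fun ξ => (f ξ : ℂ))
    (he : ∀ ξ, f (-ξ) = f ξ) (W : Lp ℂ 2 (volume : Measure ℝ)) :
    imagPart (mulReal f W) = mulReal f (imagPart W) := by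
  rw [imagPart_apply, imagPart_apply, conjRefl_mulReal hf he, map_smul, map_sub]

theorem coeFn_fourierInv_realPart (W : Lp ℂ 2 (volume : Measure ℝ)) :
    ∀ᵐ x, ((𝓕⁻ (realPart W) : Lp ℂ 2 (volume : Measure ℝ)) x).re =
      ((𝓕⁻ W : Lp ℂ 2 (volume : Measure ℝ)) x).re := by
  have h1 : (𝓕⁻ (realPart W) : Lp ℂ 2 (volume : Measure ℝ)) =
      (2⁻¹ : ℂ) • (𝓕⁻ W + 𝓕⁻ (conjRefl W)) := by
    rw [realPart_apply]
    have e1 := map_smul (Lp.fourierTransformₗᵢ ℝ ℂ).symm (2⁻¹ : ℂ) (W + conjRefl W)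
    have e2 := map_add (Lp.fourierTransformₗᵢ ℝ ℂ).symm W (conjRefl W)
    exact e1.trans (congrArg _ e2)
  rw [h1]
  filter_upwards [Lp.coeFn_smul (2⁻¹ : ℂ) ((𝓕⁻ W : Lp ℂ 2 (volume : Measure ℝ)) +
      𝓕⁻ (conjRefl W)), Lp.coeFn_add (𝓕⁻ W : Lp ℂ 2 (volume : Measure ℝ)) (𝓕⁻ (conjRefl W)),
    coeFn_fourierInv_conjRefl W] with x h2 h3 h4
  rw [h2, Pi.smul_apply, h3, Pi.add_apply, h4, Complex.add_conj]
  simp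

end RealParts

section Existence

open Filter Topology

variable {ρ r : ℝ} {l b : ℝ → ℝ} {g : ℝ → ℝ}

theorem IsSymbolPair.freqSet_neg (h : IsSymbolPair ρ r l b) (n : ℕ) (ξ : ℝ) :
    -ξ ∈ freqSet l n ↔ ξ ∈ freqSet l n := by
  simp [freqSet, h.freq_neg]

theorem IsSymbolPair.indicator_neg (h : IsSymbolPair ρ r l b) (n : ℕ) {f : ℝ → ℝ}
    (hf : ∀ ξ, f (-ξ) = f ξ) (ξ : ℝ) :
    (freqSet l n).indicator f (-ξ) = (freqSet l n).indicator f ξ := by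
  by_cases hm : ξ ∈ freqSet l n
  · rw [indicator_of_mem hm, indicator_of_mem ((h.freqSet_neg n ξ).mpr hm), hf]
  · rw [indicator_of_notMem hm, indicator_of_notMem (mt (h.freqSet_neg n ξ).mp hm)]

/-- On bounded frequencies a mild solution is differentiable. -/
theorem IsSymbolPair.hasDerivAt_proj_mild (h : IsSymbolPair ρ r l b)
    {N : Lp ℂ 2 (volume : Measure ℝ) → Lp ℂ 2 (volume : Measure ℝ)}
    {Z : ℝ → Lp ℂ 2 (volume : Measure ℝ)} (hZ : IsMildSolution (freq l) (coupling l b) N Z)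
    (n : ℕ) (t : ℝ) :
    HasDerivAt (fun τ => mulReal ((freqSet l n).indicator fun _ => 1) (Z τ))
      (-Complex.I • (mulReal ((freqSet l n).indicator (freq l)) (Z t) +
        mulReal ((freqSet l n).indicator (coupling l b)) (N (Z t)))) t := by
  have hω := h.isOrder_freq.1
  have hA := h.isExhaustion_freqSet.measurableSet n
  obtain ⟨-, R, hR⟩ := h.isBddSymbol_freqSet h.isOrder_freq n
  have h1 := hasDerivAt_proj_flow_neg hω hA (R := R) (fun ξ hξ => by
    simpa [hξ] using hR ξ) (hZ t)
  simp only [flow_neg_flow hω, map_smul] at h1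
  have hk : IsBddSymbol fun ξ => (coupling l b ξ : ℂ) :=
    h.isOrder_coupling.isBddSymbol (by linarith [h.hrρ])
  have h2 : proj (freqSet l n) (mulOp (fun ξ => (coupling l b ξ : ℂ)) (N (Z t))) =
      mulReal ((freqSet l n).indicator (coupling l b)) (N (Z t)) :=
    mulOp_mulOp_eq (isBddSymbol_indicator_one hA) hk (fun ξ => by
      by_cases hm : ξ ∈ freqSet l n <;> simp [hm]) _
  rw [h2, ofReal_indicator] at h1
  simp only [mulReal_indicator_one]
  rw [smul_add, add_comm, neg_smul Complex.I (mulReal ((freqSet l n).indicator (freq l)) (Z t)),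
    ← sub_eq_add_neg]
  exact h1

/-- The real and the imaginary part of a mild solution solve a first order system. -/
theorem IsSymbolPair.hasDerivAt_proj_parts (h : IsSymbolPair ρ r l b)
    {N : Lp ℂ 2 (volume : Measure ℝ) → Lp ℂ 2 (volume : Measure ℝ)}
    (hN : ∀ W, conjRefl (N W) = N W)
    {Z : ℝ → Lp ℂ 2 (volume : Measure ℝ)} (hZ : IsMildSolution (freq l) (coupling l b) N Z)
    (n : ℕ) (t : ℝ) :
    HasDerivAt (fun τ => mulReal ((freqSet l n).indicator fun _ => 1) (realPart (Z τ)))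
      (mulReal ((freqSet l n).indicator (freq l)) (imagPart (Z t))) t ∧
    HasDerivAt (fun τ => mulReal ((freqSet l n).indicator fun _ => 1) (imagPart (Z τ)))
      (-(mulReal ((freqSet l n).indicator (freq l)) (realPart (Z t)) +
        mulReal ((freqSet l n).indicator (coupling l b)) (N (Z t)))) t := by
  have h1 := h.hasDerivAt_proj_mild hZ n t
  have hb1 : IsBddSymbol fun ξ => (((freqSet l n).indicator (fun _ => 1) ξ : ℝ) : ℂ) :=
    isBddSymbol_indicator_ofReal measurable_const (h.isExhaustion_freqSet.measurableSet n)
      (R := 1) (by simp)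
  have he1 := h.indicator_neg n (f := fun _ => 1) (fun _ => rfl)
  have hbω := h.isBddSymbol_freqSet h.isOrder_freq n
  have heω := h.indicator_neg n h.freq_neg
  have hbk := h.isBddSymbol_freqSet h.isOrder_coupling n
  have hek := h.indicator_neg n h.coupling_neg
  have h2 := realPart.hasFDerivAt.comp_hasDerivAt t h1
  have h3 := imagPart.hasFDerivAt.comp_hasDerivAt t h1
  rw [realPart_neg_I_smul, map_add, mulReal_imagPart hbω heω, mulReal_imagPart hbk hek,
    imagPart_of_conjRefl_eq (hN _), map_zero, add_zero] at h2
  rw [imagPart_neg_I_smul, map_add, mulReal_realPart hbω heω, mulReal_realPart hbk hek,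
    realPart_of_conjRefl_eq (hN _)] at h3
  simp only [Function.comp_def, mulReal_realPart hb1 he1] at h2
  simp only [Function.comp_def, mulReal_imagPart hb1 he1] at h3
  exact ⟨h2, h3⟩

/-- Multiplication of the derivative of a cut-off by a bounded symbol. -/
theorem IsSymbolPair.hasDerivAt_mulReal (h : IsSymbolPair ρ r l b) {f : ℝ → ℝ} {m : ℝ}
    (hf : IsOrder m f) {n : ℕ} {p : ℝ → Lp ℂ 2 (volume : Measure ℝ)}
    {p' : Lp ℂ 2 (volume : Measure ℝ)} {t : ℝ}
    (hp : HasDerivAt (fun τ => mulReal ((freqSet l n).indicator fun _ => 1) (p τ)) p' t) :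
    HasDerivAt (fun τ => mulReal ((freqSet l n).indicator f) (p τ))
      (mulReal ((freqSet l n).indicator f) p') t := by
  have hb1 : IsBddSymbol fun ξ => (((freqSet l n).indicator (fun _ => 1) ξ : ℝ) : ℂ) :=
    isBddSymbol_indicator_ofReal measurable_const (h.isExhaustion_freqSet.measurableSet n)
      (R := 1) (by simp)
  have hbf := h.isBddSymbol_freqSet hf n
  have h1 := ((mulReal ((freqSet l n).indicator f)).restrictScalars ℝ).hasFDerivAt.comp_hasDerivAt
    t hp
  refine h1.congr_of_eventuallyEq (Eventually.of_forall fun τ => ?_)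
  refine (mulReal_mulReal hbf hb1 (Eventually.of_forall fun ξ => ?_) hbf _).symm
  by_cases hm : ξ ∈ freqSet l n <;> simp [hm]

theorem mulReal_comp {f g k : ℝ → ℝ} (hf : IsBddSymbol fun ξ => (f ξ : ℂ))
    (hg : IsBddSymbol fun ξ => (g ξ : ℂ)) (hk : ∀ ξ, k ξ = f ξ * g ξ)
    (W : Lp ℂ 2 (volume : Measure ℝ)) : mulReal f (mulReal g W) = mulReal k W :=
  mulOp_mulOp_eq hf hg (fun ξ => by rw [hk, Complex.ofReal_mul]) W

theorem IsSymbolPair.isBddSymbol_amp (h : IsSymbolPair ρ r l b) :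
    IsBddSymbol fun ξ => (amp l b ξ : ℂ) :=
  h.isOrder_amp.isBddSymbol (by linarith [h.hs])

theorem IsSymbolPair.isBddSymbol_jap_amp (h : IsSymbolPair ρ r l b) {m : ℝ}
    (hm : m ≤ r / 2 + ρ / 2) : IsBddSymbol fun ξ => ((jap m ξ * amp l b ξ : ℝ) : ℂ) :=
  ((isOrder_jap m).mul h.isOrder_amp).isBddSymbol (by linarith)

theorem IsSymbolPair.isBddSymbol_jap_freq_amp (h : IsSymbolPair ρ r l b) {m : ℝ}
    (hm : m ≤ r / 2 - 1) : IsBddSymbol fun ξ => ((jap m ξ * (freq l ξ * amp l b ξ) : ℝ) : ℂ) :=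
  ((isOrder_jap m).mul (h.isOrder_freq.mul h.isOrder_amp)).isBddSymbol (by linarith)

/-- A mild solution of the first order equation, along which `g` and its truncation agree, gives a
solution of the Cauchy problem. -/
theorem IsSymbolPair.exists_isGlobalSolution_of_mild (h : IsSymbolPair ρ r l b) {γ : ℝ → ℝ}
    {L : NNReal} (hγ : LipschitzWith L γ) (h0 : γ 0 = 0)
    {Y : ℝ → Lp ℂ 2 (volume : Measure ℝ)} (hY : Continuous Y)
    (hZ : IsMildSolution (freq l) (coupling l b) (nonlin hγ h0)
      (fun t => mulReal (amp l b) (Y t)))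
    {φ : Sobolev (r / 2 + ρ / 2)} {ψ : Sobolev (r / 2 - 1)}
    (hφ : hat _ φ = mulReal (fun ξ => jap (r / 2 + ρ / 2) ξ * amp l b ξ) (realPart (Y 0)))
    (hψ : hat _ ψ =
      mulReal (fun ξ => jap (r / 2 - 1) ξ * (freq l ξ * amp l b ξ)) (imagPart (Y 0)))
    (hgγ : ∀ t, ∀ᵐ x,
      γ ((𝓕⁻ (mulReal (amp l b) (realPart (Y t))) : Lp ℂ 2 (volume : Measure ℝ)) x).re =
      g ((𝓕⁻ (mulReal (amp l b) (realPart (Y t))) : Lp ℂ 2 (volume : Measure ℝ)) x).re) :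
    ∃ u : ℝ → Sobolev (r / 2 + ρ / 2), IsGlobalSolution l b g φ ψ u := by
  have hr := h.hr
  have hρ := h.hρ
  have hs := h.hs
  set s := r / 2 + ρ / 2 with hsdef
  set σ := r / 2 - 1 with hσdef
  have hba := h.isBddSymbol_amp
  have hbs : IsBddSymbol fun ξ => ((jap s ξ * amp l b ξ : ℝ) : ℂ) := h.isBddSymbol_jap_amp le_rfl
  have hbv : IsBddSymbol fun ξ => ((jap σ ξ * amp l b ξ : ℝ) : ℂ) :=
    h.isBddSymbol_jap_amp (by linarith)
  have hbt : IsBddSymbol fun ξ => ((jap σ ξ * (freq l ξ * amp l b ξ) : ℝ) : ℂ) :=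
    h.isBddSymbol_jap_freq_amp le_rfl
  have hes : ∀ m ξ, jap m (-ξ) * amp l b (-ξ) = jap m ξ * amp l b ξ := fun m ξ => by
    rw [jap_neg, h.amp_neg]
  have het : ∀ ξ, jap σ (-ξ) * (freq l (-ξ) * amp l b (-ξ)) =
      jap σ ξ * (freq l ξ * amp l b ξ) := fun ξ => by rw [jap_neg, h.amp_neg, h.freq_neg]
  have hPc : Continuous fun t => realPart (Y t) := realPart.continuous.comp hY
  have hQc : Continuous fun t => imagPart (Y t) := imagPart.continuous.comp hY
  choose u hu using fun t => exists_hat_eq (s := s)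
    (W := mulReal (fun ξ => jap s ξ * amp l b ξ) (realPart (Y t)))
    (by rw [conjRefl_mulReal hbs (hes s), conjRefl_realPart])
  choose v hv using fun t => exists_hat_eq (s := σ)
    (W := mulReal (fun ξ => jap σ ξ * amp l b ξ) (realPart (Y t)))
    (by rw [conjRefl_mulReal hbv (hes σ), conjRefl_realPart])
  choose vt hvt using fun t => exists_hat_eq (s := σ)
    (W := mulReal (fun ξ => jap σ ξ * (freq l ξ * amp l b ξ)) (imagPart (Y t)))
    (by rw [conjRefl_mulReal hbt het, conjRefl_imagPart])
  have hp : ∀ t, fourierFun (u t) = mulReal (amp l b) (realPart (Y t)) := fun t => by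
    rw [fourierFun, hu]
    refine mulReal_comp (isBddSymbol_jap (by linarith)) hbs (fun ξ => ?_) _
    rw [← mul_assoc, jap_neg_mul, one_mul]
  have hRZ : ∀ t, realPart (mulReal (amp l b) (Y t)) = mulReal (amp l b) (realPart (Y t)) :=
    fun t => mulReal_realPart hba h.amp_neg _
  have hIZ : ∀ t, imagPart (mulReal (amp l b) (Y t)) = mulReal (amp l b) (imagPart (Y t)) :=
    fun t => mulReal_imagPart hba h.amp_neg _
  have hN : ∀ t, nonlin hγ h0 (mulReal (amp l b) (Y t)) = nonlin hγ h0 (fourierFun (u t)) :=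
    fun t => nonlin_congr hγ hγ h0 h0 (by
      rw [hp, ← hRZ]
      exact (coeFn_fourierInv_realPart _).mono fun x hx => by rw [hx])
  have hA := h.isExhaustion_freqSet
  have hparts := h.hasDerivAt_proj_parts (conjRefl_nonlin hγ h0) hZ
  simp only [hRZ, hIZ, hN, ← hp] at hparts
  have hb1 : ∀ n, IsBddSymbol fun ξ => (((freqSet l n).indicator (fun _ => 1) ξ : ℝ) : ℂ) :=
    fun n => isBddSymbol_indicator_ofReal measurable_const (hA.measurableSet n) (R := 1) (by simp)
  have hbσ := fun n => h.isBddSymbol_freqSet (isOrder_jap σ) n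
  have hbω := fun n => h.isBddSymbol_freqSet h.isOrder_freq n
  have hbk := fun n => h.isBddSymbol_freqSet h.isOrder_coupling n
  have hdv : ∀ t, HasDerivAt (fun τ => hat σ (v τ)) (hat σ (vt t)) t := by
    simp only [hv, hvt]
    refine hA.hasDerivAt ((mulReal _).continuous.comp hQc) fun n t => ?_
    have h1 := h.hasDerivAt_mulReal (isOrder_jap σ) (hparts n t).1
    simp only [hp, ← mulReal_indicator_one] at h1 ⊢
    convert h1 using 1
    · funext τ
      rw [mulReal_comp (hbσ n) hba (fun _ => rfl), mulReal_comp (hb1 n) hbv fun ξ => ?_]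
      by_cases hm : ξ ∈ freqSet l n <;> simp [hm]
    · rw [mulReal_comp (hbω n) hba (fun _ => rfl),
        mulReal_comp (hbσ n) ((hbω n).mul hba |> fun H => by simpa using H) (fun _ => rfl),
        mulReal_comp (hb1 n) hbt fun ξ => ?_]
      by_cases hm : ξ ∈ freqSet l n <;> simp [hm]
  have hpc : Continuous fun t => fourierFun (u t) := by
    simp only [hp]
    exact (mulReal _).continuous.comp hPc
  have hNc : Continuous (nonlin hγ h0) := (lipschitzWith_nonlin hγ h0).continuous
  have hdw : ∀ t, HasDerivAt (fun τ => weighted ρ (vt τ)) (dispersionTerm ρ l (fourierFun (u t)) +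
      forcingTerm ρ l b (nonlin hγ h0 (fourierFun (u t)))) t := by
    refine hA.hasDerivAt (H := fun t => dispersionTerm ρ l (fourierFun (u t)) +
      forcingTerm ρ l b (nonlin hγ h0 (fourierFun (u t))))
      (((dispersionTerm ρ l).continuous.comp hpc).add
      ((forcingTerm ρ l b).continuous.comp (hNc.comp hpc))) fun n t => ?_
    have hf := (isOrder_jap (-(2 + ρ))).mul h.isOrder_freq
    have hbf := h.isBddSymbol_freqSet hf n
    have h1 := h.hasDerivAt_mulReal hf (hparts n t).2
    have hj : IsBddSymbol fun ξ => (jap (-(2 + ρ) - σ) ξ : ℂ) :=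
      isBddSymbol_jap (by linarith)
    simp only [← mulReal_indicator_one]
    convert h1 using 1
    · funext τ
      rw [weighted, hvt, mulReal_comp hj hbt (k := fun ξ => jap (-(2 + ρ)) ξ *
          (freq l ξ * amp l b ξ)) fun ξ => ?_,
        mulReal_comp hbf hba (fun _ => rfl), mulReal_comp (hb1 n)
          (h.isBddSymbol_jap_freq_amp (by linarith)) fun ξ => ?_]
      · by_cases hm : ξ ∈ freqSet l n
        · simp only [hm, indicator_of_mem]
          ring
        · simp [hm]
      · rw [← mul_assoc (jap (-(2 + ρ) - σ) ξ), ← jap_add, sub_add_cancel]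
    · rw [map_neg, map_add, map_add, dispersionTerm, forcingTerm, neg_apply, neg_apply, map_neg,
        map_neg, mulReal_comp hbf (hbω n) (fun _ => rfl), mulReal_comp hbf (hbk n) (fun _ => rfl),
        mulReal_comp (hb1 n) h.isBddSymbol_dispersion fun ξ => ?_,
        mulReal_comp (hb1 n) h.isBddSymbol_forcing fun ξ => ?_, neg_add]
      · by_cases hm : ξ ∈ freqSet l n
        · simp only [hm, indicator_of_mem]
          ring
        · simp [hm]
      · by_cases hm : ξ ∈ freqSet l n
        · simp only [hm, indicator_of_mem]
          ring
        · simp [hm]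
  refine ⟨u, continuousOn_of_hat ?_, (hat s).injective ((hu 0).trans hφ.symm), v, vt,
    fun t _ => toDist_eq_of_hat ?_, fun t _ => hasDerivWithinAt_of_hat (hdv t).hasDerivWithinAt,
    continuousOn_of_hat ?_, (hat σ).injective ((hvt 0).trans hψ.symm),
    fun t _ => solvesAt_of_hasDerivAt h hγ h0 ?_ (hdw t)⟩
  · simp only [hu]
    exact ((mulReal _).continuous.comp hPc).continuousOn
  · rw [hu, hv]
    filter_upwards [coeFn_mulReal hbs (realPart (Y t)), coeFn_mulReal hbv (realPart (Y t))]
      with ξ h1 h2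
    rw [h1, h2, ← mul_assoc, ← Complex.ofReal_mul, ← mul_assoc, ← jap_add, sub_add_cancel]
  · simp only [hvt]
    exact ((mulReal _).continuous.comp hQc).continuousOn
  · rw [hp]
    exact hgγ t

/-- Existence, for initial data of finite energy. -/
theorem IsSymbolPair.exists_isGlobalSolution (h : IsSymbolPair ρ r l b) (hg : ContDiff ℝ 1 g)
    (hG : ∀ v : ℝ, 0 ≤ ∫ p in (0 : ℝ)..v, g p) {φ : Sobolev (r / 2 + ρ / 2)}
    {ψ : Sobolev (r / 2 - 1)} {W₁ W₂ : Lp ℂ 2 (volume : Measure ℝ)} (h₁ : conjRefl W₁ = W₁)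
    (h₂ : conjRefl W₂ = W₂)
    (hφ : hat _ φ = mulReal (fun ξ => jap (r / 2 + ρ / 2) ξ * amp l b ξ) W₁)
    (hψ : hat _ ψ = mulReal (fun ξ => jap (r / 2 - 1) ξ * (freq l ξ * amp l b ξ)) W₂) :
    ∃ u : ℝ → Sobolev (r / 2 + ρ / 2), IsGlobalSolution l b g φ ψ u := by
  have hs := h.hs
  set s := r / 2 + ρ / 2 with hsdef
  have hba := h.isBddSymbol_amp
  have hbs : IsBddSymbol fun ξ => ((jap s ξ * amp l b ξ : ℝ) : ℂ) := h.isBddSymbol_jap_amp le_rfl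
  obtain ⟨K, hK0, hK⟩ := exists_sobolev_bound hs
  obtain ⟨C₁, hC₁0, hC₁⟩ := ((isOrder_jap s).mul h.isOrder_amp).exists_abs_le (by linarith)
  obtain ⟨C₂, hC₂0, hC₂⟩ := h.isOrder_amp.exists_abs_le (by linarith)
  obtain ⟨C₃, hC₃0, hC₃⟩ := h.isOrder_coupling.exists_abs_le (by linarith [h.hrρ])
  -- The supremum of a function is controlled by the norm of its energy variable.
  have hbd : ∀ W : Lp ℂ 2 (volume : Measure ℝ), ∀ᵐ x,
      |((𝓕⁻ (mulReal (amp l b) (realPart W)) : Lp ℂ 2 (volume : Measure ℝ)) x).re| ≤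
        K * (C₁ * ‖W‖) := fun W => by
    have e : mulReal (amp l b) (realPart W) = mulOp (fun ξ => (jap (-s) ξ : ℂ))
        (mulReal (fun ξ => jap s ξ * amp l b ξ) (realPart W)) := by
      refine (mulReal_comp (f := jap (-s)) (isBddSymbol_jap (by linarith)) hbs (fun ξ => ?_) _).symm
      rw [← mul_assoc, jap_neg_mul, one_mul]
    rw [e]
    refine (hK _).mono fun x hx => (Complex.abs_re_le_norm _).trans (hx.trans ?_)
    refine mul_le_mul_of_nonneg_left ?_ hK0
    refine (norm_mulOp_le hbs (fun ξ => ?_) _).trans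
      (mul_le_mul_of_nonneg_left (norm_realPart_le W) hC₁0.le)
    rw [Complex.norm_real]
    exact hC₁ ξ
  set Y₀ := W₁ + Complex.I • W₂ with hY₀
  -- The initial energy does not depend on the truncation.
  set E : ℝ := ‖Y₀‖ ^ 2 / 2 + ∫ x, ∫ p in (0 : ℝ)..
    ((𝓕⁻ (mulReal (amp l b) (realPart Y₀)) : Lp ℂ 2 (volume : Measure ℝ)) x).re, g p with hE
  set M : ℝ := K * (C₁ * √(2 * E)) with hM
  have hE0 : ‖Y₀‖ ≤ √(2 * E) := by
    refine Real.le_sqrt_of_sq_le ?_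
    have : 0 ≤ ∫ x, ∫ p in (0 : ℝ)..((𝓕⁻ (mulReal (amp l b) (realPart Y₀)) :
      Lp ℂ 2 (volume : Measure ℝ)) x).re, g p := integral_nonneg fun x => hG _
    rw [hE]
    linarith
  have hM0 : 0 ≤ M := by positivity
  obtain ⟨γ, L, hγ, hγg, hγG⟩ := exists_lipschitz_truncation hg hG hM0
  have h0 : γ 0 = 0 := by
    rw [hγg 0 ⟨by linarith, hM0⟩, eq_zero_of_primitive_nonneg hg.continuous hG]
  obtain ⟨Y, hY, hYi, hZ, hen⟩ := exists_isMildSolution_energy h.isOrder_freq.1 h.isOrder_amp.1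
    h.amp_pos (fun ξ => (le_abs_self _).trans (hC₂ ξ)) h.isOrder_coupling.1 (C := C₃.toNNReal)
    (fun ξ => by rw [Real.coe_toNNReal _ hC₃0.le]; exact hC₃ ξ) (fun ξ => rfl)
    (hasPotential_nonlin hγ h0 hγG) Y₀
  have hpot : potential γ (mulReal (amp l b) Y₀) = E - ‖Y₀‖ ^ 2 / 2 := by
    rw [hE, add_sub_cancel_left]
    refine integral_congr_ae ?_
    have e1 := coeFn_fourierInv_realPart (mulReal (amp l b) Y₀)
    rw [mulReal_realPart hba h.amp_neg] at e1
    filter_upwards [e1, hbd Y₀] with x hx1 hx2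
    rw [← hx1]
    have hx3 := abs_le.mp (hx2.trans (mul_le_mul_of_nonneg_left
      (mul_le_mul_of_nonneg_left hE0 hC₁0.le) hK0))
    refine intervalIntegral.integral_congr fun p hp => hγg p ?_
    exact uIcc_subset_Icc ⟨by linarith, hM0⟩ hx3 hp
  have hYle : ∀ t, ‖Y t‖ ≤ √(2 * E) := fun t => by
    refine Real.le_sqrt_of_sq_le ?_
    have e1 := hen t
    have e2 := (hasPotential_nonlin hγ h0 hγG).nonneg (mulReal (amp l b) (Y t))
    have e3 : potential γ (mulOp (fun x => (amp l b x : ℂ)) Y₀) = E - ‖Y₀‖ ^ 2 / 2 := hpot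
    have e4 : 0 ≤ potential γ (mulOp (fun x => (amp l b x : ℂ)) (Y t)) := e2
    rw [e3] at e1
    linarith
  refine h.exists_isGlobalSolution_of_mild hγ h0 hY hZ ?_ ?_ fun t => ?_
  · rw [hYi, hY₀, realPart_add_I_smul h₁ h₂]
    exact hφ
  · rw [hYi, hY₀, imagPart_add_I_smul h₁ h₂]
    exact hψ
  · refine (hbd (Y t)).mono fun x hx => hγg _ (abs_le.mp (hx.trans ?_))
    exact mul_le_mul_of_nonneg_left (mul_le_mul_of_nonneg_left (hYle t) hC₁0.le) hK0

end Existence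

/-! ### Finiteness of the initial energy -/

section InitialData

open Filter Topology

variable {ρ r : ℝ} {l b : ℝ → ℝ}

/-- Division by an even symbol `c` preserves the Fourier transforms of real functions. -/
theorem exists_mulReal_eq {c : ℝ → ℝ} (hc : IsBddSymbol fun ξ => (c ξ : ℂ))
    (he : ∀ ξ, c (-ξ) = c ξ) (h0 : ∀ᵐ ξ, c ξ ≠ 0) {H : Lp ℂ 2 (volume : Measure ℝ)}
    (hH : conjRefl H = H) (hm : MemLp (fun ξ => (((c ξ)⁻¹ : ℝ) : ℂ) * H ξ) 2) :
    ∃ W, conjRefl W = W ∧ H = mulReal c W := by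
  have h1 : H = mulReal c (hm.toLp _) := by
    refine Lp.ext ?_
    filter_upwards [coeFn_mulReal hc (hm.toLp _), hm.coeFn_toLp, h0] with ξ e1 e2 e3
    rw [e1, e2, ← mul_assoc, ← Complex.ofReal_mul, mul_inv_cancel₀ e3, Complex.ofReal_one, one_mul]
  refine ⟨hm.toLp _, ?_, h1⟩
  refine mulOp_injective hc (h0.mono fun ξ hξ => by exact_mod_cast hξ) ?_
  have h2 := conjRefl_mulReal hc he (hm.toLp _)
  rw [← h1, hH] at h2
  exact h2.symm.trans h1

theorem MultiplierMemL2.memLp {m : ℝ → ℝ} {s : ℝ} {u : Sobolev s}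
    (h : MultiplierMemL2 m u.toDist) :
    MemLp (fun ξ => (m (2 * Real.pi * ξ) : ℂ) * ((jap (-s) ξ : ℂ) * hat s u ξ)) 2 := by
  obtain ⟨w, hw⟩ := h
  exact (memLp_congr_ae ((hw.representedBy (representedBy_hat u)).ae_eq
    (representedBy_fourier w))).mpr (Lp.memLp _)

theorem rpow_neg_half {x : ℝ} (hx : 0 ≤ x) : x ^ (-1 / 2 : ℝ) = (√x)⁻¹ := by
  rw [neg_div, Real.rpow_neg hx, Real.sqrt_eq_rpow]

theorem inv_jap (s ξ : ℝ) : (jap s ξ)⁻¹ = jap (-s) ξ :=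
  inv_eq_of_mul_eq_one_left (jap_neg_mul s ξ)

theorem IsSymbolPair.inv_amp (h : IsSymbolPair ρ r l b) (ξ : ℝ) :
    (amp l b ξ)⁻¹ = b (2 * Real.pi * ξ) ^ (-1 / 2 : ℝ) * √(l (2 * Real.pi * ξ)) := by
  rw [rpow_neg_half (h.b_pos _).le, amp, Real.sqrt_div (h.b_pos _).le, inv_div, div_eq_inv_mul]

theorem IsSymbolPair.inv_freq_mul_amp (h : IsSymbolPair ρ r l b) (ξ : ℝ) :
    (freq l ξ * amp l b ξ)⁻¹ = b (2 * Real.pi * ξ) ^ (-1 / 2 : ℝ) * |2 * Real.pi * ξ|⁻¹ := by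
  have h1 : √(l (2 * Real.pi * ξ)) ≠ 0 := (Real.sqrt_pos.mpr (h.l_pos _)).ne'
  rw [rpow_neg_half (h.b_pos _).le, freq, amp, Real.sqrt_div (h.b_pos _).le, ← mul_inv]
  congr 1
  field_simp

/-- The hypothesis that the energy is finite, in terms of the variables of the first order
system. -/
theorem IsSymbolPair.exists_initial (h : IsSymbolPair ρ r l b) {φ : Sobolev (r / 2 + ρ / 2)}
    {ψ : Sobolev (r / 2 - 1)}
    (hφ : MemLp (fun ξ => ((b (2 * Real.pi * ξ) ^ (-1 / 2 : ℝ) * √(l (2 * Real.pi * ξ)) : ℝ) : ℂ) *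
      ((jap (-(r / 2 + ρ / 2)) ξ : ℂ) * hat _ φ ξ)) 2)
    (hψ : MemLp (fun ξ => ((b (2 * Real.pi * ξ) ^ (-1 / 2 : ℝ) * |2 * Real.pi * ξ|⁻¹ : ℝ) : ℂ) *
      ((jap (-(r / 2 - 1)) ξ : ℂ) * hat _ ψ ξ)) 2) :
    (∃ W, conjRefl W = W ∧
      hat _ φ = mulReal (fun ξ => jap (r / 2 + ρ / 2) ξ * amp l b ξ) W) ∧
    ∃ W, conjRefl W = W ∧
      hat _ ψ = mulReal (fun ξ => jap (r / 2 - 1) ξ * (freq l ξ * amp l b ξ)) W := by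
  constructor
  · refine exists_mulReal_eq (h.isBddSymbol_jap_amp le_rfl)
      (fun ξ => by rw [jap_neg, h.amp_neg]) (Eventually.of_forall fun ξ =>
        (mul_pos (jap_pos _ ξ) (h.amp_pos ξ)).ne') (conjRefl_hat φ) ?_
    convert hφ using 2 with ξ
    rw [mul_inv, h.inv_amp, inv_jap, mul_comm (jap _ ξ), Complex.ofReal_mul, mul_assoc]
  · refine exists_mulReal_eq (h.isBddSymbol_jap_freq_amp le_rfl)
      (fun ξ => by rw [jap_neg, h.freq_neg, h.amp_neg]) (h.ae_freq_ne_zero.mono fun ξ hξ =>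
        mul_ne_zero (jap_pos _ ξ).ne' (mul_ne_zero hξ (h.amp_pos ξ).ne')) (conjRefl_hat ψ) ?_
    convert hψ using 2 with ξ
    rw [mul_inv, h.inv_freq_mul_amp, inv_jap, mul_comm (jap _ ξ), Complex.ofReal_mul, mul_assoc]

theorem IsSymbolPair.isOrder_inv_sqrt_b (h : IsSymbolPair ρ r l b)
    (hell : ∃ c₄ > (0 : ℝ), ∀ ξ : ℝ, c₄ ^ 2 * (1 + ξ ^ 2) ^ (-r / 2) ≤ b ξ) :
    IsOrder (r / 2) (fun ξ => b (2 * Real.pi * ξ) ^ (-1 / 2 : ℝ)) := by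
  obtain ⟨c, hc0, hc⟩ := hell
  have e : IsOrder (r / 2) (fun ξ => b ξ ^ (-1 / 2 : ℝ)) := by
    refine ⟨h.hb_meas.pow_const _, c⁻¹, fun ξ => ?_⟩
    have h1 : c * jap (-r / 2) ξ ≤ √(b ξ) := by
      rw [← sqrt_jap, ← Real.sqrt_sq hc0.le, ← Real.sqrt_mul (sq_nonneg _), jap_eq]
      exact Real.sqrt_le_sqrt (hc ξ)
    simp only
    rw [rpow_neg_half (h.b_pos _).le, abs_of_nonneg (by positivity),
      show r / 2 = -(-r / 2) by ring, ← inv_jap, ← mul_inv]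
    exact inv_anti₀ (mul_pos hc0 (jap_pos _ _)) h1
  exact e.dilation

/-- For an elliptic `B` the initial energy is finite. -/
theorem IsSymbolPair.memLp_of_elliptic (h : IsSymbolPair ρ r l b)
    (hell : ∃ c₄ > (0 : ℝ), ∀ ξ : ℝ, c₄ ^ 2 * (1 + ξ ^ 2) ^ (-r / 2) ≤ b ξ)
    (φ : Sobolev (r / 2 + ρ / 2)) {ψ : Sobolev (r / 2 - 1)}
    (hψ : MultiplierMemL2 (fun ξ => |ξ|⁻¹) ψ.toDist) :
    MemLp (fun ξ => ((b (2 * Real.pi * ξ) ^ (-1 / 2 : ℝ) * √(l (2 * Real.pi * ξ)) : ℝ) : ℂ) *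
      ((jap (-(r / 2 + ρ / 2)) ξ : ℂ) * hat _ φ ξ)) 2 ∧
    MemLp (fun ξ => ((b (2 * Real.pi * ξ) ^ (-1 / 2 : ℝ) * |2 * Real.pi * ξ|⁻¹ : ℝ) : ℂ) *
      ((jap (-(r / 2 - 1)) ξ : ℂ) * hat _ ψ ξ)) 2 := by
  have hb := h.isOrder_inv_sqrt_b hell
  constructor
  · have h1 := ((hb.mul h.isOrder_sqrt_l).mul (isOrder_jap (-(r / 2 + ρ / 2)))).isBddSymbol
      (by linarith)
    refine (h1.memLp (hat _ φ)).ae_eq (Eventually.of_forall fun ξ => ?_)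
    push_cast
    ring
  · obtain ⟨C, hC0, hC⟩ := hb.exists_pos
    -- For `|ξ| ≥ 1` the regularity of `ψ` suffices, for `|ξ| ≤ 1` the function is comparable to
    -- the Fourier transform of `Λ⁻¹ψ`.
    have h1 := ((Lp.memLp (hat _ ψ)).norm.const_mul C).add
      (hψ.memLp.norm.const_mul (C * jap (r / 2) 1))
    refine h1.mono' ?_ (Eventually.of_forall fun ξ => ?_)
    · refine (Complex.measurable_ofReal.comp (hb.1.mul ?_)).aestronglyMeasurable.mul
        ((Complex.measurable_ofReal.comp (measurable_jap _)).aestronglyMeasurable.mul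
          (Lp.aestronglyMeasurable _))
      fun_prop
    · have hj := jap_pos (-(r / 2 - 1)) ξ
      have hbn : 0 ≤ b (2 * Real.pi * ξ) ^ (-1 / 2 : ℝ) := Real.rpow_nonneg (h.b_pos _).le _
      have hq : 0 ≤ |2 * Real.pi * ξ|⁻¹ := by positivity
      have hpi := Real.two_le_pi
      simp only [Pi.add_apply, norm_mul, Complex.norm_real, Real.norm_eq_abs, abs_abs, abs_inv,
        abs_of_pos hj, abs_of_nonneg hbn]
      set H : ℂ := hat (r / 2 - 1) ψ ξ
      have hbC : b (2 * Real.pi * ξ) ^ (-1 / 2 : ℝ) ≤ C * jap (r / 2) ξ :=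
        (le_abs_self _).trans (hC ξ)
      have hHn := norm_nonneg H
      have h2 : b (2 * Real.pi * ξ) ^ (-1 / 2 : ℝ) * |2 * Real.pi * ξ|⁻¹ *
          (jap (-(r / 2 - 1)) ξ * ‖H‖) ≤
          C * jap (r / 2) ξ * |2 * Real.pi * ξ|⁻¹ * (jap (-(r / 2 - 1)) ξ * ‖H‖) := by
        gcongr
      refine h2.trans ?_
      rcases le_total |ξ| 1 with h3 | h3
      · have h4 : jap (r / 2) ξ ≤ jap (r / 2) 1 := by
          rw [jap_eq, jap_eq]
          refine Real.rpow_le_rpow (by positivity) ?_ (by linarith [h.hr])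
          have := sq_le_one_iff_abs_le_one ξ |>.mpr h3
          linarith
        have h5 : C * jap (r / 2) ξ * |2 * Real.pi * ξ|⁻¹ * (jap (-(r / 2 - 1)) ξ * ‖H‖) ≤
            C * jap (r / 2) 1 * |2 * Real.pi * ξ|⁻¹ * (jap (-(r / 2 - 1)) ξ * ‖H‖) := by
          gcongr
        have h6 : 0 ≤ C * ‖H‖ := by positivity
        rw [mul_assoc _ _⁻¹] at h5
        linarith
      · have h4 : jap 1 ξ ≤ |2 * Real.pi * ξ| := by
          rw [show (1 : ℝ) = 2 / 2 by norm_num, ← sqrt_jap, jap_two]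
          refine Real.sqrt_le_iff.mpr ⟨abs_nonneg _, ?_⟩
          rw [sq_abs]
          have h5 : 1 ≤ ξ ^ 2 := by nlinarith [sq_abs ξ]
          have h6 : 2 ≤ (2 * Real.pi) ^ 2 := by nlinarith
          nlinarith
        have h5 : jap (r / 2) ξ * jap (-(r / 2 - 1)) ξ = jap 1 ξ := by
          rw [← jap_add]; congr 1; ring
        have h6 : jap 1 ξ * |2 * Real.pi * ξ|⁻¹ ≤ 1 := by
          rw [← div_eq_mul_inv]
          exact div_le_one_of_le₀ h4 (abs_nonneg _)
        have h7 : C * jap (r / 2) ξ * |2 * Real.pi * ξ|⁻¹ * (jap (-(r / 2 - 1)) ξ * ‖H‖) =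
            C * ‖H‖ * (jap 1 ξ * |2 * Real.pi * ξ|⁻¹) := by
          rw [← h5]; ring
        rw [h7]
        have h8 : 0 ≤ C * jap (r / 2) 1 * (|2 * Real.pi * ξ|⁻¹ * (jap (-(r / 2 - 1)) ξ * ‖H‖)) := by
          have := jap_pos (r / 2) 1
          positivity
        have h9 : C * ‖H‖ * (jap 1 ξ * |2 * Real.pi * ξ|⁻¹) ≤ C * ‖H‖ * 1 := by gcongr
        linarith

end InitialData

end DoublyDispersive

end

theorem theorem6p3 (ρ r : ℝ) (hρ : 0 ≤ ρ) (hr : 0 ≤ r)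
    (hrρ : 1 ≤ r + ρ / 2) (hs : 1 / 2 < r / 2 + ρ / 2)
    (l b : ℝ → ℝ) (hl_meas : Measurable l) (hb_meas : Measurable b)
    (hl_even : ∀ ξ, l (-ξ) = l ξ) (hb_even : ∀ ξ, b (-ξ) = b ξ)
    (hl : ∃ c₁ > (0 : ℝ), ∃ c₂ > (0 : ℝ), ∀ ξ : ℝ,
      c₁ ^ 2 * (1 + ξ ^ 2) ^ (ρ / 2) ≤ l ξ ∧ l ξ ≤ c₂ ^ 2 * (1 + ξ ^ 2) ^ (ρ / 2))
    (hb : ∃ c₃ > (0 : ℝ), ∀ ξ : ℝ, 0 < b ξ ∧ b ξ ≤ c₃ ^ 2 * (1 + ξ ^ 2) ^ (-r / 2))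
    (g : ℝ → ℝ) (hg : ContDiff ℝ ((⌊r / 2 + ρ / 2⌋₊ + 1 : ℕ) : WithTop ℕ∞) g)
    (φ : DoublyDispersive.Sobolev (r / 2 + ρ / 2)) (ψ : DoublyDispersive.Sobolev (r / 2 - 1))
    (hψ : DoublyDispersive.MultiplierMemL2 (fun ξ => |ξ|⁻¹) ψ.toDist)
    (hell : (∃ c₄ > (0 : ℝ), ∀ ξ : ℝ, c₄ ^ 2 * (1 + ξ ^ 2) ^ (-r / 2) ≤ b ξ) ∨
      (DoublyDispersive.MultiplierMemL2 (fun ξ => b ξ ^ (-1 / 2 : ℝ) * √(l ξ)) φ.toDist ∧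
        DoublyDispersive.MultiplierMemL2 (fun ξ => b ξ ^ (-1 / 2 : ℝ) * |ξ|⁻¹) ψ.toDist))
    (hG_int : ∃ f : ℝ → ℝ, DoublyDispersive.RepresentedBy φ.toDist (fun x => (f x : ℂ)) ∧
      Integrable (fun x => ∫ p in (0 : ℝ)..(f x), g p))
    (hG : ∀ v : ℝ, 0 ≤ ∫ p in (0 : ℝ)..v, g p) :
    ∃ u : ℝ → DoublyDispersive.Sobolev (r / 2 + ρ / 2),
      DoublyDispersive.IsGlobalSolution l b g φ ψ u ∧
      ∀ u' : ℝ → DoublyDispersive.Sobolev (r / 2 + ρ / 2),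
        DoublyDispersive.IsGlobalSolution l b g φ ψ u' → Set.EqOn u' u (Set.Ici 0) := by
  have h : DoublyDispersive.IsSymbolPair ρ r l b :=
    ⟨hρ, hr, hrρ, hs, hl_meas, hb_meas, hl_even, hb_even, hl, hb⟩
  have hg1 : ContDiff ℝ 1 g := hg.of_le (by exact_mod_cast Nat.le_add_left 1 _)
  have hfin := hell.elim (fun hell => h.memLp_of_elliptic hell φ hψ)
    fun hen => ⟨hen.1.memLp, hen.2.memLp⟩
  obtain ⟨⟨W₁, hW₁, hφW⟩, W₂, hW₂, hψW⟩ := h.exists_initial hfin.1 hfin.2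
  obtain ⟨u, hu⟩ := h.exists_isGlobalSolution hg1 hG hW₁ hW₂ hφW hψW
  exact ⟨u, hu, fun u' hu' => h.unique hg1 hG hu' hu⟩
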